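/- Let $n$ be the dimension and let $u:\mathbb R^n\times\mathbb R\to\mathbb R$ be a global strong solution of $$u_t-\Delta u=\chi_{\{u>0\}}\quad\text{in }\mathbb R^n\times(-\infty,\infty),$$ that is, $u$ is continuous, its weak derivatives $\nabla u$, $D^2u$ (in the spatial variable $x$) and $u_t$ exist and belong to $L^2_{\rm loc}$, and the equation holds almost everywhere. Assume that $u$ has quadratic growth: there is a constant $C$ with $$\sup_{Q_R}|u|\le CR^2\quad\text{for all }R>0,\qquad Q_R:=\{(x,t):|x|+|t|^{1/2}<R\}.$$ For $r>0$ let $T_r:=\mathbb R^n\times(-4r^2,-r^2)$, let $$G(x,t):=\frac1{(4\pi(-t))^{n/2}}\,e^{-|x|^2/(-4t)}\qquad(t<0)$$ be the backward heat kernel, and define $$\Psi(r,u):=\frac1{r^4}\int_{T_r}\Big(|\nabla u|^2-2\max\{u,0\}+\frac{u^2}{t}\Big)G(x,t)\,dx\,dt .$$ Then $|\nabla u|^2G$, $\max\{u,0\}G$, $\frac{u^2}{t}G$ and $\frac1{-t}(2tu_t+\langle\nabla u,x\rangle-2u)^2G$ are integrable on $T_r$ for every $r>0$. For every $r>0$ the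 function $\Psi(\cdot,u)$ is differentiable at $r$ with $$\frac{d}{dr}\Psi(r,u)=r^{-5}\int_{T_r}\frac1{-t}\big(2tu_t+\langle\nabla u,x\rangle-2u\big)^2G(x,t)\,dx\,dt\ \ge 0 .$$ Consequently $\Psi(r,u)$ is nondecreasing in $r\in(0,\infty)$, and $\lim_{r\to0^+}\Psi(r,u)$ exists and is finite. Moreover, $\Psi(\cdot,u)$ is constant on $(0,\infty)$ if and only if $u(rx,r^2t)=r^2u(x,t)$ for all $r>0$, all $x\in\mathbb R^n$ and all $t<0$. -/

import Mathlib

open MeasureTheory Set Filter Topology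

/-- Space-time `ℝⁿ × ℝ`, a point being written `(x, t)`. -/
abbrev SpaceTime (n : ℕ) : Type := EuclideanSpace ℝ (Fin n) × ℝ

/-- The spatial coordinate direction `∂/∂xᵢ` in space-time. -/
noncomputable def dirX {n : ℕ} (i : Fin n) : SpaceTime n := (EuclideanSpace.single i 1, 0)

/-- The time direction `∂/∂t` in space-time. -/
def dirT (n : ℕ) : SpaceTime n := (0, 1)

/-- `g` is the weak (distributional) derivative of `f` in the direction `v`, on all of space-time:
both are locally integrable and `∫ f ∂ᵥφ = - ∫ g φ` for every test function `φ`. -/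
structure HasWeakDeriv {n : ℕ} (f : SpaceTime n → ℝ) (v : SpaceTime n) (g : SpaceTime n → ℝ) :
    Prop where
  locInt_fun : LocallyIntegrable f volume
  locInt_deriv : LocallyIntegrable g volume
  integral_eq : ∀ φ : SpaceTime n → ℝ, ContDiff ℝ (⊤ : ℕ∞) φ → HasCompactSupport φ →
    ∫ z, f z * fderiv ℝ φ z v = - ∫ z, g z * φ z

/-- `f` is square integrable on every compact subset of space-time. -/
def LocallyL2 {n : ℕ} (f : SpaceTime n → ℝ) : Prop :=
  ∀ K : Set (SpaceTime n), IsCompact K → MemLp f 2 (volume.restrict K)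

/-- `u` is a global strong solution of `u_t - Δu = χ_{u > 0}` in `ℝⁿ × (-∞, ∞)`: `u` is continuous,
its weak derivatives `∇u = Du`, `D²u = D2u` and `u_t = ut` exist and are locally square
integrable, and the equation holds almost everywhere. -/
structure IsGlobalSolution {n : ℕ} (u : SpaceTime n → ℝ)
    (Du : SpaceTime n → EuclideanSpace ℝ (Fin n)) (D2u : Fin n → Fin n → SpaceTime n → ℝ)
    (ut : SpaceTime n → ℝ) : Prop where
  continuous : Continuous u
  weak_gradient : ∀ i, HasWeakDeriv u (dirX i) (fun z => Du z i)
  weak_hessian : ∀ i j, HasWeakDeriv (fun z => Du z i) (dirX j) (D2u i j)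
  weak_time : HasWeakDeriv u (dirT n) ut
  gradient_L2 : ∀ i, LocallyL2 (fun z => Du z i)
  hessian_L2 : ∀ i j, LocallyL2 (D2u i j)
  time_L2 : LocallyL2 ut
  equation : ∀ᵐ z : SpaceTime n,
    ut z - ∑ i, D2u i i z = {w | 0 < u w}.indicator (fun _ => (1 : ℝ)) z

/-- The parabolic neighborhood `Q_R = {(x, t) : |x| + |t|^{1/2} < R}` of the origin. -/
def paraCyl (n : ℕ) (R : ℝ) : Set (SpaceTime n) := {z | ‖z.1‖ + √|z.2| < R}

/-- Quadratic growth: `sup_{Q_R} |u| ≤ C R²` for all `R > 0`, with a constant `C`. -/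
def QuadraticGrowth {n : ℕ} (u : SpaceTime n → ℝ) : Prop :=
  ∃ C : ℝ, ∀ R : ℝ, 0 < R → ∀ z ∈ paraCyl n R, |u z| ≤ C * R ^ 2

/-- The strip `T_r = ℝⁿ × (-4r², -r²)`. -/
def strip (n : ℕ) (r : ℝ) : Set (SpaceTime n) := {z | -4 * r ^ 2 < z.2 ∧ z.2 < -r ^ 2}

/-- The backward heat kernel
`G(x, t) = (4π(-t))^{-n/2} exp(-|x|² / (-4t))`; it is used for `t < 0` only. -/
noncomputable def backwardHeatKernel {n : ℕ} (z : SpaceTime n) : ℝ :=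
  1 / (4 * Real.pi * (-z.2)) ^ ((n : ℝ) / 2) * Real.exp (-‖z.1‖ ^ 2 / (-4 * z.2))

/-- The Weiss functional
`Ψ(r, u) = r⁻⁴ ∫_{T_r} (|∇u|² - 2 max{u, 0} + u² / t) G dx dt`, where `Du = ∇u`. -/
noncomputable def weissPsi {n : ℕ} (u : SpaceTime n → ℝ)
    (Du : SpaceTime n → EuclideanSpace ℝ (Fin n)) (r : ℝ) : ℝ :=
  1 / r ^ 4 * ∫ z in strip n r,
    (‖Du z‖ ^ 2 - 2 * max (u z) 0 + u z ^ 2 / z.2) * backwardHeatKernel z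

/-- The density `(1 / (-t)) (2 t u_t + ⟨∇u, x⟩ - 2u)² G` where `Du = ∇u` and `ut = u_t`. -/
noncomputable def weissDensity {n : ℕ} (u : SpaceTime n → ℝ)
    (Du : SpaceTime n → EuclideanSpace ℝ (Fin n)) (ut : SpaceTime n → ℝ) (z : SpaceTime n) : ℝ :=
  1 / (-z.2) * (2 * z.2 * ut z + inner ℝ (Du z) z.1 - 2 * u z) ^ 2 * backwardHeatKernel z

/-! For `s > 0` put `U(y, s) = u(s y, -s²)`, and let `γ` be the Gaussian measure with density
`(4π)^{-n/2} exp(-|y|²/4)`. In these coordinates `G dx dt` becomes `2s ds dγ(y)` and `T_r` becomes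
the shell `r < s < 2r`. Hence `Ψ(r) = r⁻⁴ ∫_r^{2r} (2/s) M(s) ds` with `M(s) = ∫ (|∇U|² - U² - 2s²
max(U, 0)) dγ`, and `Ψ'(r) = r⁻⁵ ∫_r^{2r} s⁻¹ (2s M' - 8M) ds` (`hasDerivAt_shell_average`). The
equation with right-hand side `f` reads `s U_s + 2 L U = -2s² f`, where `L = Δ - ½ y·∇` is symmetric
with respect to `γ`. Green's formula (`integral_green`) turns the gradient terms of `M` and `M'`
into terms with `LU`, which the equation eliminates. What is left is the integral of `2(s U_s -
2U)²`, plus multiples of `(f - β'(U)) U_s` and `β(U) - U f`, where `β` is the positive part; both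
vanish for `f = χ_{U > 0}`. Finally `s U_s - 2U = 2t u_t + ⟨∇u, x⟩ - 2u`.

This computation needs smoothness, and control at infinity that the local `L²` conditions on the
derivatives do not give. Mollifications of `u` solve the equation with mollified sources and have
derivatives of polynomial growth, so for them the computation is exact when a `C¹` ramp `β` replaces
the positive part (`hasDerivAt_weiss_smooth`). Energy estimates in Gaussian space
(`integral_shell_gradSq_le`, `integral_shell_time_sq_le`), applied to differences of two
mollifications, show that the gradients and `s`-derivatives are Cauchy in `L²` of every shell;
almost everywhere convergence identifies the limits (`Approximates.lpLim_grad`,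
`Approximates.lpLim_time`). Removing the mollification and afterwards the smoothing of the ramp
gives `Approximates.hasDerivAt_weissAverage`, and the integrability claims come with it.

For the limit at zero, dropping `|∇U|²` and using quadratic growth bounds the monotone function `Ψ`
from below (`Approximates.exists_le_weissAverage`). If `Ψ` is constant, then `s U_s = 2U` almost
everywhere, so `U / s²` does not depend on `s` (`Approximates.homogeneous_of_dev_eq_zero`).
Conversely, for homogeneous `u` the energy identity evaluates `Ψ` as `-(15/2) ∫ max(U(y, 1), 0) dγ`
(`Approximates.weissAverage_of_homogeneous`). -/

namespace WeissMonotonicity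

variable {n : ℕ}

/-! ### Gaussian measure and functions of polynomial growth -/

/-- The density of the Gaussian weight `(4π)^{-n/2} exp(-|y|²/4)`. -/
noncomputable def gaussDensity {n : ℕ} (y : EuclideanSpace ℝ (Fin n)) : ℝ :=
  1 / (4 * Real.pi) ^ ((n : ℝ) / 2) * Real.exp (-‖y‖ ^ 2 / 4)

/-- The Gaussian measure with density `gaussDensity`. -/
noncomputable def gaussMeasure (n : ℕ) : Measure (EuclideanSpace ℝ (Fin n)) :=
  volume.withDensity fun y => ENNReal.ofReal (gaussDensity y)

/-- The product of the Gaussian measure with Lebesgue measure on `(a, b)`. -/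
noncomputable def shellMeasure (n : ℕ) (a b : ℝ) : Measure (SpaceTime n) :=
  (gaussMeasure n).prod (volume.restrict (Ioo a b))

lemma gaussDensity_pos (y : EuclideanSpace ℝ (Fin n)) : 0 < gaussDensity y := by
  unfold gaussDensity; positivity

lemma continuous_gaussDensity :
    Continuous (gaussDensity : EuclideanSpace ℝ (Fin n) → ℝ) := by
  unfold gaussDensity; fun_prop

lemma measurable_ofReal_gaussDensity :
    Measurable fun y : EuclideanSpace ℝ (Fin n) => ENNReal.ofReal (gaussDensity y) :=
  continuous_gaussDensity.measurable.ennreal_ofReal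

lemma integral_gaussMeasure (f : EuclideanSpace ℝ (Fin n) → ℝ) :
    ∫ y, f y ∂gaussMeasure n = ∫ y, gaussDensity y * f y := by
  rw [gaussMeasure, integral_withDensity_eq_integral_toReal_smul measurable_ofReal_gaussDensity
    (by simp)]
  simp [ENNReal.toReal_ofReal (gaussDensity_pos _).le]

lemma integrable_gaussMeasure_iff {f : EuclideanSpace ℝ (Fin n) → ℝ} :
    Integrable f (gaussMeasure n) ↔ Integrable (fun y => gaussDensity y * f y) := by
  rw [gaussMeasure, integrable_withDensity_iff_integrable_smul' measurable_ofReal_gaussDensity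
    (by simp)]
  simp [ENNReal.toReal_ofReal (gaussDensity_pos _).le]

lemma volume_absolutelyContinuous_gaussMeasure :
    (volume : Measure (EuclideanSpace ℝ (Fin n))) ≪ gaussMeasure n :=
  withDensity_absolutelyContinuous' measurable_ofReal_gaussDensity.aemeasurable
    (by simp [gaussDensity_pos])

lemma integrable_exp_neg_mul_sq_norm {b : ℝ} (hb : 0 < b) :
    Integrable fun y : EuclideanSpace ℝ (Fin n) => Real.exp (-b * ‖y‖ ^ 2) := by
  have h := (GaussianFourier.integrable_cexp_neg_mul_sq_norm_add
    (V := EuclideanSpace ℝ (Fin n)) (b := (b : ℂ)) (by simpa using hb) 0 0).norm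
  refine h.congr (Eventually.of_forall fun y => ?_)
  simp only [Complex.norm_exp]
  norm_cast
  simp

/-- Half of the Gaussian exponent absorbs the polynomial and the other half remains integrable. All
integrability of `Moderate` functions rests on these moments. -/
lemma integrable_one_add_norm_pow (k : ℕ) :
    Integrable (fun y : EuclideanSpace ℝ (Fin n) => (1 + ‖y‖) ^ k) (gaussMeasure n) := by
  rw [integrable_gaussMeasure_iff]
  have hb : ∃ C : ℝ, ∀ x : ℝ, 0 ≤ x → (1 + x) ^ k * Real.exp (-x ^ 2 / 8) ≤ C := by
    -- `(1 + x)^k ≤ k! exp(1 + x)`, and `1 + x - x²/8` has its maximum `3` at `x = 4`.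
    refine ⟨k.factorial * Real.exp 3, fun x hx => ?_⟩
    have h1 : (1 + x) ^ k ≤ k.factorial * Real.exp (1 + x) := by
      have := Real.pow_div_factorial_le_exp (1 + x) (by linarith) k
      rw [div_le_iff₀ (by positivity)] at this
      linarith
    calc (1 + x) ^ k * Real.exp (-x ^ 2 / 8)
        ≤ k.factorial * Real.exp (1 + x) * Real.exp (-x ^ 2 / 8) := by gcongr
      _ = k.factorial * Real.exp (1 + x - x ^ 2 / 8) := by
          rw [mul_assoc, ← Real.exp_add]; ring_nf
      _ ≤ k.factorial * Real.exp 3 := by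
          gcongr; nlinarith [sq_nonneg (x - 4)]
  obtain ⟨C, hC⟩ := hb
  refine Integrable.mono' ((integrable_exp_neg_mul_sq_norm (n := n) (b := 1 / 8)
    (by norm_num)).const_mul (1 / (4 * Real.pi) ^ ((n : ℝ) / 2) * C)) ?_ ?_
  · exact (continuous_gaussDensity.mul (by fun_prop)).aestronglyMeasurable
  · refine Eventually.of_forall fun y => ?_
    rw [Real.norm_of_nonneg (by have := gaussDensity_pos y; positivity), gaussDensity]
    have h := hC ‖y‖ (norm_nonneg y)
    have he : Real.exp (-‖y‖ ^ 2 / 4) = Real.exp (-‖y‖ ^ 2 / 8) * Real.exp (-(1 / 8) * ‖y‖ ^ 2) := by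
      rw [← Real.exp_add]; ring_nf
    rw [he]
    calc _ = 1 / (4 * Real.pi) ^ ((n : ℝ) / 2) * ((1 + ‖y‖) ^ k * Real.exp (-‖y‖ ^ 2 / 8)) *
          Real.exp (-(1 / 8) * ‖y‖ ^ 2) := by ring
      _ ≤ _ := by gcongr

instance : IsFiniteMeasure (gaussMeasure n) := by
  have h := integrable_one_add_norm_pow (n := n) 0
  simp only [pow_zero] at h
  exact (integrable_const_iff_isFiniteMeasure one_ne_zero).1 h

instance (a b : ℝ) : IsFiniteMeasure (shellMeasure n a b) := by
  unfold shellMeasure; infer_instance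

/-- Continuous functions of polynomial growth on space-time. -/
structure Moderate (F : SpaceTime n → ℝ) : Prop where
  continuous : Continuous F
  bound : ∃ (k : ℕ) (C : ℝ), ∀ z, |F z| ≤ C * (1 + ‖z‖) ^ k

/-- Separating `s` from `y` gives a Gaussian-integrable majorant in `y` that is locally uniform in
`s`, as dominated convergence on slices requires. -/
lemma Moderate.exists_split_bound {F : SpaceTime n → ℝ} (hF : Moderate F) :
    ∃ (k : ℕ) (C : ℝ), 0 ≤ C ∧ ∀ y s, |F (y, s)| ≤ C * (1 + |s|) ^ k * (1 + ‖y‖) ^ k := by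
  obtain ⟨k, C, h⟩ := hF.bound
  have hC : 0 ≤ C := by simpa using (abs_nonneg _).trans (h 0)
  refine ⟨k, C, hC, fun y s => (h _).trans ?_⟩
  rw [mul_assoc, ← mul_pow]
  gcongr
  have : ‖((y, s) : SpaceTime n)‖ ≤ ‖y‖ + |s| := by
    rw [Prod.norm_def]
    exact max_le (by simp) (by simp)
  nlinarith [norm_nonneg y, abs_nonneg s]

/-- Two classes are used: `HasTemperateGrowth` for what gets differentiated, and `Moderate` for
expressions such as `|W|` or `β(W)`, which need not be smooth. -/
lemma Moderate.of_hasTemperateGrowth {F : SpaceTime n → ℝ} (hF : F.HasTemperateGrowth) :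
    Moderate F := by
  refine ⟨hF.1.continuous, ?_⟩
  obtain ⟨k, C, h⟩ := hF.2 0
  exact ⟨k, C, fun z => by simpa using h z⟩

lemma Moderate.add {F G : SpaceTime n → ℝ} (hF : Moderate F) (hG : Moderate G) :
    Moderate fun z => F z + G z := by
  refine ⟨hF.continuous.add hG.continuous, ?_⟩
  obtain ⟨k, C, h⟩ := hF.bound
  obtain ⟨l, D, h'⟩ := hG.bound
  have hC : 0 ≤ C := by simpa using (abs_nonneg _).trans (h 0)
  have hD : 0 ≤ D := by simpa using (abs_nonneg _).trans (h' 0)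
  refine ⟨k + l, C + D, fun z => (abs_add_le _ _).trans ?_⟩
  have h1 : (1 + ‖z‖) ^ k ≤ (1 + ‖z‖) ^ (k + l) :=
    pow_le_pow_right₀ (by linarith [norm_nonneg z]) (by omega)
  have h2 : (1 + ‖z‖) ^ l ≤ (1 + ‖z‖) ^ (k + l) :=
    pow_le_pow_right₀ (by linarith [norm_nonneg z]) (by omega)
  rw [add_mul]
  exact add_le_add ((h z).trans (by gcongr)) ((h' z).trans (by gcongr))

lemma Moderate.mul {F G : SpaceTime n → ℝ} (hF : Moderate F) (hG : Moderate G) :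
    Moderate fun z => F z * G z := by
  refine ⟨hF.continuous.mul hG.continuous, ?_⟩
  obtain ⟨k, C, h⟩ := hF.bound
  obtain ⟨l, D, h'⟩ := hG.bound
  have hC : 0 ≤ C := by simpa using (abs_nonneg _).trans (h 0)
  have hD : 0 ≤ D := by simpa using (abs_nonneg _).trans (h' 0)
  refine ⟨k + l, C * D, fun z => ?_⟩
  rw [abs_mul, pow_add]
  calc |F z| * |G z| ≤ (C * (1 + ‖z‖) ^ k) * (D * (1 + ‖z‖) ^ l) := by
        gcongr
        · exact h z
        · exact h' z
    _ = _ := by ring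

lemma Moderate.mono {F G : SpaceTime n → ℝ} (hG : Moderate G) (hF : Continuous F)
    (h : ∀ z, |F z| ≤ |G z|) : Moderate F :=
  ⟨hF, by obtain ⟨k, C, h'⟩ := hG.bound; exact ⟨k, C, fun z => (h z).trans (h' z)⟩⟩

lemma Moderate.const (c : ℝ) : Moderate fun _ : SpaceTime n => c :=
  ⟨continuous_const, 0, |c|, fun z => by simp⟩

lemma Moderate.const_mul {F : SpaceTime n → ℝ} (hF : Moderate F) (c : ℝ) :
    Moderate fun z => c * F z := (Moderate.const c).mul hF

lemma Moderate.neg {F : SpaceTime n → ℝ} (hF : Moderate F) : Moderate fun z => -F z := by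
  simpa using hF.const_mul (-1)

lemma Moderate.sub {F G : SpaceTime n → ℝ} (hF : Moderate F) (hG : Moderate G) :
    Moderate fun z => F z - G z := by simpa [sub_eq_add_neg] using hF.add hG.neg

lemma Moderate.sq {F : SpaceTime n → ℝ} (hF : Moderate F) : Moderate fun z => F z ^ 2 := by
  simpa [_root_.sq] using hF.mul hF

lemma Moderate.abs {F : SpaceTime n → ℝ} (hF : Moderate F) : Moderate fun z => |F z| :=
  hF.mono hF.continuous.abs (by simp)

lemma Moderate.sum {ι : Type*} (s : Finset ι) {F : ι → SpaceTime n → ℝ}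
    (hF : ∀ i, Moderate (F i)) : Moderate fun z => ∑ i ∈ s, F i z := by
  classical
  induction s using Finset.induction_on with
  | empty => simpa using Moderate.const (n := n) 0
  | insert a s ha ih => simpa [Finset.sum_insert ha] using (hF a).add ih

lemma Moderate.snd : Moderate fun z : SpaceTime n => z.2 :=
  ⟨continuous_snd, 1, 1, fun z => by
    have : |z.2| ≤ ‖z‖ := norm_snd_le z
    simp; linarith⟩

lemma Moderate.coord (i : Fin n) : Moderate fun z : SpaceTime n => z.1 i :=
  ⟨by fun_prop, 1, 1, fun z => by
    have h1 : ‖z.1‖ ≤ ‖z‖ := norm_fst_le z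
    have h2 : |z.1 i| ≤ ‖z.1‖ := PiLp.norm_apply_le z.1 i
    simp; linarith⟩

lemma Moderate.integrable_slice {F : SpaceTime n → ℝ} (hF : Moderate F) (s : ℝ) :
    Integrable (fun y => F (y, s)) (gaussMeasure n) := by
  obtain ⟨k, C, hC, h⟩ := hF.exists_split_bound
  have hc := hF.continuous
  exact ((integrable_one_add_norm_pow k).const_mul (C * (1 + |s|) ^ k)).mono'
    (by fun_prop) (Eventually.of_forall fun y => h y s)

lemma Moderate.integrable_shell {F : SpaceTime n → ℝ} (hF : Moderate F) (a b : ℝ) :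
    Integrable F (shellMeasure n a b) := by
  obtain ⟨k, C, hC, h⟩ := hF.exists_split_bound
  have h1 : IntegrableOn (fun s : ℝ => C * (1 + |s|) ^ k) (Ioo a b) :=
    (Continuous.integrableOn_Icc (by fun_prop)).mono_set Ioo_subset_Icc_self
  have h2 : Integrable (fun z : SpaceTime n => (1 + ‖z.1‖) ^ k * (C * (1 + |z.2|) ^ k))
    (shellMeasure n a b) := (integrable_one_add_norm_pow k).mul_prod h1
  refine h2.mono' hF.continuous.aestronglyMeasurable (Eventually.of_forall fun z => ?_)
  rw [mul_comm]
  exact h z.1 z.2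

lemma Moderate.integral_shell {F : SpaceTime n → ℝ} (hF : Moderate F) (a b : ℝ) :
    ∫ z, F z ∂shellMeasure n a b = ∫ s in Ioo a b, ∫ y, F (y, s) ∂gaussMeasure n :=
  integral_prod_symm _ (hF.integrable_shell a b)

lemma Moderate.continuous_integral_slice {F : SpaceTime n → ℝ} (hF : Moderate F) :
    Continuous fun s => ∫ y, F (y, s) ∂gaussMeasure n := by
  obtain ⟨k, C, hC, h⟩ := hF.exists_split_bound
  have hc := hF.continuous
  refine continuous_iff_continuousAt.2 fun s₀ => ?_
  refine continuousAt_of_dominated (bound := fun y => C * (1 + (|s₀| + 1)) ^ k * (1 + ‖y‖) ^ k)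
    (Eventually.of_forall fun s => by fun_prop) ?_
    ((integrable_one_add_norm_pow k).const_mul _) (Eventually.of_forall fun y => by fun_prop)
  filter_upwards [Metric.ball_mem_nhds s₀ one_pos] with s hs
  refine Eventually.of_forall fun y => (h y s).trans ?_
  rw [Metric.mem_ball, Real.dist_eq] at hs
  have : |s| ≤ |s₀| + 1 := by linarith [abs_sub_abs_le_abs_sub s s₀]
  gcongr

lemma Moderate.intervalIntegral_eq {F : SpaceTime n → ℝ} (hF : Moderate F) {a b : ℝ}
    (hab : a ≤ b) :
    ∫ s in a..b, ∫ y, F (y, s) ∂gaussMeasure n = ∫ z, F z ∂shellMeasure n a b := by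
  rw [hF.integral_shell, intervalIntegral.integral_of_le hab, integral_Ioc_eq_integral_Ioo]

/-- Differentiation of a Gaussian integral with respect to a parameter. -/
lemma hasDerivAt_integral_slice {F F' : SpaceTime n → ℝ} (hF : Moderate F) (hF' : Moderate F')
    (hd : ∀ y s, HasDerivAt (fun σ => F (y, σ)) (F' (y, s)) s) (s : ℝ) :
    HasDerivAt (fun σ => ∫ y, F (y, σ) ∂gaussMeasure n) (∫ y, F' (y, s) ∂gaussMeasure n) s := by
  obtain ⟨k, C, hC, h⟩ := hF'.exists_split_bound
  have hc := hF.continuous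
  have hc' := hF'.continuous
  refine (hasDerivAt_integral_of_dominated_loc_of_deriv_le (Metric.ball_mem_nhds s one_pos)
    (bound := fun y => C * (1 + (|s| + 1)) ^ k * (1 + ‖y‖) ^ k)
    (F := fun σ y => F (y, σ)) (F' := fun σ y => F' (y, σ))
    (Eventually.of_forall fun s => by fun_prop) (hF.integrable_slice s) (by fun_prop) ?_
    ((integrable_one_add_norm_pow k).const_mul _)
    (Eventually.of_forall fun y σ _ => hd y σ)).2
  refine Eventually.of_forall fun y σ hσ => (h y σ).trans ?_
  rw [Metric.mem_ball, Real.dist_eq] at hσ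
  have : |σ| ≤ |s| + 1 := by linarith [abs_sub_abs_le_abs_sub σ s]
  gcongr

/-! ### Gaussian integration by parts and the Ornstein-Uhlenbeck operator -/

/-- The derivative of `W` in the direction `v`. -/
noncomputable def pd (v : SpaceTime n) (W : SpaceTime n → ℝ) (z : SpaceTime n) : ℝ :=
  fderiv ℝ W z v

lemma temperate_pd {W : SpaceTime n → ℝ} (hW : W.HasTemperateGrowth) (v : SpaceTime n) :
    (pd v W).HasTemperateGrowth := by
  have h1 : (fderiv ℝ W).HasTemperateGrowth := by
    refine ⟨hW.1.fderiv_right (by simp), fun m => ?_⟩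
    obtain ⟨k, C, h⟩ := hW.2 (m + 1)
    exact ⟨k, C, fun x => by simpa [norm_iteratedFDeriv_fderiv] using h x⟩
  exact (ContinuousLinearMap.apply ℝ ℝ v).hasTemperateGrowth.comp h1

lemma temperate_snd : (fun z : SpaceTime n => z.2).HasTemperateGrowth :=
  (ContinuousLinearMap.snd ℝ (EuclideanSpace ℝ (Fin n)) ℝ).hasTemperateGrowth

lemma temperate_differentiable {W : SpaceTime n → ℝ} (hW : W.HasTemperateGrowth) :
    Differentiable ℝ W := hW.1.differentiable (by simp)

lemma hasDerivAt_time {W : SpaceTime n → ℝ} (hW : Differentiable ℝ W)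
    (y : EuclideanSpace ℝ (Fin n)) (s : ℝ) :
    HasDerivAt (fun σ => W (y, σ)) (pd (dirT n) W (y, s)) s := by
  have h := (hW (y, s)).hasFDerivAt.comp_hasDerivAt s
    ((hasDerivAt_const s y).prodMk (hasDerivAt_id s))
  exact h

lemma hasFDerivAt_gaussDensity (y : EuclideanSpace ℝ (Fin n)) :
    HasFDerivAt (gaussDensity : EuclideanSpace ℝ (Fin n) → ℝ)
      ((-gaussDensity y / 2) • (innerSL ℝ y)) y := by
  have h1 : HasFDerivAt (fun y : EuclideanSpace ℝ (Fin n) => ‖y‖ ^ 2) (2 • (innerSL ℝ y)) y :=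
    (hasStrictFDerivAt_norm_sq y).hasFDerivAt
  have h2 := ((h1.const_mul (-1 / 4 : ℝ)).exp).const_mul (1 / (4 * Real.pi) ^ ((n : ℝ) / 2))
  refine (h2.congr_of_eventuallyEq (Eventually.of_forall fun z => ?_)).congr_fderiv ?_
  · simp only [gaussDensity]; ring_nf
  · ext v
    simp only [gaussDensity, _root_.smul_apply, smul_eq_mul, innerSL_apply_apply,
      nsmul_eq_mul]
    ring_nf

/-- The drift term comes from `∂ᵢ` of the Gaussian density, which equals `-yᵢ/2` times that density.
-/
lemma integral_gauss_divergence {H : SpaceTime n → ℝ} (hd : Differentiable ℝ H)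
    (hH : Moderate H) (i : Fin n) (hH' : Moderate (pd (dirX i) H)) (s : ℝ) :
    ∫ y, (pd (dirX i) H (y, s) - y i / 2 * H (y, s)) ∂gaussMeasure n = 0 := by
  set v : EuclideanSpace ℝ (Fin n) := EuclideanSpace.single i 1 with hv
  have hfd : ∀ y, HasFDerivAt (fun y => H (y, s)) ((fderiv ℝ H (y, s)).comp
      (ContinuousLinearMap.inl ℝ (EuclideanSpace ℝ (Fin n)) ℝ)) y := fun y =>
    (hd (y, s)).hasFDerivAt.comp y (hasFDerivAt_prodMk_left y s)
  have hfv : ∀ y, fderiv ℝ (fun y => H (y, s)) y v = pd (dirX i) H (y, s) := fun y => by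
    rw [(hfd y).fderiv]; rfl
  have hgv : ∀ y, fderiv ℝ gaussDensity y v = -(gaussDensity y * (y i / 2)) := fun y => by
    rw [(hasFDerivAt_gaussDensity y).fderiv]
    simp [hv, EuclideanSpace.inner_single_right]
    ring
  have hi1 : Integrable fun y => gaussDensity y * pd (dirX i) H (y, s) :=
    integrable_gaussMeasure_iff.1 (hH'.integrable_slice s)
  have hm : Moderate fun z : SpaceTime n => 1 / 2 * z.1 i * H z :=
    ((Moderate.coord i).const_mul (1 / 2)).mul hH
  have hi2 : Integrable fun y => gaussDensity y * (1 / 2 * y i * H (y, s)) :=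
    integrable_gaussMeasure_iff.1 (hm.integrable_slice s)
  have key := integral_mul_fderiv_eq_neg_fderiv_mul_of_integrable (μ := volume)
    (f := (gaussDensity : EuclideanSpace ℝ (Fin n) → ℝ)) (g := fun y => H (y, s)) (v := v)
    (by simp only [hgv]; exact hi2.neg.congr (Eventually.of_forall fun y => by simp; ring))
    (by simpa only [hfv] using hi1)
    (integrable_gaussMeasure_iff.1 (hH.integrable_slice s))
    (fun y _ => (hasFDerivAt_gaussDensity y).differentiableAt)
    (fun y _ => (hfd y).differentiableAt)
  simp only [hfv, hgv] at key
  rw [integral_gaussMeasure]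
  have : ∀ y, gaussDensity y * (pd (dirX i) H (y, s) - y i / 2 * H (y, s)) =
    gaussDensity y * pd (dirX i) H (y, s) - gaussDensity y * (1 / 2 * y i * H (y, s)) :=
    fun y => by ring
  simp only [this]
  rw [integral_sub hi1 hi2, key, ← integral_neg, sub_eq_zero]
  congr 1; ext y; ring

/-- The squared length of the spatial gradient. -/
noncomputable def gradSq (W : SpaceTime n → ℝ) (z : SpaceTime n) : ℝ :=
  ∑ i, pd (dirX i) W z ^ 2

/-- The Ornstein-Uhlenbeck operator `Δ - ½ y · ∇`. -/
noncomputable def ouLap (W : SpaceTime n → ℝ) (z : SpaceTime n) : ℝ :=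
  ∑ i, (pd (dirX i) (pd (dirX i) W) z - z.1 i / 2 * pd (dirX i) W z)

lemma moderate_pd {W : SpaceTime n → ℝ} (hW : W.HasTemperateGrowth) (v : SpaceTime n) :
    Moderate (pd v W) := .of_hasTemperateGrowth (temperate_pd hW v)

lemma moderate_gradSq {W : SpaceTime n → ℝ} (hW : W.HasTemperateGrowth) :
    Moderate (gradSq W) :=
  Moderate.sum _ fun i => (moderate_pd hW (dirX i)).sq

lemma moderate_ouLap {W : SpaceTime n → ℝ} (hW : W.HasTemperateGrowth) :
    Moderate (ouLap W) :=
  Moderate.sum _ fun i => (moderate_pd (temperate_pd hW (dirX i)) (dirX i)).sub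
    (by simpa [div_eq_inv_mul] using
      ((Moderate.coord i).const_mul 2⁻¹).mul (moderate_pd hW (dirX i)))

lemma pd_mul {F G : SpaceTime n → ℝ} (hF : Differentiable ℝ F) (hG : Differentiable ℝ G)
    (v z : SpaceTime n) : pd v (fun z => F z * G z) z = F z * pd v G z + G z * pd v F z := by
  simp [pd, fderiv_fun_mul (hF z) (hG z)]

lemma pd_comm {W : SpaceTime n → ℝ} (hW : W.HasTemperateGrowth) (v w z : SpaceTime n) :
    pd v (pd w W) z = pd w (pd v W) z := by
  have h1 : ∀ u, ∀ z, fderiv ℝ (pd u W) z = (fderiv ℝ (fderiv ℝ W) z).flip u := fun u z => by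
    have hd : DifferentiableAt ℝ (fderiv ℝ W) z :=
      (hW.1.fderiv_right (m := 1) (by
        exact WithTop.coe_le_coe.2 (le_top : ((2 : ℕ) : ℕ∞) ≤ ⊤))).differentiable (by simp) z
    refine ContinuousLinearMap.ext fun w => ?_
    rw [ContinuousLinearMap.flip_apply]
    have := (hd.hasFDerivAt.clm_apply (hasFDerivAt_const u z)).fderiv
    change fderiv ℝ (fun z => fderiv ℝ W z u) z w = _
    rw [this]; simp
  have hs : IsSymmSndFDerivAt ℝ W z := (hW.1.contDiffAt (x := z)).isSymmSndFDerivAt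
    (by
      simpa using WithTop.coe_le_coe.2 (le_top : ((2 : ℕ) : ℕ∞) ≤ ⊤))
  change fderiv ℝ (pd w W) z v = fderiv ℝ (pd v W) z w
  rw [h1, h1]
  exact hs v w

/-- The Gaussian divergence formula is applied to `(∂ᵢW) V` and summed over `i`; the drift of
`ouLap` is exactly the term produced by the weight. -/
lemma integral_green {W V : SpaceTime n → ℝ} (hW : W.HasTemperateGrowth)
    (hV : V.HasTemperateGrowth) (s : ℝ) :
    ∫ y, ((∑ i, pd (dirX i) W (y, s) * pd (dirX i) V (y, s)) + ouLap W (y, s) * V (y, s))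
      ∂gaussMeasure n = 0 := by
  have hH : ∀ i : Fin n, (fun z => pd (dirX i) W z * V z).HasTemperateGrowth := fun i =>
    (temperate_pd hW _).mul hV
  have h0 := fun i : Fin n => integral_gauss_divergence (temperate_differentiable (hH i))
    (.of_hasTemperateGrowth (hH i)) i (moderate_pd (hH i) _) s
  have hpt : ∀ y, (∑ i, pd (dirX i) W (y, s) * pd (dirX i) V (y, s)) + ouLap W (y, s) * V (y, s) =
      ∑ i, (pd (dirX i) (fun z => pd (dirX i) W z * V z) (y, s) -
        y i / 2 * (pd (dirX i) W (y, s) * V (y, s))) := fun y => by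
    rw [ouLap, Finset.sum_mul, ← Finset.sum_add_distrib]
    refine Finset.sum_congr rfl fun i _ => ?_
    rw [pd_mul (temperate_differentiable (temperate_pd hW _)) (temperate_differentiable hV)]
    ring
  simp only [hpt]
  rw [integral_finsetSum]
  · exact Finset.sum_eq_zero fun i _ => h0 i
  · intro i _
    have := ((moderate_pd (hH i) (dirX i)).sub (((Moderate.coord i).const_mul 2⁻¹).mul
      (.of_hasTemperateGrowth (hH i)))).integrable_slice s
    simpa [div_eq_inv_mul] using this

lemma integral_gradSq_add {W : SpaceTime n → ℝ} (hW : W.HasTemperateGrowth) (s : ℝ) :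
    ∫ y, (gradSq W (y, s) + ouLap W (y, s) * W (y, s)) ∂gaussMeasure n = 0 := by
  simpa [gradSq, sq] using integral_green hW hW s

/-- The time derivative of `gradSq W`. -/
noncomputable def gradSqDeriv (W : SpaceTime n → ℝ) (z : SpaceTime n) : ℝ :=
  ∑ i, 2 * (pd (dirX i) W z * pd (dirX i) (pd (dirT n) W) z)

lemma moderate_gradSqDeriv {W : SpaceTime n → ℝ} (hW : W.HasTemperateGrowth) :
    Moderate (gradSqDeriv W) :=
  Moderate.sum _ fun i => ((moderate_pd hW (dirX i)).mul
    (moderate_pd (temperate_pd hW (dirT n)) (dirX i))).const_mul 2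

lemma hasDerivAt_gradSq {W : SpaceTime n → ℝ} (hW : W.HasTemperateGrowth)
    (y : EuclideanSpace ℝ (Fin n)) (s : ℝ) :
    HasDerivAt (fun σ => gradSq W (y, σ)) (gradSqDeriv W (y, s)) s := by
  unfold gradSq gradSqDeriv
  refine HasDerivAt.fun_sum fun i _ => ?_
  have h := (hasDerivAt_time (temperate_differentiable (temperate_pd hW (dirX i))) y s).pow 2
  rw [pd_comm hW] at h
  refine h.congr_deriv ?_
  ring

/-- Green's formula tested with `V = ∂ₛW`; the factor `2` is that of `∂ₛ|∇W|² = 2 ∇W·∇∂ₛW`. -/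
lemma integral_gradSqDeriv_add {W : SpaceTime n → ℝ} (hW : W.HasTemperateGrowth) (s : ℝ) :
    ∫ y, (gradSqDeriv W (y, s) + 2 * (ouLap W (y, s) * pd (dirT n) W (y, s)))
      ∂gaussMeasure n = 0 := by
  have h := integral_green hW (temperate_pd hW (dirT n)) s
  calc _ = ∫ y, 2 * ((∑ i, pd (dirX i) W (y, s) * pd (dirX i) (pd (dirT n) W) (y, s)) +
      ouLap W (y, s) * pd (dirT n) W (y, s)) ∂gaussMeasure n := by
        congr 1; ext y; rw [gradSqDeriv, ← Finset.mul_sum]; ring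
    _ = 0 := by rw [integral_const_mul, h, mul_zero]

/-! ### The Weiss formula for smooth solutions -/

/-- `W` solves the heat equation with right-hand side `f`, in self-similar coordinates. -/
def SolvesSelfSimilar (W f : SpaceTime n → ℝ) : Prop :=
  ∀ z : SpaceTime n, 0 < z.2 → z.2 * pd (dirT n) W z + 2 * ouLap W z = -2 * z.2 ^ 2 * f z

/-- A `C¹` function vanishing at `0` with derivative in `[0, 1]`. -/
structure Ramp (β β' : ℝ → ℝ) : Prop where
  deriv : ∀ x, HasDerivAt β (β' x) x
  continuous_deriv : Continuous β'
  abs_deriv_le : ∀ x, |β' x| ≤ 1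
  abs_le : ∀ x, |β x| ≤ |x|

lemma Ramp.continuous {β β' : ℝ → ℝ} (h : Ramp β β') : Continuous β :=
  continuous_iff_continuousAt.2 fun x => (h.deriv x).continuousAt

lemma Moderate.ramp {β β' : ℝ → ℝ} (h : Ramp β β') {F : SpaceTime n → ℝ} (hF : Moderate F) :
    Moderate fun z => β (F z) :=
  hF.mono (h.continuous.comp hF.continuous) fun _ => h.abs_le _

lemma Moderate.ramp_deriv {β β' : ℝ → ℝ} (h : Ramp β β') {F : SpaceTime n → ℝ}
    (hF : Moderate F) : Moderate fun z => β' (F z) :=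
  (Moderate.const 1).mono (h.continuous_deriv.comp hF.continuous) fun _ => by
    simpa using h.abs_deriv_le _

/-- The integrand of the Weiss functional in self-similar coordinates. -/
noncomputable def weissN (β : ℝ → ℝ) (U G : SpaceTime n → ℝ) (z : SpaceTime n) : ℝ :=
  z.2⁻¹ * (2 * (G z - U z ^ 2 - 2 * z.2 ^ 2 * β (U z)))

/-- The integrand of the derivative of the Weiss functional in self-similar coordinates. -/
noncomputable def weissPhi (β β' : ℝ → ℝ) (U Us f : SpaceTime n → ℝ) (z : SpaceTime n) : ℝ :=
  z.2⁻¹ * (2 * (z.2 * Us z - 2 * U z) ^ 2 + 4 * z.2 ^ 3 * ((f z - β' (U z)) * Us z) +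
    8 * z.2 ^ 2 * (β (U z) - U z * f z))

lemma ae_shell_mem (a b : ℝ) : ∀ᵐ z ∂shellMeasure n a b, z.2 ∈ Ioo a b := by
  have h : ∀ᵐ s ∂(volume.restrict (Ioo a b)), s ∈ Ioo a b := ae_restrict_mem measurableSet_Ioo
  exact (Measure.quasiMeasurePreserving_snd (μ := gaussMeasure n)).ae h

lemma Moderate.integrable_inv_mul {F : SpaceTime n → ℝ} (hF : Moderate F) {a : ℝ} (ha : 0 < a)
    (b : ℝ) : Integrable (fun z => z.2⁻¹ * F z) (shellMeasure n a b) := by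
  -- The function `s⁻¹` is singular at `0`; on the shell it coincides with the bounded continuous
  -- `(max s a)⁻¹`.
  have h1 : Moderate fun z : SpaceTime n => (max z.2 a)⁻¹ :=
    (Moderate.const a⁻¹).mono (Continuous.inv₀ (by fun_prop)
      fun z => (lt_of_lt_of_le ha (le_max_right _ _)).ne') fun z => by
        have : 0 < max z.2 a := lt_of_lt_of_le ha (le_max_right _ _)
        rw [abs_of_pos (by positivity), abs_of_pos (by positivity)]
        exact inv_anti₀ ha (le_max_right _ _)
  refine ((h1.mul hF).integrable_shell a b).congr ?_
  filter_upwards [ae_shell_mem a b] with z hz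
  rw [max_eq_left hz.1.le]

lemma Moderate.integral_inv_mul {F : SpaceTime n → ℝ} (hF : Moderate F) {a b : ℝ} (ha : 0 < a)
    (hab : a ≤ b) : ∫ z, z.2⁻¹ * F z ∂shellMeasure n a b =
      ∫ s in a..b, s⁻¹ * ∫ y, F (y, s) ∂gaussMeasure n := by
  rw [intervalIntegral.integral_of_le hab, integral_Ioc_eq_integral_Ioo, shellMeasure,
    integral_prod_symm _ (hF.integrable_inv_mul ha b)]
  simp only [integral_const_mul]

/-- Differentiation of the averages `r⁻⁴ ∫_r^{2r} (2 / s) M(s) ds`. -/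
lemma hasDerivAt_shell_average {M M' : ℝ → ℝ} (hM : ∀ s, HasDerivAt M (M' s) s)
    (hM' : Continuous M') {r : ℝ} (hr : 0 < r) :
    HasDerivAt (fun r => 1 / r ^ 4 * ∫ s in r..(2 * r), s⁻¹ * (2 * M s))
      (1 / r ^ 5 * ∫ s in r..(2 * r), s⁻¹ * (2 * s * M' s - 8 * M s)) r := by
  have hMc : Continuous M := continuous_iff_continuousAt.2 fun s => (hM s).continuousAt
  have hcont : ContinuousOn (fun s => s⁻¹ * (2 * M s)) (Ioi 0) :=
    (continuousOn_inv₀.mono fun s (hs : 0 < s) => hs.ne').mul (by fun_prop)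
  have hii : ∀ x y : ℝ, 0 < x → 0 < y →
      IntervalIntegrable (fun s => s⁻¹ * (2 * M s)) volume x y := fun x y hx hy =>
    (hcont.mono fun s hs => lt_of_lt_of_le (lt_min hx hy) hs.1).intervalIntegrable
  -- The base point `1` is arbitrary; any positive one keeps the integrals away from the singularity
  -- of `s⁻¹`.
  have hG : ∀ x : ℝ, 0 < x → HasDerivAt (fun x => ∫ s in (1 : ℝ)..x, s⁻¹ * (2 * M s))
      (x⁻¹ * (2 * M x)) x := fun x hx =>
    intervalIntegral.integral_hasDerivAt_right (hii 1 x one_pos hx)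
      (hcont.stronglyMeasurableAtFilter isOpen_Ioi x hx)
      (hcont.continuousAt (Ioi_mem_nhds hx))
  have h2 := (hG (2 * r) (by linarith)).comp r ((hasDerivAt_id r).const_mul 2)
  have h3 := (h2.sub (hG r hr)).congr_of_eventuallyEq
    (f₁ := fun r => ∫ s in r..(2 * r), s⁻¹ * (2 * M s)) (by
      filter_upwards [Ioi_mem_nhds hr] with x (hx : 0 < x)
      simp only [Pi.sub_apply, Function.comp_apply]
      rw [intervalIntegral.integral_interval_sub_left (hii 1 _ one_pos (by linarith))
        (hii 1 _ one_pos hx)])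
  have h4 : HasDerivAt (fun r : ℝ => 1 / r ^ 4) (-4 / r ^ 5) r := by
    have := ((hasDerivAt_id r).pow 4).inv (by simp; positivity)
    simp only [one_div]
    refine (this.congr_deriv ?_)
    simp only [Pi.pow_apply, id]
    field_simp
    norm_num
    ring
  refine (h4.mul h3).congr_deriv ?_
  have hFTC : ∫ s in r..(2 * r), M' s = M (2 * r) - M r :=
    intervalIntegral.integral_eq_sub_of_hasDerivAt (fun s _ => hM s)
      (hM'.intervalIntegrable _ _)
  -- The moving endpoints contribute `(2/r)(M(2r) - M(r))`, and the difference `M(2r) - M(r)` is put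
  -- back under the integral as `M'`. The term `-8M` comes from differentiating `r⁻⁴`.
  have hsplit : ∫ s in r..(2 * r), s⁻¹ * (2 * s * M' s - 8 * M s) =
      2 * (M (2 * r) - M r) - 4 * ∫ s in r..(2 * r), s⁻¹ * (2 * M s) := by
    rw [← hFTC, ← intervalIntegral.integral_const_mul, ← intervalIntegral.integral_const_mul,
      ← intervalIntegral.integral_sub ((hM'.intervalIntegrable _ _).const_mul 2)
        ((hii r (2 * r) hr (by linarith)).const_mul 4)]
    refine intervalIntegral.integral_congr fun s hs => ?_
    rw [uIcc_of_le (by linarith)] at hs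
    have : s ≠ 0 := (lt_of_lt_of_le hr hs.1).ne'
    field_simp
    ring
  rw [hsplit]
  simp only [mul_one]
  field_simp
  ring

/-- The Weiss formula for smooth functions. -/
theorem hasDerivAt_weiss_smooth {W f : SpaceTime n → ℝ} (hW : W.HasTemperateGrowth)
    (hf : Moderate f) (heq : SolvesSelfSimilar W f) {β β' : ℝ → ℝ} (hβ : Ramp β β') {r : ℝ}
    (hr : 0 < r) :
    HasDerivAt (fun r => 1 / r ^ 4 * ∫ z, weissN β W (gradSq W) z ∂shellMeasure n r (2 * r))
      (1 / r ^ 5 * ∫ z, weissPhi β β' W (pd (dirT n) W) f z ∂shellMeasure n r (2 * r)) r := by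
  have hWm : Moderate W := .of_hasTemperateGrowth hW
  have hTm : Moderate (pd (dirT n) W) := moderate_pd hW _
  have hGm := moderate_gradSq hW
  have hDm := moderate_gradSqDeriv hW
  have hLm := moderate_ouLap hW
  have hs := Moderate.snd (n := n)
  have hβm := hWm.ramp hβ
  have hβm' := hWm.ramp_deriv hβ
  -- `m` is the slice density of `M(s)`, so that `weissN` is `(2/s) m`, and `m'` is its
  -- `s`-derivative.
  set m : SpaceTime n → ℝ := fun z => gradSq W z - W z ^ 2 - 2 * (z.2 ^ 2 * β (W z)) with hm
  set m' : SpaceTime n → ℝ := fun z => gradSqDeriv W z - 2 * (W z * pd (dirT n) W z) -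
    2 * (2 * (z.2 * β (W z)) + z.2 ^ 2 * (β' (W z) * pd (dirT n) W z)) with hm'
  have hmm : Moderate m := (hGm.sub hWm.sq).sub ((hs.sq.mul hβm).const_mul 2)
  have hmm' : Moderate m' := (hDm.sub ((hWm.mul hTm).const_mul 2)).sub
    ((((hs.mul hβm).const_mul 2).add (hs.sq.mul (hβm'.mul hTm))).const_mul 2)
  have hder : ∀ y s, HasDerivAt (fun σ => m (y, σ)) (m' (y, s)) s := fun y s => by
    have hWd := hasDerivAt_time (temperate_differentiable hW) y s
    have h1 := (hasDerivAt_gradSq hW y s).sub (hWd.pow 2)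
    have h2 := ((hasDerivAt_id s).pow 2).mul ((hβ.deriv _).comp s hWd)
    refine (h1.sub (h2.const_mul 2)).congr_deriv ?_
    simp only [hm', Pi.pow_apply, id, Function.comp_apply]
    push_cast
    ring
  have hM := hasDerivAt_integral_slice hmm hmm' hder
  have key := hasDerivAt_shell_average hM hmm'.continuous_integral_slice hr
  refine (key.congr_of_eventuallyEq ?_).congr_deriv ?_
  · filter_upwards [Ioi_mem_nhds hr] with x (hx : 0 < x)
    congr 1
    have h := (hmm.const_mul 2).integral_inv_mul hx (by linarith : x ≤ 2 * x)
    simp only [integral_const_mul] at h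
    rw [← h]
    refine integral_congr_ae (Eventually.of_forall fun z => ?_)
    simp only [weissN, hm]; ring
  · congr 1
    have hφ : Moderate fun z => 2 * (z.2 * pd (dirT n) W z - 2 * W z) ^ 2 +
        4 * (z.2 ^ 2 * (z.2 * ((f z - β' (W z)) * pd (dirT n) W z))) +
        8 * (z.2 ^ 2 * (β (W z) - W z * f z)) :=
      ((((hs.mul hTm).sub (hWm.const_mul 2)).sq.const_mul 2).add
        ((hs.sq.mul (hs.mul ((hf.sub hβm').mul hTm))).const_mul 4)).add
        ((hs.sq.mul (hβm.sub (hWm.mul hf))).const_mul 8)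
    have h := hφ.integral_inv_mul hr (by linarith : r ≤ 2 * r)
    have h0 : ∫ z, weissPhi β β' W (pd (dirT n) W) f z ∂shellMeasure n r (2 * r) =
        ∫ s in r..(2 * r), s⁻¹ * ∫ y, (2 * (s * pd (dirT n) W (y, s) - 2 * W (y, s)) ^ 2 +
        4 * (s ^ 2 * (s * ((f (y, s) - β' (W (y, s))) * pd (dirT n) W (y, s)))) +
        8 * (s ^ 2 * (β (W (y, s)) - W (y, s) * f (y, s)))) ∂gaussMeasure n := by
      rw [← h]
      refine integral_congr_ae (Eventually.of_forall fun z => ?_)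
      simp only [weissPhi]; ring
    rw [h0]
    refine intervalIntegral.integral_congr fun s hs' => ?_
    rw [uIcc_of_le (by linarith)] at hs'
    have hs0 : 0 < s := lt_of_lt_of_le hr hs'.1
    congr 1
    have hA := integral_gradSqDeriv_add hW s
    have hB := integral_gradSq_add hW s
    have e1 := (hmm'.integrable_slice s).const_mul (2 * s)
    have e2 := (hmm.integrable_slice s).const_mul 8
    have e3 := ((hDm.add ((hLm.mul hTm).const_mul 2)).integrable_slice s).const_mul (2 * s)
    have e4 := ((hGm.add (hLm.mul hWm)).integrable_slice s).const_mul 8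
    -- Both Green integrals vanish, so multiples of them may be added. The factors `-2s` and `8` are
    -- those that cancel `gradSqDeriv` and `gradSq`; the remaining `ouLap W` is eliminated by the
    -- equation.
    calc _ = 2 * s * ∫ y, m' (y, s) ∂gaussMeasure n - 8 * ∫ y, m (y, s) ∂gaussMeasure n := rfl
      _ = ∫ y, (2 * s * m' (y, s) - 8 * m (y, s) -
          2 * s * (gradSqDeriv W (y, s) + 2 * (ouLap W (y, s) * pd (dirT n) W (y, s))) +
          8 * (gradSq W (y, s) + ouLap W (y, s) * W (y, s))) ∂gaussMeasure n := by
        have e12 : Integrable (fun y => 2 * s * m' (y, s) - 8 * m (y, s)) (gaussMeasure n) :=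
          e1.sub e2
        have e123 : Integrable (fun y => 2 * s * m' (y, s) - 8 * m (y, s) -
            2 * s * (gradSqDeriv W (y, s) + 2 * (ouLap W (y, s) * pd (dirT n) W (y, s))))
            (gaussMeasure n) := e12.sub e3
        rw [integral_add e123 e4, integral_sub e12 e3, integral_sub e1 e2]
        simp only [integral_const_mul]
        rw [hA, hB]; ring
      _ = _ := by
        refine integral_congr_ae (Eventually.of_forall fun y => ?_)
        have h1 := heq (y, s) hs0
        simp only at h1
        have h2 : ouLap W (y, s) = -(s * pd (dirT n) W (y, s)) / 2 - s ^ 2 * f (y, s) := by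
          linarith
        simp only [hm, hm', h2]
        ring

/-! ### Energy estimates for smooth solutions -/

lemma hasDerivAt_integral_sq {W : SpaceTime n → ℝ} (hW : W.HasTemperateGrowth) (s : ℝ) :
    HasDerivAt (fun σ => ∫ y, W (y, σ) ^ 2 ∂gaussMeasure n)
      (∫ y, 2 * (W (y, s) * pd (dirT n) W (y, s)) ∂gaussMeasure n) s := by
  have hWm : Moderate W := .of_hasTemperateGrowth hW
  refine hasDerivAt_integral_slice hWm.sq ((hWm.mul (moderate_pd hW (dirT n))).const_mul 2)
    (fun y s => ?_) s
  refine ((hasDerivAt_time (temperate_differentiable hW) y s).pow 2).congr_deriv ?_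
  push_cast
  ring

/-- Green's formula with `V = W`, where `LW` is expressed through the equation. It turns the
Dirichlet energy of a slice into an `s`-derivative of `∫ W²` plus a source term. -/
lemma integral_slice_gradSq {W f : SpaceTime n → ℝ} (hW : W.HasTemperateGrowth)
    (hf : Moderate f) (heq : SolvesSelfSimilar W f) {s : ℝ} (hs : 0 < s) :
    ∫ y, gradSq W (y, s) ∂gaussMeasure n =
      s / 4 * (∫ y, 2 * (W (y, s) * pd (dirT n) W (y, s)) ∂gaussMeasure n) +
        s ^ 2 * ∫ y, W (y, s) * f (y, s) ∂gaussMeasure n := by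
  have hWm : Moderate W := .of_hasTemperateGrowth hW
  have hB := integral_gradSq_add hW s
  have i1 := (moderate_gradSq hW).integrable_slice s
  have i2 := ((moderate_ouLap hW).mul hWm).integrable_slice s
  have i3 := ((hWm.mul (moderate_pd hW (dirT n))).const_mul 2).integrable_slice s
  have i4 := (hWm.mul hf).integrable_slice s
  rw [integral_add i1 i2] at hB
  rw [eq_neg_of_add_eq_zero_left hB, ← integral_const_mul, ← integral_const_mul,
    ← integral_add (i3.const_mul _) (i4.const_mul _), ← integral_neg]
  refine integral_congr_ae (Eventually.of_forall fun y => ?_)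
  have h1 := heq (y, s) hs
  simp only at h1 ⊢
  have h2 : ouLap W (y, s) = -(s * pd (dirT n) W (y, s)) / 2 - s ^ 2 * f (y, s) := by linarith
  rw [h2]; ring

/-- The energy identity. -/
lemma integral_shell_gradSq_sub {W f : SpaceTime n → ℝ} (hW : W.HasTemperateGrowth)
    (hf : Moderate f) (heq : SolvesSelfSimilar W f) {a b : ℝ} (ha : 0 < a) (hab : a ≤ b) :
    ∫ z, z.2⁻¹ * (4 * (gradSq W z - z.2 ^ 2 * (W z * f z))) ∂shellMeasure n a b =
      ∫ y, W (y, b) ^ 2 ∂gaussMeasure n - ∫ y, W (y, a) ^ 2 ∂gaussMeasure n := by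
  have hWm : Moderate W := .of_hasTemperateGrowth hW
  have hTm := (hWm.mul (moderate_pd hW (dirT n))).const_mul 2
  have hm := (((moderate_gradSq hW).sub (Moderate.snd.sq.mul (hWm.mul hf))).const_mul 4)
  rw [hm.integral_inv_mul ha hab,
    ← intervalIntegral.integral_eq_sub_of_hasDerivAt (fun s _ => hasDerivAt_integral_sq hW s)
      (hTm.continuous_integral_slice.intervalIntegrable _ _)]
  refine intervalIntegral.integral_congr fun s hs => ?_
  rw [uIcc_of_le hab] at hs
  have hs0 : 0 < s := lt_of_lt_of_le ha hs.1
  simp only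
  rw [integral_const_mul, integral_sub ((moderate_gradSq hW).integrable_slice s)
    ((Moderate.snd.sq.mul (hWm.mul hf)).integrable_slice s), integral_slice_gradSq hW hf heq hs0]
  simp only [integral_const_mul]
  field_simp
  ring

/-- The Caccioppoli estimate on shells. -/
lemma integral_shell_gradSq_le {W f : SpaceTime n → ℝ} (hW : W.HasTemperateGrowth)
    (hf : Moderate f) (heq : SolvesSelfSimilar W f) {a b : ℝ} (ha : 0 < a) (hab : a ≤ b) :
    ∫ z, gradSq W z ∂shellMeasure n a b ≤
      b / 4 * ∫ y, W (y, b) ^ 2 ∂gaussMeasure n +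
        b ^ 2 * ∫ z, |W z| * |f z| ∂shellMeasure n a b := by
  have hWm : Moderate W := .of_hasTemperateGrowth hW
  have hTm := (hWm.mul (moderate_pd hW (dirT n))).const_mul 2
  have hAm := hWm.abs.mul hf.abs
  rw [← (moderate_gradSq hW).intervalIntegral_eq hab, ← hAm.intervalIntegral_eq hab]
  -- The derivative of `(s/4) ∫ W²` is the first term of the slice identity plus the nonnegative `¼
  -- ∫ W²`. After integration only the boundary value at `b` has to be kept, since the one at `a`
  -- enters with a minus sign.
  have hd : ∀ s, HasDerivAt (fun s => s / 4 * ∫ y, W (y, s) ^ 2 ∂gaussMeasure n)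
      (1 / 4 * ∫ y, W (y, s) ^ 2 ∂gaussMeasure n + s / 4 *
        ∫ y, 2 * (W (y, s) * pd (dirT n) W (y, s)) ∂gaussMeasure n) s := fun s =>
    ((hasDerivAt_id s).div_const 4).mul (hasDerivAt_integral_sq hW s)
  have c1 := hWm.sq.continuous_integral_slice
  have c2 := hTm.continuous_integral_slice
  have c3 := hAm.continuous_integral_slice
  have hcd : Continuous fun s => 1 / 4 * ∫ y, W (y, s) ^ 2 ∂gaussMeasure n + s / 4 *
      ∫ y, 2 * (W (y, s) * pd (dirT n) W (y, s)) ∂gaussMeasure n := by fun_prop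
  have hF := intervalIntegral.integral_eq_sub_of_hasDerivAt (a := a) (b := b)
    (fun s _ => hd s) (hcd.intervalIntegrable _ _)
  have hpos : ∀ s, 0 ≤ ∫ y, W (y, s) ^ 2 ∂gaussMeasure n := fun s =>
    integral_nonneg fun y => sq_nonneg _
  calc _ ≤ ∫ s in a..b, ((1 / 4 * ∫ y, W (y, s) ^ 2 ∂gaussMeasure n + s / 4 *
        ∫ y, 2 * (W (y, s) * pd (dirT n) W (y, s)) ∂gaussMeasure n) +
        b ^ 2 * ∫ y, |W (y, s)| * |f (y, s)| ∂gaussMeasure n) := by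
        refine intervalIntegral.integral_mono_on hab
          ((moderate_gradSq hW).continuous_integral_slice.intervalIntegrable _ _)
          (Continuous.intervalIntegrable (by fun_prop) _ _) fun s hs => ?_
        have hs0 : 0 < s := lt_of_lt_of_le ha hs.1
        rw [integral_slice_gradSq hW hf heq hs0]
        have h1 : ∫ y, W (y, s) * f (y, s) ∂gaussMeasure n ≤
            ∫ y, |W (y, s)| * |f (y, s)| ∂gaussMeasure n :=
          integral_mono ((hWm.mul hf).integrable_slice s) (hAm.integrable_slice s) fun y => by
            simp only [← abs_mul]; exact le_abs_self _
        have h2 : 0 ≤ ∫ y, |W (y, s)| * |f (y, s)| ∂gaussMeasure n :=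
          integral_nonneg fun y => by positivity
        have h3 : s ^ 2 ≤ b ^ 2 := pow_le_pow_left₀ hs0.le hs.2 2
        have h4 : s ^ 2 * ∫ y, W (y, s) * f (y, s) ∂gaussMeasure n ≤
          b ^ 2 * ∫ y, |W (y, s)| * |f (y, s)| ∂gaussMeasure n := by
            calc _ ≤ s ^ 2 * ∫ y, |W (y, s)| * |f (y, s)| ∂gaussMeasure n := by gcongr
              _ ≤ _ := by gcongr
        have := hpos s
        linarith
    _ ≤ _ := by
        rw [intervalIntegral.integral_add (hcd.intervalIntegrable _ _)
          (Continuous.intervalIntegrable (by fun_prop) _ _), hF,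
          intervalIntegral.integral_const_mul]
        have := mul_nonneg ha.le (hpos a)
        linarith

/-- The estimate of the self-similar derivative on shells. -/
lemma integral_shell_time_sq_le {W f : SpaceTime n → ℝ} (hW : W.HasTemperateGrowth)
    (hf : Moderate f) (heq : SolvesSelfSimilar W f) {a b : ℝ} (ha : 0 < a) (hab : a ≤ b) :
    a / 2 * ∫ z, pd (dirT n) W z ^ 2 ∂shellMeasure n a b ≤
      ∫ z, gradSq W z ∂shellMeasure n a (b + 1) +
        2 * (b + 1) ^ 4 * ∫ z, f z ^ 2 ∂shellMeasure n a (b + 1) := by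
  have hTm := moderate_pd hW (dirT n)
  have hGm := moderate_gradSq hW
  have hDm := moderate_gradSqDeriv hW
  have hLm := moderate_ouLap hW
  have haB : a ≤ b + 1 := by linarith
  rw [← hTm.sq.intervalIntegral_eq hab, ← hGm.intervalIntegral_eq haB,
    ← hf.sq.intervalIntegral_eq haB]
  have cT := hTm.sq.continuous_integral_slice
  have cG := hGm.continuous_integral_slice
  have cD := hDm.continuous_integral_slice
  have cf := hf.sq.continuous_integral_slice
  set T := fun s => ∫ y, pd (dirT n) W (y, s) ^ 2 ∂gaussMeasure n with hT
  set G := fun s => ∫ y, gradSq W (y, s) ∂gaussMeasure n with hG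
  set D := fun s => ∫ y, gradSqDeriv W (y, s) ∂gaussMeasure n with hD
  set g := fun s => ∫ y, f (y, s) ^ 2 ∂gaussMeasure n with hg
  have hd : ∀ s, HasDerivAt G (D s) s :=
    hasDerivAt_integral_slice hGm hDm (hasDerivAt_gradSq hW)
  have hT0 : ∀ s, 0 ≤ T s := fun s => integral_nonneg fun y => sq_nonneg _
  have hg0 : ∀ s, 0 ≤ g s := fun s => integral_nonneg fun y => sq_nonneg _
  have hG0 : ∀ s, 0 ≤ G s := fun s => integral_nonneg fun y =>
    Finset.sum_nonneg fun i _ => sq_nonneg _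
  -- By Green and the equation, `D(s) = ∫ (s W_s² + 2s² f W_s)`. The gap in the claim is the
  -- integral of the perfect square `(s/2)(W_s + 2s f)²`.
  have hDge : ∀ s, 0 < s → s / 2 * T s - 2 * s ^ 3 * g s ≤ D s := fun s hs => by
    have hA := integral_gradSqDeriv_add hW s
    rw [integral_add (hDm.integrable_slice s)
      (((hLm.mul hTm).const_mul 2).integrable_slice s)] at hA
    have : D s = ∫ y, -(2 * (ouLap W (y, s) * pd (dirT n) W (y, s))) ∂gaussMeasure n := by
      rw [integral_neg]; exact eq_neg_of_add_eq_zero_left hA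
    rw [this, hT, hg, ← integral_const_mul, ← integral_const_mul,
      ← integral_sub ((hTm.sq.integrable_slice s).const_mul _)
        ((hf.sq.integrable_slice s).const_mul _)]
    refine integral_mono (((hTm.sq.integrable_slice s).const_mul _).sub
        ((hf.sq.integrable_slice s).const_mul _))
        (((hLm.mul hTm).const_mul 2).neg.integrable_slice s) fun y => ?_
    have h1 := heq (y, s) hs
    simp only at h1 ⊢
    have h2 : ouLap W (y, s) = -(s * pd (dirT n) W (y, s)) / 2 - s ^ 2 * f (y, s) := by
      linarith
    rw [h2]
    have h3 : 0 ≤ s / 2 * (pd (dirT n) W (y, s) + 2 * s * f (y, s)) ^ 2 := by positivity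
    nlinarith
  -- The linear cutoff `b + 1 - s` vanishes at the top and is at least `1` on `(a, b)`; at `a` the
  -- boundary term has the good sign. Its derivative costs `∫ G` over the larger shell, which is why
  -- the estimate reaches up to `b + 1`.
  have hd' : ∀ s, HasDerivAt (fun s => (b + 1 - s) * G s) (-1 * G s + (b + 1 - s) * D s) s :=
    fun s => ((hasDerivAt_id s).const_sub (b + 1)).mul (hd s)
  have hF := intervalIntegral.integral_eq_sub_of_hasDerivAt (a := a) (b := b + 1)
    (fun s _ => hd' s) (Continuous.intervalIntegrable (by fun_prop) _ _)
  have hF0 : ∫ s in a..(b + 1), (-1 * G s + (b + 1 - s) * D s) ≤ 0 := by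
    rw [hF]
    nlinarith [mul_nonneg (sub_nonneg.2 haB) (hG0 a)]
  have key : ∫ s in a..(b + 1), ((b + 1 - s) * (s / 2) * T s) ≤
      ∫ s in a..(b + 1), ((-1 * G s + (b + 1 - s) * D s) + (G s + 2 * (b + 1) ^ 4 * g s)) := by
    refine intervalIntegral.integral_mono_on haB (Continuous.intervalIntegrable (by fun_prop) _ _)
      (Continuous.intervalIntegrable (by fun_prop) _ _) fun s hs => ?_
    have hs0 : 0 < s := lt_of_lt_of_le ha hs.1
    have h1 := mul_le_mul_of_nonneg_left (hDge s hs0) (sub_nonneg.2 hs.2)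
    have h2 : (b + 1 - s) * s ^ 3 ≤ (b + 1) ^ 4 := by
      have : s ^ 3 ≤ (b + 1) ^ 3 := pow_le_pow_left₀ hs0.le hs.2 3
      calc (b + 1 - s) * s ^ 3 ≤ (b + 1) * (b + 1) ^ 3 := by gcongr <;> linarith
        _ = _ := by ring
    have h3 := mul_le_mul_of_nonneg_right h2 (hg0 s)
    nlinarith
  rw [intervalIntegral.integral_add (Continuous.intervalIntegrable (by fun_prop) _ _)
    (Continuous.intervalIntegrable (by fun_prop) _ _),
    intervalIntegral.integral_add (f := G) (Continuous.intervalIntegrable (by fun_prop) _ _)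
    (Continuous.intervalIntegrable (by fun_prop) _ _),
    intervalIntegral.integral_const_mul] at key
  have hleft : a / 2 * ∫ s in a..b, T s ≤ ∫ s in a..(b + 1), ((b + 1 - s) * (s / 2) * T s) := by
    rw [← intervalIntegral.integral_const_mul,
      ← intervalIntegral.integral_add_adjacent_intervals (a := a) (b := b)
        (c := b + 1)
        (Continuous.intervalIntegrable (by fun_prop) _ _)
        (Continuous.intervalIntegrable (by fun_prop) _ _)]
    have h1 : ∫ s in a..b, a / 2 * T s ≤ ∫ s in a..b, ((b + 1 - s) * (s / 2) * T s) := by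
      refine intervalIntegral.integral_mono_on hab
        (Continuous.intervalIntegrable (by fun_prop) _ _)
        (Continuous.intervalIntegrable (by fun_prop) _ _) fun s hs => ?_
      have := hT0 s
      have hs1 := hs.1
      have hs2 := hs.2
      have : a / 2 ≤ (b + 1 - s) * (s / 2) := by nlinarith
      gcongr
    have h2 : 0 ≤ ∫ s in b..(b + 1), ((b + 1 - s) * (s / 2) * T s) := by
      refine intervalIntegral.integral_nonneg (by linarith) fun s hs => ?_
      have h3 := hT0 s
      have : 0 ≤ b + 1 - s := by linarith [hs.2]
      have : 0 < s := by linarith [hs.1]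
      positivity
    linarith
  linarith

/-- The deviation from homogeneity is controlled by the self-similar derivative. -/
lemma integral_abs_homogeneity_le {W : SpaceTime n → ℝ} (hW : W.HasTemperateGrowth) {a b : ℝ}
    (ha : 0 < a) (hab : a ≤ b) :
    ∫ y, |W (y, b) / b ^ 2 - W (y, a) / a ^ 2| ∂gaussMeasure n ≤
      (1 / a ^ 3) * ∫ z, |z.2 * pd (dirT n) W z - 2 * W z| ∂shellMeasure n a b := by
  have hWm : Moderate W := .of_hasTemperateGrowth hW
  have hTm := moderate_pd hW (dirT n)
  have hm := ((Moderate.snd.mul hTm).sub (hWm.const_mul 2)).abs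
  have hc := hm.continuous
  rw [shellMeasure, integral_prod _ (hm.integrable_shell a b), ← integral_const_mul]
  refine integral_mono (((((hWm.integrable_slice b).div_const _).sub
    ((hWm.integrable_slice a).div_const _)).abs)) ?_ fun y => ?_
  · exact ((hm.integrable_shell a b).integral_prod_left).const_mul _
  -- Along each ray `∂ₛ(W/s²) = s⁻³ (s W_s - 2W)`, and `s⁻³ ≤ a⁻³`.
  have hd : ∀ s, 0 < s → HasDerivAt (fun s => W (y, s) / s ^ 2)
      (1 / s ^ 3 * (s * pd (dirT n) W (y, s) - 2 * W (y, s))) s := fun s hs => by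
    refine ((hasDerivAt_time (temperate_differentiable hW) y s).div ((hasDerivAt_id s).pow 2)
      (by simp; positivity)).congr_deriv ?_
    simp only [Pi.pow_apply, id]
    push_cast
    field_simp
  have hcT := hTm.continuous
  have hcW := hWm.continuous
  have hcon : ContinuousOn (fun s => 1 / s ^ 3 * (s * pd (dirT n) W (y, s) - 2 * W (y, s)))
      (uIcc a b) := by
    rw [uIcc_of_le hab]
    refine ContinuousOn.mul (ContinuousOn.div (by fun_prop) (by fun_prop) fun s hs => ?_)
      (by fun_prop)
    have := lt_of_lt_of_le ha hs.1
    positivity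
  rw [← intervalIntegral.integral_eq_sub_of_hasDerivAt (fun s hs => hd s (by
    rw [uIcc_of_le hab] at hs; exact lt_of_lt_of_le ha hs.1)) hcon.intervalIntegrable,
    ← integral_Ioc_eq_integral_Ioo, ← intervalIntegral.integral_of_le hab,
    ← intervalIntegral.integral_const_mul]
  refine (intervalIntegral.abs_integral_le_integral_abs hab).trans
    (intervalIntegral.integral_mono_on hab hcon.abs.intervalIntegrable
      (Continuous.intervalIntegrable (by fun_prop) _ _) fun s hs => ?_)
  have hs0 := lt_of_lt_of_le ha hs.1
  rw [abs_mul, abs_of_pos (by positivity : 0 < 1 / s ^ 3)]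
  gcongr
  exact hs.1

/-! ### Parabolic self-similar coordinates -/

instance : (volume : Measure (SpaceTime n)).IsAddHaarMeasure :=
  inferInstanceAs ((volume : Measure (EuclideanSpace ℝ (Fin n))).prod
    (volume : Measure ℝ)).IsAddHaarMeasure

/-- The parabolic self-similar coordinates `(y, s) ↦ (s y, -s²)`. -/
noncomputable def selfSimMap (z : SpaceTime n) : SpaceTime n := (z.2 • z.1, -z.2 ^ 2)

lemma continuous_selfSimMap : Continuous (selfSimMap : SpaceTime n → SpaceTime n) := by
  unfold selfSimMap; fun_prop

lemma temperate_selfSimMap : (selfSimMap : SpaceTime n → SpaceTime n).HasTemperateGrowth := by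
  have h1 : (fun z : SpaceTime n => z.2 • z.1).HasTemperateGrowth :=
    temperate_snd.smul
      (ContinuousLinearMap.fst ℝ (EuclideanSpace ℝ (Fin n)) ℝ).hasTemperateGrowth
  have h2 : (fun z : SpaceTime n => -z.2 ^ 2).HasTemperateGrowth := (temperate_snd.pow 2).neg
  have h3 := ((ContinuousLinearMap.inl ℝ (EuclideanSpace ℝ (Fin n)) ℝ).hasTemperateGrowth.comp
    h1).add ((ContinuousLinearMap.inr ℝ (EuclideanSpace ℝ (Fin n)) ℝ).hasTemperateGrowth.comp h2)
  convert h3 using 1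
  ext z <;> simp [selfSimMap]

lemma temperate_selfSim {w : SpaceTime n → ℝ} (hw : w.HasTemperateGrowth) :
    (fun z => w (selfSimMap z)).HasTemperateGrowth := hw.comp temperate_selfSimMap

lemma hasFDerivAt_selfSimMap (z : SpaceTime n) :
    HasFDerivAt (selfSimMap : SpaceTime n → SpaceTime n)
      ((z.2 • ContinuousLinearMap.fst ℝ (EuclideanSpace ℝ (Fin n)) ℝ +
        (ContinuousLinearMap.snd ℝ (EuclideanSpace ℝ (Fin n)) ℝ).smulRight z.1).prod
      ((-2 * z.2) • ContinuousLinearMap.snd ℝ (EuclideanSpace ℝ (Fin n)) ℝ)) z := by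
  refine HasFDerivAt.prodMk (HasFDerivAt.fun_smul hasFDerivAt_snd hasFDerivAt_fst) ?_
  refine ((hasFDerivAt_snd (p := z)).pow 2).neg.congr_fderiv ?_
  ext <;> simp

lemma pd_selfSim {w : SpaceTime n → ℝ} (hw : Differentiable ℝ w) (v z : SpaceTime n) :
    pd v (fun z => w (selfSimMap z)) z =
      fderiv ℝ w (selfSimMap z) (z.2 • v.1 + v.2 • z.1, -2 * z.2 * v.2) := by
  have h := (hw (selfSimMap z)).hasFDerivAt.comp z (hasFDerivAt_selfSimMap z)
  change fderiv ℝ (w ∘ selfSimMap) z v = _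
  rw [h.fderiv]
  simp

lemma pd_dirX_selfSim {w : SpaceTime n → ℝ} (hw : Differentiable ℝ w) (i : Fin n) :
    pd (dirX i) (fun z => w (selfSimMap z)) = fun z => z.2 * pd (dirX i) w (selfSimMap z) := by
  ext z
  have : ((z.2 • (dirX i).1 + (dirX i).2 • z.1, -2 * z.2 * (dirX i).2) : SpaceTime n) =
      z.2 • dirX i := by simp [dirX]
  rw [pd_selfSim hw, this, map_smul, smul_eq_mul, pd]

lemma eq_sum_dirX_add (z : SpaceTime n) :
    z = ∑ i, z.1 i • dirX i + z.2 • dirT n := by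
  have h : z.1 = ∑ i, z.1 i • EuclideanSpace.single i (1 : ℝ) := by
    ext j; simp [Finset.sum_apply, Pi.single_apply]
  refine Prod.ext ?_ ?_
  · conv_lhs => rw [h]
    simp [dirX, dirT, Prod.fst_sum]
  · simp [dirX, dirT, Prod.snd_sum]

lemma pd_dirT_selfSim {w : SpaceTime n → ℝ} (hw : Differentiable ℝ w) :
    pd (dirT n) (fun z => w (selfSimMap z)) = fun z =>
      ∑ i, z.1 i * pd (dirX i) w (selfSimMap z) - 2 * z.2 * pd (dirT n) w (selfSimMap z) := by
  ext z
  rw [pd_selfSim hw, eq_sum_dirX_add (n := n) (_, _), map_add, map_sum]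
  simp only [map_smul, smul_eq_mul, pd]
  simp [dirT]
  ring

/-- The heat equation in self-similar coordinates. -/
lemma solvesSelfSimilar_of_heat {w f : SpaceTime n → ℝ} (hw : w.HasTemperateGrowth)
    (heq : ∀ z, pd (dirT n) w z - ∑ i, pd (dirX i) (pd (dirX i) w) z = f z) :
    SolvesSelfSimilar (fun z => w (selfSimMap z)) (fun z => f (selfSimMap z)) := by
  intro z _
  have h2 : ∀ i : Fin n, pd (dirX i) (pd (dirX i) (fun z => w (selfSimMap z))) z =
      z.2 * (z.2 * pd (dirX i) (pd (dirX i) w) (selfSimMap z)) := fun i => by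
    have hd := temperate_differentiable (temperate_pd hw (dirX i))
    rw [pd_dirX_selfSim (temperate_differentiable hw), pd_mul
      (temperate_differentiable temperate_snd)
      (temperate_differentiable (temperate_selfSim (temperate_pd hw _))),
      pd_dirX_selfSim hd]
    have : pd (dirX i) (fun z : SpaceTime n => z.2) z = 0 := by
      rw [pd, fderiv_snd]; simp [dirX]
    rw [this]; ring
  simp only [← heq]
  rw [ouLap, pd_dirT_selfSim (temperate_differentiable hw)]
  simp only [h2]
  simp only [pd_dirX_selfSim (temperate_differentiable hw), Finset.mul_sum, mul_sub,
    Finset.sum_sub_distrib]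
  -- The radial part `s y·∇w` of `s ∂ₛ` cancels the drift of `2 ouLap`.
  have e1 : ∑ i, z.2 * (z.1 i * pd (dirX i) w (selfSimMap z)) =
      ∑ i, 2 * (z.1 i / 2 * (z.2 * pd (dirX i) w (selfSimMap z))) :=
    Finset.sum_congr rfl fun i _ => by ring
  have e2 : ∑ i, 2 * (z.2 * (z.2 * pd (dirX i) (pd (dirX i) w) (selfSimMap z))) =
      -∑ i, -2 * z.2 ^ 2 * pd (dirX i) (pd (dirX i) w) (selfSimMap z) := by
    rw [← Finset.sum_neg_distrib]
    exact Finset.sum_congr rfl fun i _ => by ring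
  rw [e1, e2]; ring

/-! ### Mollification -/

section Convolution

open scoped Convolution
open ContinuousLinearMap (lsmul)

lemma norm_convolution_le_of_growth {F F' : Type} [NormedAddCommGroup F] [NormedSpace ℝ F]
    [NormedAddCommGroup F'] [NormedSpace ℝ F'] (L : F →L[ℝ] ℝ →L[ℝ] F') {ρ : SpaceTime n → F}
    (hρ : Continuous ρ) (hc : HasCompactSupport ρ) {g : SpaceTime n → ℝ} {k : ℕ} {C : ℝ}
    (hg : ∀ z, |g z| ≤ C * (1 + ‖z‖) ^ k) :
    ∃ D : ℝ, ∀ z, ‖(ρ ⋆[L, volume] g) z‖ ≤ D * (1 + ‖z‖) ^ k := by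
  have hC : 0 ≤ C := by simpa using (abs_nonneg _).trans (hg 0)
  refine ⟨∫ t, ‖L‖ * ‖ρ t‖ * (C * (1 + ‖t‖) ^ k), fun z => ?_⟩
  rw [← integral_mul_const]
  refine norm_integral_le_of_norm_le ?_ (Eventually.of_forall fun t => ?_)
  · refine Continuous.integrable_of_hasCompactSupport (by fun_prop) ?_
    have : HasCompactSupport fun t => ‖ρ t‖ := hc.norm
    exact ((this.mul_left (f := fun _ => ‖L‖)).mul_right).mul_right
  · have h1 : (1 + ‖z - t‖) ^ k ≤ (1 + ‖t‖) ^ k * (1 + ‖z‖) ^ k := by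
      rw [← mul_pow]
      gcongr
      nlinarith [norm_sub_le z t, norm_nonneg z, norm_nonneg t]
    calc ‖L (ρ t) (g (z - t))‖ ≤ ‖L‖ * ‖ρ t‖ * ‖g (z - t)‖ := L.le_opNorm₂ _ _
      _ ≤ ‖L‖ * ‖ρ t‖ * (C * ((1 + ‖t‖) ^ k * (1 + ‖z‖) ^ k)) := by
        gcongr
        exact (hg _).trans (by gcongr)
      _ = _ := by ring

/-- All derivatives fall on the kernel, so the growth exponent of `g` is the same at every order.
The pairing `L` and its spaces are quantified inside the induction because each differentiation
replaces `L` by `L.precompL`. -/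
lemma norm_iteratedFDeriv_convolution_le {g : SpaceTime n → ℝ} (hgi : LocallyIntegrable g)
    {k : ℕ} {C : ℝ} (hg : ∀ z, |g z| ≤ C * (1 + ‖z‖) ^ k) (m : ℕ) :
    ∀ {F F' : Type} [NormedAddCommGroup F] [NormedSpace ℝ F] [NormedAddCommGroup F']
      [NormedSpace ℝ F'] (L : F →L[ℝ] ℝ →L[ℝ] F') {ρ : SpaceTime n → F}
      (_ : ContDiff ℝ (⊤ : ℕ∞) ρ) (_ : HasCompactSupport ρ),
    ∃ D : ℝ, ∀ z, ‖iteratedFDeriv ℝ m (ρ ⋆[L, volume] g) z‖ ≤ D * (1 + ‖z‖) ^ k := by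
  induction m with
  | zero =>
    intro F F' _ _ _ _ L ρ hρ hc
    simpa using norm_convolution_le_of_growth L hρ.continuous hc hg
  | succ m ih =>
    intro F F' _ _ _ _ L ρ hρ hc
    have hfd : fderiv ℝ (ρ ⋆[L, volume] g) =
        (fderiv ℝ ρ ⋆[L.precompL (SpaceTime n), volume] g) := by
      ext1 z
      exact (hc.hasFDerivAt_convolution_left L (hρ.of_le (by
        exact WithTop.coe_le_coe.2 (le_top : ((1 : ℕ) : ℕ∞) ≤ ⊤))) hgi z).fderiv
    obtain ⟨D, hD⟩ := ih (L.precompL (SpaceTime n)) (hρ.fderiv_right (by simp)) (hc.fderiv ℝ)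
    exact ⟨D, fun z => by rw [← norm_iteratedFDeriv_fderiv, hfd]; exact hD z⟩

/-- Mollification. -/
noncomputable def mollify (φ : ContDiffBump (0 : SpaceTime n)) (g : SpaceTime n → ℝ) :
    SpaceTime n → ℝ :=
  φ.normed volume ⋆[lsmul ℝ ℝ, volume] g

lemma mollify_apply (φ : ContDiffBump (0 : SpaceTime n)) (g : SpaceTime n → ℝ)
    (z : SpaceTime n) : mollify φ g z = ∫ y, φ.normed volume (z - y) * g y := by
  rw [mollify, convolution_eq_swap]; rfl

lemma temperate_mollify (φ : ContDiffBump (0 : SpaceTime n)) {g : SpaceTime n → ℝ}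
    (hgi : LocallyIntegrable g) {k : ℕ} {C : ℝ} (hg : ∀ z, |g z| ≤ C * (1 + ‖z‖) ^ k) :
    (mollify φ g).HasTemperateGrowth := by
  refine ⟨φ.hasCompactSupport_normed.contDiff_convolution_left _ φ.contDiff_normed hgi,
    fun m => ?_⟩
  obtain ⟨D, hD⟩ := norm_iteratedFDeriv_convolution_le hgi hg m (lsmul ℝ ℝ)
    (φ.contDiff_normed (μ := volume)) φ.hasCompactSupport_normed
  exact ⟨k, D, hD⟩

lemma integrable_bump_mul (φ : ContDiffBump (0 : SpaceTime n)) {g : SpaceTime n → ℝ}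
    (hg : LocallyIntegrable g) (z : SpaceTime n) :
    Integrable fun y => φ.normed volume (z - y) * g y := by
  have h := hg.integrable_smul_left_of_hasCompactSupport
    (g := fun y => φ.normed volume (z - y))
    (φ.continuous_normed.comp (by fun_prop))
    (φ.hasCompactSupport_normed.comp_homeomorph (Homeomorph.subLeft z))
  exact h

/-- The derivative falls on the kernel, and `y ↦ ρ(z - y)` is a test function; the sign of the
reflection cancels the one in the weak derivative. -/
lemma pd_mollify (φ : ContDiffBump (0 : SpaceTime n)) {u g : SpaceTime n → ℝ} {v : SpaceTime n}
    (h : HasWeakDeriv u v g) : pd v (mollify φ u) = mollify φ g := by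
  ext z
  have hsm : ContDiff ℝ (⊤ : ℕ∞) (φ.normed volume : SpaceTime n → ℝ) := φ.contDiff_normed
  have h1 : ContDiff ℝ 1 (φ.normed volume : SpaceTime n → ℝ) := φ.contDiff_normed
  have hfd := (φ.hasCompactSupport_normed.hasFDerivAt_convolution_left (lsmul ℝ ℝ) h1
    h.locInt_fun z).fderiv
  have hcont : Continuous (fderiv ℝ (φ.normed volume : SpaceTime n → ℝ)) :=
    h1.continuous_fderiv one_ne_zero
  have hI : Integrable fun y => ((lsmul ℝ ℝ).precompL (SpaceTime n))
      (fderiv ℝ (φ.normed volume : SpaceTime n → ℝ) (z - y)) (u y) := by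
    have := (φ.hasCompactSupport_normed (μ := volume)).fderiv ℝ
    have hce := this.convolutionExists_left ((lsmul ℝ ℝ).precompL (SpaceTime n)) hcont
      h.locInt_fun z
    have hswap := hce.integrable_swap
    exact hswap
  rw [pd, mollify, hfd, convolution_eq_swap, ContinuousLinearMap.integral_apply hI]
  have hw := h.integral_eq (fun y => φ.normed volume (z - y)) (hsm.comp (by fun_prop))
    (φ.hasCompactSupport_normed.comp_homeomorph (Homeomorph.subLeft z))
  have hder : ∀ y, fderiv ℝ (fun y => φ.normed volume (z - y)) y v =
      -fderiv ℝ (φ.normed volume : SpaceTime n → ℝ) (z - y) v := fun y => by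
    have hd := (h1.differentiable one_ne_zero (z - y)).hasFDerivAt.comp y
      ((hasFDerivAt_id y).const_sub z)
    change fderiv ℝ ((φ.normed volume : SpaceTime n → ℝ) ∘ fun y => z - y) y v = _
    rw [hd.fderiv]; simp
  simp only [hder, mul_neg, integral_neg, neg_inj] at hw
  rw [mollify_apply]
  calc _ = ∫ y, u y * fderiv ℝ (φ.normed volume : SpaceTime n → ℝ) (z - y) v := by
        congr 1; ext y; simp [ContinuousLinearMap.precompL_apply, mul_comm]
    _ = _ := by rw [hw]; congr 1; ext y; ring

/-- Mollifying upgrades an equation valid almost everywhere to one valid at every point. -/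
lemma mollify_sub_sum (φ : ContDiffBump (0 : SpaceTime n)) {g : SpaceTime n → ℝ}
    {h : Fin n → SpaceTime n → ℝ} {f : SpaceTime n → ℝ} (hg : LocallyIntegrable g)
    (hh : ∀ i, LocallyIntegrable (h i)) (hf : ∀ᵐ z, g z - ∑ i, h i z = f z) (z : SpaceTime n) :
    mollify φ g z - ∑ i, mollify φ (h i) z = mollify φ f z := by
  simp only [mollify_apply]
  rw [← integral_finsetSum _ fun i _ => integrable_bump_mul φ (hh i) z,
    ← integral_sub (integrable_bump_mul φ hg z)
      (integrable_finsetSum _ fun i _ => integrable_bump_mul φ (hh i) z)]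
  refine integral_congr_ae ?_
  filter_upwards [hf] with y hy
  rw [← hy, mul_sub, Finset.mul_sum]

/-- The kernel is a probability density supported in the ball of radius `rOut`, so the value at `z`
is an average over that ball. -/
lemma abs_mollify_le (φ : ContDiffBump (0 : SpaceTime n)) {g : SpaceTime n → ℝ} {z : SpaceTime n}
    {D : ℝ} (hg : ∀ y, ‖z - y‖ < φ.rOut → |g y| ≤ D) : |mollify φ g z| ≤ D := by
  rw [mollify_apply]
  have h1 : ∫ y, φ.normed volume (z - y) * D = D := by
    rw [integral_mul_const, integral_sub_left_eq_self (φ.normed volume) volume z,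
      φ.integral_normed, one_mul]
  rw [← h1, ← Real.norm_eq_abs]
  refine norm_integral_le_of_norm_le ?_ (Eventually.of_forall fun y => ?_)
  · exact (φ.integrable_normed.comp_sub_left z).mul_const D
  · rw [norm_mul, Real.norm_of_nonneg (φ.nonneg_normed _)]
    by_cases hy : ‖z - y‖ < φ.rOut
    · exact mul_le_mul_of_nonneg_left (hg y hy) (φ.nonneg_normed _)
    · have : φ.normed volume (z - y) = 0 := by
        rw [← Function.notMem_support, φ.support_normed_eq]
        simpa using hy
      simp [this]

/-- A sequence of bump functions shrinking to the origin. -/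
noncomputable def shrinkingBump (n k : ℕ) : ContDiffBump (0 : SpaceTime n) where
  rIn := 1 / (2 * (k + 1))
  rOut := 1 / (k + 1)
  rIn_pos := by positivity
  rIn_lt_rOut := by
    apply one_div_lt_one_div_of_lt <;> [positivity; linarith [(Nat.cast_nonneg k : (0 : ℝ) ≤ k)]]

lemma shrinkingBump_rOut_le (k : ℕ) : (shrinkingBump n k).rOut ≤ 1 := by
  change 1 / ((k : ℝ) + 1) ≤ 1
  rw [div_le_one (by positivity)]; linarith [(Nat.cast_nonneg k : (0 : ℝ) ≤ k)]

lemma tendsto_shrinkingBump_rOut :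
    Tendsto (fun k => (shrinkingBump n k).rOut) atTop (𝓝 0) :=
  tendsto_one_div_add_atTop_nhds_zero_nat

lemma tendsto_mollify {g : SpaceTime n → ℝ} (hg : Continuous g) (z : SpaceTime n) :
    Tendsto (fun k => mollify (shrinkingBump n k) g z) atTop (𝓝 (g z)) :=
  ContDiffBump.convolution_tendsto_right_of_continuous tendsto_shrinkingBump_rOut hg z

/-- Lebesgue differentiation. It requires `rOut ≤ K * rIn` with a fixed `K`; `shrinkingBump` has
equality with `K = 2`. -/
lemma ae_tendsto_mollify {g : SpaceTime n → ℝ} (hg : LocallyIntegrable g) :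
    ∀ᵐ z, Tendsto (fun k => mollify (shrinkingBump n k) g z) atTop (𝓝 (g z)) :=
  ContDiffBump.ae_convolution_tendsto_right_of_locallyIntegrable (K := 2)
    tendsto_shrinkingBump_rOut (Eventually.of_forall fun k => by
      change 1 / ((k : ℝ) + 1) ≤ 2 * (1 / (2 * (k + 1)))
      apply le_of_eq; field_simp) hg

end Convolution

/-! ### Change of variables between strips and Gaussian shells -/

lemma backwardHeatKernel_nonneg {z : SpaceTime n} (hz : z.2 < 0) : 0 ≤ backwardHeatKernel z := by
  have : 0 < 4 * Real.pi * (-z.2) := by have := Real.pi_pos; nlinarith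
  unfold backwardHeatKernel; positivity

lemma measurable_backwardHeatKernel :
    Measurable (backwardHeatKernel : SpaceTime n → ℝ) := by
  unfold backwardHeatKernel; fun_prop

/-- The exponent depends only on `x/s = y`. The remaining factor `s⁻ⁿ` is cancelled in
`lintegral_slice_kernel` by the Jacobian of `x = s y`. -/
lemma backwardHeatKernel_selfSimMap {s : ℝ} (hs : 0 < s) (y : EuclideanSpace ℝ (Fin n)) :
    backwardHeatKernel (selfSimMap (y, s)) = (s ^ n)⁻¹ * gaussDensity y := by
  have h1 : (4 * Real.pi * (- -s ^ 2)) ^ ((n : ℝ) / 2) = (4 * Real.pi) ^ ((n : ℝ) / 2) * s ^ n := by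
    rw [neg_neg, Real.mul_rpow (by positivity) (by positivity), ← Real.rpow_natCast s 2,
      ← Real.rpow_mul hs.le, ← Real.rpow_natCast s n]
    congr 2; push_cast; ring
  have h2 : -‖s • y‖ ^ 2 / (-4 * -s ^ 2) = -‖y‖ ^ 2 / 4 := by
    rw [norm_smul, Real.norm_of_nonneg hs.le]; field_simp
  simp only [backwardHeatKernel, selfSimMap, gaussDensity]
  rw [h1, h2]
  field_simp

lemma lintegral_comp_smul_euclidean {s : ℝ} (hs : 0 < s)
    {h : EuclideanSpace ℝ (Fin n) → ENNReal} (hh : Measurable h) :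
    ∫⁻ y, h (s • y) = ENNReal.ofReal (s ^ n)⁻¹ * ∫⁻ x, h x := by
  have e := Measure.map_addHaar_smul (volume : Measure (EuclideanSpace ℝ (Fin n))) hs.ne'
  rw [← lintegral_map hh (measurable_const_smul s), e, lintegral_smul_measure]
  simp [abs_of_pos hs]

lemma lintegral_slice_kernel {s : ℝ} (hs : 0 < s) {F : SpaceTime n → ENNReal}
    (hF : Measurable F) :
    ∫⁻ x, F (x, -s ^ 2) * ENNReal.ofReal (backwardHeatKernel ((x, -s ^ 2) : SpaceTime n)) =
      ∫⁻ y, F (selfSimMap (y, s)) ∂gaussMeasure n := by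
  have hm : Measurable fun x : EuclideanSpace ℝ (Fin n) => F (x, -s ^ 2) *
      ENNReal.ofReal (backwardHeatKernel ((x, -s ^ 2) : SpaceTime n)) :=
    (hF.comp (by fun_prop)).mul (measurable_backwardHeatKernel.comp (by fun_prop)).ennreal_ofReal
  have h := lintegral_comp_smul_euclidean hs hm
  have hk : ∀ y : EuclideanSpace ℝ (Fin n), backwardHeatKernel ((s • y, -s ^ 2) : SpaceTime n) =
      (s ^ n)⁻¹ * gaussDensity y := backwardHeatKernel_selfSimMap hs
  simp only [hk, ENNReal.ofReal_mul (inv_nonneg.2 (pow_nonneg hs.le n))] at h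
  have hmF : Measurable fun y : EuclideanSpace ℝ (Fin n) => F (selfSimMap (y, s)) :=
    hF.comp (continuous_selfSimMap.measurable.comp (by fun_prop))
  have h' : ∫⁻ y : EuclideanSpace ℝ (Fin n), F (s • y, -s ^ 2) *
      (ENNReal.ofReal (s ^ n)⁻¹ * ENNReal.ofReal (gaussDensity y)) =
      ENNReal.ofReal (s ^ n)⁻¹ * ∫⁻ y, F (selfSimMap (y, s)) ∂gaussMeasure n := by
    rw [gaussMeasure, lintegral_withDensity_eq_lintegral_mul _ measurable_ofReal_gaussDensity hmF,
      ← lintegral_const_mul _ (measurable_ofReal_gaussDensity.mul hmF)]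
    refine lintegral_congr fun y => ?_
    simp only [Pi.mul_apply, selfSimMap]
    ring
  rw [h'] at h
  have h0 : ENNReal.ofReal (s ^ n)⁻¹ ≠ 0 := by simpa using pow_pos hs n
  exact ((ENNReal.mul_right_inj h0 ENNReal.ofReal_ne_top).1 h).symm

lemma image_neg_sq_Ioo {a b : ℝ} (ha : 0 < a) (hb : 0 ≤ b) :
    (fun s : ℝ => -s ^ 2) '' Ioo a b = Ioo (-b ^ 2) (-a ^ 2) := by
  ext t
  constructor
  · rintro ⟨s, ⟨h1, h2⟩, rfl⟩
    constructor <;> simp only <;> nlinarith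
  · rintro ⟨h1, h2⟩
    have ht : 0 ≤ -t := by nlinarith
    have hq := Real.sq_sqrt ht
    have hq0 := Real.sqrt_nonneg (-t)
    refine ⟨√(-t), ⟨?_, ?_⟩, ?_⟩
    · exact Real.lt_sqrt_of_sq_lt (by linarith)
    · by_contra hb'
      push Not at hb'
      nlinarith
    · simp only [hq, neg_neg]

/-- Integration in self-similar coordinates. -/
lemma lintegral_strip {a b : ℝ} (ha : 0 < a) (hb : 0 ≤ b) {F : SpaceTime n → ENNReal}
    (hF : Measurable F) :
    ∫⁻ z in univ ×ˢ Ioo (-b ^ 2) (-a ^ 2), F z * ENNReal.ofReal (backwardHeatKernel z) =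
      ∫⁻ z, ENNReal.ofReal (2 * z.2) * F (selfSimMap z) ∂shellMeasure n a b := by
  have hm : Measurable fun z : SpaceTime n => F z * ENNReal.ofReal (backwardHeatKernel z) :=
    hF.mul measurable_backwardHeatKernel.ennreal_ofReal
  have hm' : Measurable fun z : SpaceTime n => ENNReal.ofReal (2 * z.2) * F (selfSimMap z) :=
    (by fun_prop : Measurable fun z : SpaceTime n => ENNReal.ofReal (2 * z.2)).mul
      (hF.comp continuous_selfSimMap.measurable)
  have e1 : (volume : Measure (SpaceTime n)).restrict (univ ×ˢ Ioo (-b ^ 2) (-a ^ 2)) =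
      (volume : Measure (EuclideanSpace ℝ (Fin n))).prod
        (volume.restrict (Ioo (-b ^ 2) (-a ^ 2))) := by
    rw [Measure.volume_eq_prod, ← Measure.prod_restrict, Measure.restrict_univ]
  -- The substitution `t = -s²` is injective on `s > 0`, and `|dt| = 2s ds` supplies the weight on
  -- the right.
  rw [e1, lintegral_prod_symm' _ hm, shellMeasure, lintegral_prod_symm' _ hm',
    ← image_neg_sq_Ioo ha hb,
    lintegral_image_eq_lintegral_abs_deriv_mul measurableSet_Ioo (f' := fun s => -(2 * s))
      (fun s _ => by
        refine HasDerivAt.hasDerivWithinAt ?_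
        exact ((hasDerivAt_id s).pow 2).neg.congr_deriv (by simp))
      (fun s hs t ht h => by
        have h0 : 0 < s := ha.trans hs.1
        have h1 : 0 < t := ha.trans ht.1
        simp only [neg_inj] at h
        exact (sq_eq_sq₀ h0.le h1.le).1 h)]
  refine setLIntegral_congr_fun measurableSet_Ioo fun s hs => ?_
  have hs0 : 0 < s := ha.trans hs.1
  have hFs : Measurable fun y : EuclideanSpace ℝ (Fin n) => F (selfSimMap (y, s)) :=
    hF.comp (continuous_selfSimMap.measurable.comp (by fun_prop))
  simp only
  rw [lintegral_slice_kernel hs0 hF, lintegral_const_mul _ hFs, abs_neg,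
    abs_of_pos (by linarith)]

/-- Stated for measures, the change of variables presupposes no integrability; integrals,
integrability and null sets all transfer from it. -/
lemma map_selfSimMap {a b : ℝ} (ha : 0 < a) (hb : 0 ≤ b) :
    Measure.map selfSimMap ((shellMeasure n a b).withDensity fun z => ENNReal.ofReal (2 * z.2)) =
      (volume.restrict (univ ×ˢ Ioo (-b ^ 2) (-a ^ 2))).withDensity
        fun z => ENNReal.ofReal (backwardHeatKernel z) := by
  refine Measure.ext_of_lintegral _ fun F hF => ?_
  have hFm : Measurable fun z : SpaceTime n => F (selfSimMap z) :=
    hF.comp continuous_selfSimMap.measurable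
  rw [lintegral_map hF continuous_selfSimMap.measurable,
    lintegral_withDensity_eq_lintegral_mul _ (by fun_prop) hFm,
    lintegral_withDensity_eq_lintegral_mul _ measurable_backwardHeatKernel.ennreal_ofReal hF]
  have h := lintegral_strip (n := n) ha hb hF
  simp only [Pi.mul_apply]
  rw [← h]
  exact lintegral_congr fun z => mul_comm _ _

/-- The density `2s` is positive on the shell, so Lebesgue-null sets pull back to null sets. This
carries the almost everywhere convergence of mollifications over to the shells. -/
lemma quasiMeasurePreserving_selfSimMap {a b : ℝ} (ha : 0 < a) (hb : 0 ≤ b) :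
    Measure.QuasiMeasurePreserving (selfSimMap : SpaceTime n → SpaceTime n)
      (shellMeasure n a b) volume := by
  refine ⟨continuous_selfSimMap.measurable, ?_⟩
  have h1 : shellMeasure n a b ≪
      (shellMeasure n a b).withDensity fun z => ENNReal.ofReal (2 * z.2) := by
    refine withDensity_absolutelyContinuous' (by fun_prop) ?_
    filter_upwards [ae_shell_mem a b] with z hz
    simpa using ha.trans hz.1
  refine (h1.map continuous_selfSimMap.measurable).trans ?_
  rw [map_selfSimMap ha hb]
  exact (withDensity_absolutelyContinuous _ _).trans Measure.absolutelyContinuous_restrict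

lemma strip_eq (r : ℝ) : strip n r = univ ×ˢ Ioo (-(2 * r) ^ 2) (-r ^ 2) := by
  ext z
  simp only [strip, mem_ofPred_eq, mem_prod, mem_univ, true_and, mem_Ioo]
  rw [show -4 * r ^ 2 = -(2 * r) ^ 2 by ring]

lemma ae_strip_neg {r : ℝ} : ∀ᵐ z ∂(volume.restrict (strip n r)), z.2 < 0 := by
  have hm : MeasurableSet (strip n r) := by
    rw [strip_eq]; exact MeasurableSet.univ.prod measurableSet_Ioo
  filter_upwards [ae_restrict_mem hm] with z hz
  have := hz.2
  nlinarith [sq_nonneg r]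

lemma integral_strip {r : ℝ} (hr : 0 < r) {f : SpaceTime n → ℝ} (hf : AEStronglyMeasurable f) :
    ∫ z in strip n r, f z * backwardHeatKernel z =
      ∫ z, 2 * z.2 * f (selfSimMap z) ∂shellMeasure n r (2 * r) := by
  have hmap := map_selfSimMap (n := n) hr (by linarith : 0 ≤ 2 * r)
  rw [← strip_eq] at hmap
  have h1 : ∫ z in strip n r, f z * backwardHeatKernel z =
      ∫ z, f z ∂((volume.restrict (strip n r)).withDensity
        fun z => ENNReal.ofReal (backwardHeatKernel z)) := by
    rw [integral_withDensity_eq_integral_toReal_smul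
      measurable_backwardHeatKernel.ennreal_ofReal (by simp)]
    refine integral_congr_ae ?_
    filter_upwards [ae_strip_neg] with z hz
    rw [ENNReal.toReal_ofReal (backwardHeatKernel_nonneg hz), smul_eq_mul, mul_comm]
  have hf' : AEStronglyMeasurable f (Measure.map selfSimMap
      ((shellMeasure n r (2 * r)).withDensity fun z => ENNReal.ofReal (2 * z.2))) := by
    rw [hmap]
    exact hf.restrict.mono_ac (withDensity_absolutelyContinuous _ _)
  rw [h1, ← hmap, integral_map continuous_selfSimMap.measurable.aemeasurable hf',
    integral_withDensity_eq_integral_toReal_smul (by fun_prop)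
      (Eventually.of_forall fun _ => ENNReal.ofReal_lt_top)]
  refine integral_congr_ae ?_
  filter_upwards [ae_shell_mem r (2 * r)] with z hz
  have : 0 < z.2 := hr.trans hz.1
  rw [ENNReal.toReal_ofReal (by linarith), smul_eq_mul]

lemma integrableOn_strip {r : ℝ} (hr : 0 < r) {f : SpaceTime n → ℝ}
    (hf : AEStronglyMeasurable f)
    (hi : Integrable (fun z => 2 * z.2 * f (selfSimMap z)) (shellMeasure n r (2 * r))) :
    IntegrableOn (fun z => f z * backwardHeatKernel z) (strip n r) := by
  have hmap := map_selfSimMap (n := n) hr (by linarith : 0 ≤ 2 * r)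
  rw [← strip_eq] at hmap
  have hf' : AEStronglyMeasurable f (Measure.map selfSimMap
      ((shellMeasure n r (2 * r)).withDensity fun z => ENNReal.ofReal (2 * z.2))) := by
    rw [hmap]
    exact hf.restrict.mono_ac (withDensity_absolutelyContinuous _ _)
  have h2 : Integrable f ((volume.restrict (strip n r)).withDensity
        fun z => ENNReal.ofReal (backwardHeatKernel z)) := by
    rw [← hmap, integrable_map_measure hf' continuous_selfSimMap.measurable.aemeasurable,
      integrable_withDensity_iff_integrable_smul' (by fun_prop)
        (Eventually.of_forall fun _ => ENNReal.ofReal_lt_top)]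
    refine hi.congr ?_
    filter_upwards [ae_shell_mem r (2 * r)] with z hz
    have : 0 < z.2 := hr.trans hz.1
    rw [ENNReal.toReal_ofReal (by linarith), smul_eq_mul, Function.comp_apply]
  rw [integrable_withDensity_iff_integrable_smul'
    measurable_backwardHeatKernel.ennreal_ofReal (by simp)] at h2
  refine h2.congr ?_
  filter_upwards [ae_strip_neg] with z hz
  rw [ENNReal.toReal_ofReal (backwardHeatKernel_nonneg hz), smul_eq_mul, mul_comm]

/-! ### Convergence in `Lᵖ` -/

section LpLimits

variable {α : Type*} [MeasurableSpace α] {μ : Measure α} {p : ENNReal}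

/-- `F k → G` in `Lᵖ(μ)`. -/
structure LpLim (p : ENNReal) (μ : Measure α) (F : ℕ → α → ℝ) (G : α → ℝ) : Prop where
  memLp : ∀ k, MemLp (F k) p μ
  memLp_lim : MemLp G p μ
  tendsto : Tendsto (fun k => eLpNorm (fun z => F k z - G z) p μ) atTop (𝓝 0)

lemma LpLim.of_le {F : ℕ → α → ℝ} {G : α → ℝ} (hF : ∀ k, MemLp (F k) p μ) (hG : MemLp G p μ)
    {e : ℕ → ENNReal} (he : Tendsto e atTop (𝓝 0))
    (h : ∀ k, eLpNorm (fun z => F k z - G z) p μ ≤ e k) : LpLim p μ F G :=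
  ⟨hF, hG, tendsto_of_tendsto_of_tendsto_of_le_of_le tendsto_const_nhds he (fun _ => zero_le) h⟩

lemma LpLim.const {G : α → ℝ} (hG : MemLp G p μ) : LpLim p μ (fun _ => G) G :=
  ⟨fun _ => hG, hG, by simp⟩

lemma LpLim.add (hp : 1 ≤ p) {F F' : ℕ → α → ℝ} {G G' : α → ℝ} (h : LpLim p μ F G)
    (h' : LpLim p μ F' G') :
    LpLim p μ (fun k z => F k z + F' k z) (fun z => G z + G' z) := by
  refine .of_le (fun k => (h.memLp k).add (h'.memLp k)) (h.memLp_lim.add h'.memLp_lim)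
    (by simpa using h.tendsto.add h'.tendsto) fun k => ?_
  refine le_trans (le_of_eq ?_) (eLpNorm_add_le ((h.memLp k).sub h.memLp_lim).1
    ((h'.memLp k).sub h'.memLp_lim).1 hp)
  congr 1; ext z; simp; ring

lemma LpLim.bdd_mul {F : ℕ → α → ℝ} {G : α → ℝ} (h : LpLim p μ F G) {m : α → ℝ}
    (hm : AEStronglyMeasurable m μ) {C : ℝ} (hC : ∀ᵐ z ∂μ, |m z| ≤ C) :
    LpLim p μ (fun k z => m z * F k z) (fun z => m z * G z) := by
  have hmem : ∀ {f : α → ℝ}, MemLp f p μ → MemLp (fun z => m z * f z) p μ := fun hf => by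
    refine hf.of_le_mul (c := C) (hm.mul hf.1) ?_
    filter_upwards [hC] with z hz
    rw [norm_mul]
    exact mul_le_mul_of_nonneg_right hz (norm_nonneg _)
  refine .of_le (e := fun k => ENNReal.ofReal C * eLpNorm (fun z => F k z - G z) p μ)
    (fun k => hmem (h.memLp k)) (hmem h.memLp_lim)
    (by simpa using ENNReal.Tendsto.const_mul h.tendsto (Or.inr ENNReal.ofReal_ne_top))
    fun k => ?_
  refine eLpNorm_le_mul_eLpNorm_of_ae_le_mul ?_ p
  filter_upwards [hC] with z hz
  rw [← mul_sub, norm_mul]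
  exact mul_le_mul_of_nonneg_right hz (norm_nonneg _)

lemma LpLim.const_mul {F : ℕ → α → ℝ} {G : α → ℝ} (h : LpLim p μ F G) (c : ℝ) :
    LpLim p μ (fun k z => c * F k z) (fun z => c * G z) :=
  h.bdd_mul (m := fun _ => c) aestronglyMeasurable_const
    (Eventually.of_forall fun _ => le_refl |c|)

lemma LpLim.sub (hp : 1 ≤ p) {F F' : ℕ → α → ℝ} {G G' : α → ℝ} (h : LpLim p μ F G)
    (h' : LpLim p μ F' G') :
    LpLim p μ (fun k z => F k z - F' k z) (fun z => G z - G' z) := by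
  simpa [sub_eq_add_neg] using h.add hp (h'.const_mul (-1))

lemma LpLim.sum (hp : 1 ≤ p) {ι : Type*} (s : Finset ι) {F : ι → ℕ → α → ℝ} {G : ι → α → ℝ}
    (h : ∀ i, LpLim p μ (F i) (G i)) :
    LpLim p μ (fun k z => ∑ i ∈ s, F i k z) (fun z => ∑ i ∈ s, G i z) := by
  classical
  induction s using Finset.induction_on with
  | empty => simpa using LpLim.const (p := p) (μ := μ) (G := fun _ => (0 : ℝ)) MemLp.zero'
  | insert a s ha ih => simpa [Finset.sum_insert ha] using (h a).add hp ih

lemma eLpNorm_one_mul_le {f g : α → ℝ} (hf : MemLp f 2 μ) (hg : MemLp g 2 μ) :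
    eLpNorm (fun z => f z * g z) 1 μ ≤ eLpNorm f 2 μ * eLpNorm g 2 μ := by
  have h := eLpNorm_le_eLpNorm_mul_eLpNorm_of_nnnorm (p := 2) (q := 2) (r := 1) hf.1 hg.1
    (fun x y : ℝ => x * y) 1 (Eventually.of_forall fun z => by simp)
  rwa [ENNReal.coe_one, one_mul] at h

lemma memLp_one_mul {f g : α → ℝ} (hf : MemLp f 2 μ) (hg : MemLp g 2 μ) :
    MemLp (fun z => f z * g z) 1 μ :=
  MemLp.mul' (p := 2) (q := 2) (r := 1) hg hf

/-- Hölder applied to `FF' - GG' = (F-G)(F'-G') + (F-G)G' + G(F'-G')`. -/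
lemma LpLim.mul {F F' : ℕ → α → ℝ} {G G' : α → ℝ} (h : LpLim 2 μ F G)
    (h' : LpLim 2 μ F' G') :
    LpLim 1 μ (fun k z => F k z * F' k z) (fun z => G z * G' z) := by
  have hd := fun k => (h.memLp k).sub h.memLp_lim
  have hd' := fun k => (h'.memLp k).sub h'.memLp_lim
  refine .of_le (e := fun k => eLpNorm (fun z => F k z - G z) 2 μ *
      eLpNorm (fun z => F' k z - G' z) 2 μ + eLpNorm (fun z => F k z - G z) 2 μ * eLpNorm G' 2 μ +
      eLpNorm G 2 μ * eLpNorm (fun z => F' k z - G' z) 2 μ)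
    (fun k => memLp_one_mul (h.memLp k) (h'.memLp k)) (memLp_one_mul h.memLp_lim h'.memLp_lim) ?_ fun k => ?_
  · have h1 := ENNReal.Tendsto.mul h.tendsto (Or.inr ENNReal.zero_ne_top) h'.tendsto
      (Or.inr ENNReal.zero_ne_top)
    have h2 := ENNReal.Tendsto.mul_const h.tendsto (b := eLpNorm G' 2 μ)
      (Or.inr h'.memLp_lim.2.ne)
    have h3 := ENNReal.Tendsto.const_mul h'.tendsto (a := eLpNorm G 2 μ)
      (Or.inr h.memLp_lim.2.ne)
    simpa using (h1.add h2).add h3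
  · have m1 := memLp_one_mul (hd k) (hd' k)
    have m2 := memLp_one_mul (hd k) h'.memLp_lim
    have m3 := memLp_one_mul h.memLp_lim (hd' k)
    have e1 := eLpNorm_one_mul_le (hd k) (hd' k)
    have e2 := eLpNorm_one_mul_le (hd k) h'.memLp_lim
    have e3 := eLpNorm_one_mul_le h.memLp_lim (hd' k)
    have e4 := eLpNorm_add_le m1.1 m2.1 le_rfl
    have e5 := eLpNorm_add_le (m1.add m2).1 m3.1 le_rfl
    have e6 := e5.trans (add_le_add (e4.trans (add_le_add e1 e2)) e3)
    refine le_trans (le_of_eq ?_) e6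
    congr 1; ext z; simp only [Pi.add_apply, Pi.sub_apply]; ring

lemma LpLim.one_of_two [IsFiniteMeasure μ] {F : ℕ → α → ℝ} {G : α → ℝ} (h : LpLim 2 μ F G) :
    LpLim 1 μ F G := by
  simpa using h.mul (LpLim.const (memLp_const (1 : ℝ)))

lemma LpLim.congr {F F' : ℕ → α → ℝ} {G G' : α → ℝ} (h : LpLim p μ F G)
    (hF : ∀ k, F k =ᵐ[μ] F' k) (hG : G =ᵐ[μ] G') : LpLim p μ F' G' :=
  ⟨fun k => (memLp_congr_ae (hF k)).1 (h.memLp k), (memLp_congr_ae hG).1 h.memLp_lim, by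
    refine h.tendsto.congr fun k => eLpNorm_congr_ae ?_
    filter_upwards [hF k, hG] with z h1 h2
    rw [h1, h2]⟩

lemma eLpNorm_two_eq {f : α → ℝ} (hf : MemLp f 2 μ) :
    eLpNorm f 2 μ = ENNReal.ofReal (√(∫ z, f z ^ 2 ∂μ)) := by
  rw [hf.eLpNorm_eq_integral_rpow_norm (by simp) (by simp), Real.sqrt_eq_rpow]
  simp

lemma LpLim.tendsto_integral_sq {F : ℕ → α → ℝ} {G : α → ℝ} (h : LpLim 2 μ F G) :
    Tendsto (fun k => ∫ z, (F k z - G z) ^ 2 ∂μ) atTop (𝓝 0) := by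
  have h1 := (ENNReal.tendsto_toReal ENNReal.zero_ne_top).comp h.tendsto
  have h2 := h1.pow 2
  simp only [Function.comp_def, ENNReal.toReal_zero, ne_eq, OfNat.ofNat_ne_zero,
    not_false_eq_true, zero_pow] at h2
  refine h2.congr fun k => ?_
  have := eLpNorm_two_eq ((h.memLp k).sub h.memLp_lim)
  simp only [Pi.sub_apply] at this
  change eLpNorm (fun z => F k z - G z) 2 μ = _ at this
  rw [this, ENNReal.toReal_ofReal (Real.sqrt_nonneg _), Real.sq_sqrt]
  exact integral_nonneg fun z => sq_nonneg _

lemma LpLim.tendsto_integral_abs {F : ℕ → α → ℝ} {G : α → ℝ} (h : LpLim 1 μ F G) :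
    Tendsto (fun k => ∫ z, |F k z - G z| ∂μ) atTop (𝓝 0) := by
  have h1 := (ENNReal.tendsto_toReal ENNReal.zero_ne_top).comp h.tendsto
  refine h1.congr fun k => ?_
  simp only [Function.comp_apply, eLpNorm_one_eq_lintegral_enorm]
  exact (integral_norm_eq_lintegral_enorm ((h.memLp k).sub h.memLp_lim).1).symm

lemma LpLim.tendsto_integral {F : ℕ → α → ℝ} {G : α → ℝ} (h : LpLim 1 μ F G) :
    Tendsto (fun k => ∫ z, F k z ∂μ) atTop (𝓝 (∫ z, G z ∂μ)) := by
  rw [tendsto_iff_norm_sub_tendsto_zero]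
  refine squeeze_zero (fun k => norm_nonneg _) (fun k => ?_) h.tendsto_integral_abs
  rw [← integral_sub (memLp_one_iff_integrable.1 (h.memLp k))
    (memLp_one_iff_integrable.1 h.memLp_lim)]
  exact norm_integral_le_integral_norm _

/-- Dominated convergence in `L²`. -/
lemma LpLim.of_dominated {F : ℕ → α → ℝ} {G g : α → ℝ}
    (hF : ∀ k, AEStronglyMeasurable (F k) μ) (hg : MemLp g 2 μ)
    (hb : ∀ k, ∀ᵐ z ∂μ, |F k z| ≤ g z)
    (hlim : ∀ᵐ z ∂μ, Tendsto (fun k => F k z) atTop (𝓝 (G z))) : LpLim 2 μ F G := by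
  have hGm : AEStronglyMeasurable G μ := aestronglyMeasurable_of_tendsto_ae atTop hF hlim
  have hb' : ∀ᵐ z ∂μ, ∀ k, |F k z| ≤ g z := ae_all_iff.2 hb
  have hbG : ∀ᵐ z ∂μ, |G z| ≤ g z := by
    filter_upwards [hb', hlim] with z h1 h2
    exact le_of_tendsto h2.abs (Eventually.of_forall h1)
  have hFl : ∀ k, MemLp (F k) 2 μ := fun k => hg.mono' (hF k) (hb k)
  have hGl : MemLp G 2 μ := hg.mono' hGm hbG
  have hmain : Tendsto (fun k => ∫ z, (F k z - G z) ^ 2 ∂μ) atTop (𝓝 0) := by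
    have := tendsto_integral_of_dominated_convergence (μ := μ)
      (F := fun k z => (F k z - G z) ^ 2) (f := fun _ => 0) (fun z => 4 * g z ^ 2)
      (fun k => ((hF k).sub hGm).pow 2) (hg.integrable_sq.const_mul 4)
      (fun k => by
        filter_upwards [hb k, hbG] with z h1 h2
        rw [Real.norm_of_nonneg (sq_nonneg _)]
        have h3 : |F k z - G z| ≤ 2 * g z := (abs_sub _ _).trans (by linarith)
        calc (F k z - G z) ^ 2 = |F k z - G z| ^ 2 := (sq_abs _).symm
          _ ≤ (2 * g z) ^ 2 := by gcongr
          _ = _ := by ring)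
      (by
        filter_upwards [hlim] with z hz
        simpa using (hz.sub_const (G z)).pow 2)
    simpa using this
  refine .of_le hFl hGl (e := fun k => ENNReal.ofReal (√(∫ z, (F k z - G z) ^ 2 ∂μ))) ?_
    fun k => (eLpNorm_two_eq ((hFl k).sub hGl)).le
  have := ENNReal.tendsto_ofReal ((Real.continuous_sqrt.tendsto 0).comp hmain)
  simpa using this

/-- An `L²` Cauchy sequence that converges almost everywhere converges in `L²`. -/
lemma LpLim.of_cauchy {F : ℕ → α → ℝ} {G : α → ℝ} (hF : ∀ k, MemLp (F k) 2 μ) {e : ℕ → ℝ}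
    (he : Tendsto e atTop (𝓝 0)) (hc : ∀ k m, ∫ z, (F k z - F m z) ^ 2 ∂μ ≤ e k + e m)
    (hlim : ∀ᵐ z ∂μ, Tendsto (fun k => F k z) atTop (𝓝 (G z))) : LpLim 2 μ F G := by
  have hGm : AEStronglyMeasurable G μ :=
    aestronglyMeasurable_of_tendsto_ae atTop (fun k => (hF k).1) hlim
  have hle : ∀ k, eLpNorm (fun z => F k z - G z) 2 μ ≤ ENNReal.ofReal (√(e k)) := fun k => by
    -- Fatou in `m` with `k` fixed: the distance of `F k` to the limit is at most the lower limit of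
    -- its distances to `F m`, and `e m` tends to `0`.
    have h1 := Lp.eLpNorm_lim_le_liminf_eLpNorm (p := 2) (μ := μ)
      (f := fun m z => F k z - F m z) (fun m => ((hF k).sub (hF m)).1)
      (fun z => F k z - G z) (by
        filter_upwards [hlim] with z hz
        exact tendsto_const_nhds.sub hz)
    refine h1.trans ?_
    have h2 : Tendsto (fun m => ENNReal.ofReal (√(e k + e m))) atTop
        (𝓝 (ENNReal.ofReal (√(e k)))) := by
      refine ENNReal.tendsto_ofReal ((Real.continuous_sqrt.tendsto _).comp ?_)
      simpa using he.const_add (e k)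
    rw [← h2.liminf_eq]
    refine liminf_le_liminf (Eventually.of_forall fun m => ?_)
    have := eLpNorm_two_eq ((hF k).sub (hF m))
    refine this.le.trans (ENNReal.ofReal_le_ofReal (Real.sqrt_le_sqrt (hc k m)))
  have hd : MemLp (fun z => F 0 z - G z) 2 μ :=
    ⟨(hF 0).1.sub hGm, (hle 0).trans_lt ENNReal.ofReal_lt_top⟩
  have hGl : MemLp G 2 μ := by
    refine ((hF 0).sub hd).ae_eq (Eventually.of_forall fun z => ?_)
    simp
  refine .of_le hF hGl ?_ hle
  have := ENNReal.tendsto_ofReal ((Real.continuous_sqrt.tendsto 0).comp he)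
  simpa using this

end LpLimits

/-! ### Limits of smooth approximations on shells -/

lemma shellMeasure_mono {a b a' b' : ℝ} (ha : a ≤ a') (hb : b' ≤ b) :
    shellMeasure n a' b' ≤ shellMeasure n a b :=
  Measure.prod_mono le_rfl (Measure.restrict_mono (Ioo_subset_Ioo ha hb) le_rfl)

/-- Passage to the limit in a differential identity for averages over shells. -/
lemma hasDerivAt_shell_of_tendsto {N Φ : ℕ → SpaceTime n → ℝ} {N' Φ' : SpaceTime n → ℝ}
    (hN : ∀ a b, 0 < a → a < b → LpLim 1 (shellMeasure n a b) N N')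
    (hΦ : ∀ a b, 0 < a → a < b → LpLim 1 (shellMeasure n a b) Φ Φ')
    (hd : ∀ k r, 0 < r → HasDerivAt (fun r => 1 / r ^ 4 * ∫ z, N k z ∂shellMeasure n r (2 * r))
      (1 / r ^ 5 * ∫ z, Φ k z ∂shellMeasure n r (2 * r)) r) {r : ℝ} (hr : 0 < r) :
    HasDerivAt (fun r => 1 / r ^ 4 * ∫ z, N' z ∂shellMeasure n r (2 * r))
      (1 / r ^ 5 * ∫ z, Φ' z ∂shellMeasure n r (2 * r)) r := by
  refine hasDerivAt_of_tendstoLocallyUniformlyOn (l := atTop) (s := Ioi 0) isOpen_Ioi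
    (f := fun k r => 1 / r ^ 4 * ∫ z, N k z ∂shellMeasure n r (2 * r))
    (f' := fun k r => 1 / r ^ 5 * ∫ z, Φ k z ∂shellMeasure n r (2 * r))
    (g' := fun r => 1 / r ^ 5 * ∫ z, Φ' z ∂shellMeasure n r (2 * r)) ?_
    (Eventually.of_forall fun k x hx => hd k x hx) (fun x hx =>
      ((hN x (2 * x) hx (by linarith [mem_Ioi.1 hx])).tendsto_integral).const_mul _) hr
  rw [Metric.tendstoLocallyUniformlyOn_iff]
  intro ε hε x hx
  have hx0 : 0 < x := hx
  -- Every shell `(r, 2r)` with `x/2 < r < 2x` lies in `(x/2, 4x)`, so one `L¹` convergence on that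
  -- shell makes the derivatives converge uniformly in `r`.
  refine ⟨Ioo (x / 2) (2 * x), mem_nhdsWithin_of_mem_nhds
    (Ioo_mem_nhds (by linarith) (by linarith)), ?_⟩
  have hL := hΦ (x / 2) (4 * x) (by linarith) (by linarith)
  have ht := hL.tendsto_integral_abs.const_mul (1 / (x / 2) ^ 5)
  rw [mul_zero] at ht
  filter_upwards [ht.eventually (gt_mem_nhds hε)] with k hk r hr'
  have hr0 : 0 < r := by linarith [hr'.1]
  have hle : shellMeasure n r (2 * r) ≤ shellMeasure n (x / 2) (4 * x) :=
    shellMeasure_mono hr'.1.le (by linarith [hr'.2])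
  have i1 := memLp_one_iff_integrable.1 (hL.memLp k)
  have i2 := memLp_one_iff_integrable.1 hL.memLp_lim
  rw [dist_comm, Real.dist_eq, ← mul_sub,
    ← integral_sub (i1.mono_measure hle) (i2.mono_measure hle), abs_mul,
    abs_of_pos (by positivity)]
  refine lt_of_le_of_lt ?_ hk
  have h1 : |∫ z, (Φ k z - Φ' z) ∂shellMeasure n r (2 * r)| ≤
      ∫ z, |Φ k z - Φ' z| ∂shellMeasure n (x / 2) (4 * x) :=
    (norm_integral_le_integral_norm _).trans (integral_mono_measure hle
      (Eventually.of_forall fun z => norm_nonneg _) (i1.sub i2).norm)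
  have h2 : 1 / r ^ 5 ≤ 1 / (x / 2) ^ 5 := by
    have := hr'.1.le
    gcongr
  gcongr

lemma Moderate.memLp_two {F : SpaceTime n → ℝ} (hF : Moderate F) (a b : ℝ) :
    MemLp F 2 (shellMeasure n a b) :=
  (memLp_two_iff_integrable_sq hF.continuous.aestronglyMeasurable).2 (hF.sq.integrable_shell a b)

lemma pd_sub {F G : SpaceTime n → ℝ} (hF : Differentiable ℝ F) (hG : Differentiable ℝ G)
    (v : SpaceTime n) : pd v (fun z => F z - G z) = fun z => pd v F z - pd v G z := by
  ext z
  simp [pd, fderiv_fun_sub (hF z) (hG z)]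

lemma SolvesSelfSimilar.sub {W V f g : SpaceTime n → ℝ} (hW : W.HasTemperateGrowth)
    (hV : V.HasTemperateGrowth) (h : SolvesSelfSimilar W f) (h' : SolvesSelfSimilar V g) :
    SolvesSelfSimilar (fun z => W z - V z) (fun z => f z - g z) := by
  intro z hz
  have e : ouLap (fun z => W z - V z) z = ouLap W z - ouLap V z := by
    simp only [ouLap, pd_sub (temperate_differentiable hW) (temperate_differentiable hV),
      pd_sub (temperate_differentiable (temperate_pd hW _))
        (temperate_differentiable (temperate_pd hV _)), ← Finset.sum_sub_distrib]
    exact Finset.sum_congr rfl fun i _ => by ring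
  rw [e, pd_sub (temperate_differentiable hW) (temperate_differentiable hV)]
  have h1 := h z hz
  have h2 := h' z hz
  simp only
  linarith

/-- Smooth solutions `W k` with sources `f k` in self-similar coordinates that approximate `U`,
its gradient `Ui`, its self-similar derivative `Us` and its source `χ`. -/
structure Approximates (W f : ℕ → SpaceTime n → ℝ) (U : SpaceTime n → ℝ)
    (Ui : Fin n → SpaceTime n → ℝ) (Us χ : SpaceTime n → ℝ) : Prop where
  temperate : ∀ k, (W k).HasTemperateGrowth
  moderate : ∀ k, Moderate (f k)
  abs_le : ∀ k z, |f k z| ≤ 1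
  solves : ∀ k, SolvesSelfSimilar (W k) (f k)
  continuous : Continuous U
  dominated : ∃ g, Moderate g ∧ ∀ k z, |W k z| ≤ g z
  tendsto : ∀ z, Tendsto (fun k => W k z) atTop (𝓝 (U z))
  ae_tendsto_grad : ∀ i a b, 0 < a → a < b → ∀ᵐ z ∂shellMeasure n a b,
    Tendsto (fun k => pd (dirX i) (W k) z) atTop (𝓝 (Ui i z))
  ae_tendsto_time : ∀ a b, 0 < a → a < b → ∀ᵐ z ∂shellMeasure n a b,
    Tendsto (fun k => pd (dirT n) (W k) z) atTop (𝓝 (Us z))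
  ae_tendsto_source : ∀ a b, 0 < a → a < b → ∀ᵐ z ∂shellMeasure n a b,
    Tendsto (fun k => f k z) atTop (𝓝 (χ z))

section

variable {W f : ℕ → SpaceTime n → ℝ} {U : SpaceTime n → ℝ} {Ui : Fin n → SpaceTime n → ℝ}
  {Us χ : SpaceTime n → ℝ}

lemma Approximates.moderate_approx (h : Approximates W f U Ui Us χ) (k : ℕ) : Moderate (W k) :=
  .of_hasTemperateGrowth (h.temperate k)

lemma Approximates.exists_bound (h : Approximates W f U Ui Us χ) :
    ∃ g, Moderate g ∧ (∀ k z, |W k z| ≤ g z) ∧ ∀ z, |U z| ≤ g z := by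
  obtain ⟨g, hg, hb⟩ := h.dominated
  exact ⟨g, hg, hb, fun z => le_of_tendsto (h.tendsto z).abs (Eventually.of_forall (hb · z))⟩

lemma Approximates.moderate_lim (h : Approximates W f U Ui Us χ) : Moderate U := by
  obtain ⟨g, hg, -, hb⟩ := h.exists_bound
  exact hg.mono h.continuous fun z => (hb z).trans (le_abs_self _)

lemma Approximates.lpLim (h : Approximates W f U Ui Us χ) (a b : ℝ) :
    LpLim 2 (shellMeasure n a b) W U := by
  obtain ⟨g, hg, hb, -⟩ := h.exists_bound
  exact .of_dominated (fun k => (h.moderate_approx k).continuous.aestronglyMeasurable)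
    (hg.memLp_two a b) (fun k => Eventually.of_forall (hb k)) (Eventually.of_forall h.tendsto)

lemma Approximates.lpLim_slice (h : Approximates W f U Ui Us χ) (s : ℝ) :
    LpLim 2 (gaussMeasure n) (fun k y => W k (y, s)) (fun y => U (y, s)) := by
  obtain ⟨g, hg, hb, -⟩ := h.exists_bound
  refine .of_dominated (g := fun y => g (y, s))
    (fun k => ((h.moderate_approx k).continuous.comp (by fun_prop)).aestronglyMeasurable) ?_
    (fun k => Eventually.of_forall fun y => hb k _) (Eventually.of_forall fun y => h.tendsto _)
  exact (memLp_two_iff_integrable_sq (hg.continuous.comp (by fun_prop)).aestronglyMeasurable).2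
    (hg.sq.integrable_slice s)

lemma Approximates.lpLim_source (h : Approximates W f U Ui Us χ) {a b : ℝ} (ha : 0 < a)
    (hab : a < b) : LpLim 2 (shellMeasure n a b) f χ :=
  .of_dominated (g := fun _ => 1) (fun k => (h.moderate k).continuous.aestronglyMeasurable)
    (memLp_const 1) (fun k => Eventually.of_forall (h.abs_le k)) (h.ae_tendsto_source a b ha hab)

lemma integral_sub_sq_le {α : Type*} [MeasurableSpace α] {μ : Measure α} {F G H : α → ℝ}
    (hF : MemLp F 2 μ) (hG : MemLp G 2 μ) (hH : MemLp H 2 μ) :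
    ∫ z, (F z - G z) ^ 2 ∂μ ≤
      2 * ∫ z, (F z - H z) ^ 2 ∂μ + 2 * ∫ z, (G z - H z) ^ 2 ∂μ := by
  have h1 := (hF.sub hH).integrable_sq
  have h2 := (hG.sub hH).integrable_sq
  have h3 := (hF.sub hG).integrable_sq
  simp only [Pi.sub_apply] at h1 h2 h3
  rw [← integral_const_mul, ← integral_const_mul,
    ← integral_add (h1.const_mul 2) (h2.const_mul 2)]
  refine integral_mono h3 ((h1.const_mul 2).add (h2.const_mul 2)) fun z => ?_
  simp only
  nlinarith [sq_nonneg ((F z - H z) + (G z - H z))]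

/-- By linearity the Caccioppoli estimate applies to `W k - W m`. For the sources only `|f k - f m|
≤ 2` is used, so convergence of the functions alone makes the gradients Cauchy. -/
lemma Approximates.exists_gradSq_le (h : Approximates W f U Ui Us χ) {a b : ℝ} (ha : 0 < a)
    (hab : a < b) : ∃ e : ℕ → ℝ, Tendsto e atTop (𝓝 0) ∧ ∀ k m,
      ∫ z, gradSq (fun z => W k z - W m z) z ∂shellMeasure n a b ≤ e k + e m := by
  have hb := ha.trans hab
  refine ⟨fun k => b / 2 * ∫ y, (W k (y, b) - U (y, b)) ^ 2 ∂gaussMeasure n +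
    2 * b ^ 2 * ∫ z, |W k z - U z| ∂shellMeasure n a b, ?_, fun k m => ?_⟩
  · simpa using ((h.lpLim_slice b).tendsto_integral_sq.const_mul (b / 2)).add
      ((h.lpLim a b).one_of_two.tendsto_integral_abs.const_mul (2 * b ^ 2))
  have hk := h.moderate_approx k
  have hm := h.moderate_approx m
  have hU := h.moderate_lim
  have hfd := (h.moderate k).sub (h.moderate m)
  have h1 := integral_shell_gradSq_le ((h.temperate k).sub (h.temperate m)) hfd
    ((h.solves k).sub (h.temperate k) (h.temperate m) (h.solves m)) ha hab.le
  have h2 := integral_sub_sq_le ((h.lpLim_slice b).memLp k) ((h.lpLim_slice b).memLp m)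
    (h.lpLim_slice b).memLp_lim
  have h3 : ∫ z, |W k z - W m z| * |f k z - f m z| ∂shellMeasure n a b ≤
      2 * ∫ z, |W k z - U z| ∂shellMeasure n a b + 2 * ∫ z, |W m z - U z| ∂shellMeasure n a b := by
    have i1 := ((hk.sub hU).abs.const_mul 2).integrable_shell a b
    have i2 := ((hm.sub hU).abs.const_mul 2).integrable_shell a b
    rw [← integral_const_mul, ← integral_const_mul, ← integral_add i1 i2]
    refine integral_mono (((hk.sub hm).abs.mul hfd.abs).integrable_shell a b) (i1.add i2)
      fun z => ?_
    have e1 : |f k z - f m z| ≤ 2 := (abs_sub _ _).trans (by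
      linarith [h.abs_le k z, h.abs_le m z])
    have e2 : |W k z - W m z| ≤ |W k z - U z| + |W m z - U z| := by
      rw [abs_sub_comm (W m z)]; exact abs_sub_le _ _ _
    simp only
    calc _ ≤ (|W k z - U z| + |W m z - U z|) * 2 := by gcongr
      _ = _ := by ring
  have h4 := mul_le_mul_of_nonneg_left h2 (by positivity : 0 ≤ b / 4)
  have h5 := mul_le_mul_of_nonneg_left h3 (by positivity : 0 ≤ b ^ 2)
  refine (h1.trans (add_le_add h4 h5)).trans (le_of_eq ?_)
  ring

/-- The Cauchy property gives an `L²` limit, and the pointwise limit of the mollified derivatives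
identifies it as `Ui`. -/
lemma Approximates.lpLim_grad (h : Approximates W f U Ui Us χ) (i : Fin n) {a b : ℝ}
    (ha : 0 < a) (hab : a < b) :
    LpLim 2 (shellMeasure n a b) (fun k => pd (dirX i) (W k)) (Ui i) := by
  obtain ⟨e, he, hc⟩ := h.exists_gradSq_le ha hab
  refine .of_cauchy (fun k => (moderate_pd (h.temperate k) _).memLp_two a b) he (fun k m => ?_)
    (h.ae_tendsto_grad i a b ha hab)
  refine le_trans ?_ (hc k m)
  refine integral_mono ((((moderate_pd (h.temperate k) _).sub
    (moderate_pd (h.temperate m) _)).sq).integrable_shell a b)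
    ((moderate_gradSq ((h.temperate k).sub (h.temperate m))).integrable_shell a b) fun z => ?_
  simp only [gradSq, pd_sub (temperate_differentiable (h.temperate k))
    (temperate_differentiable (h.temperate m))]
  exact Finset.single_le_sum
    (f := fun i => (pd (dirX i) (W k) z - pd (dirX i) (W m) z) ^ 2)
    (fun i _ => sq_nonneg _) (Finset.mem_univ i)

/-- Here the `L²` convergence of the sources is needed, and the gradients must be Cauchy on the
larger shell up to `b + 1`, where the estimate spends its cutoff. -/
lemma Approximates.lpLim_time (h : Approximates W f U Ui Us χ) {a b : ℝ}
    (ha : 0 < a) (hab : a < b) :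
    LpLim 2 (shellMeasure n a b) (fun k => pd (dirT n) (W k)) Us := by
  have hb := ha.trans hab
  have haB : a < b + 1 := by linarith
  obtain ⟨e, he, hc⟩ := h.exists_gradSq_le ha haB
  have hs := h.lpLim_source ha haB
  refine .of_cauchy (fun k => (moderate_pd (h.temperate k) _).memLp_two a b)
    (e := fun k => 2 / a * (e k + 4 * (b + 1) ^ 4 *
      ∫ z, (f k z - χ z) ^ 2 ∂shellMeasure n a (b + 1))) ?_ (fun k m => ?_)
    (h.ae_tendsto_time a b ha hab)
  · simpa using (he.add (hs.tendsto_integral_sq.const_mul (4 * (b + 1) ^ 4))).const_mul (2 / a)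
  have h1 := integral_shell_time_sq_le (W := fun z => W k z - W m z) ((h.temperate k).sub (h.temperate m))
    ((h.moderate k).sub (h.moderate m))
    ((h.solves k).sub (h.temperate k) (h.temperate m) (h.solves m)) ha hab.le
  have h2 := integral_sub_sq_le (hs.memLp k) (hs.memLp m) hs.memLp_lim
  simp only [pd_sub (temperate_differentiable (h.temperate k))
    (temperate_differentiable (h.temperate m))] at h1
  have h3 := mul_le_mul_of_nonneg_left h2 (by positivity : 0 ≤ 2 * (b + 1) ^ 4)
  have h4 := h1.trans (add_le_add (hc k m) h3)
  rw [div_mul_eq_mul_div, div_le_iff₀ two_pos] at h4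
  rw [← mul_add, div_mul_eq_mul_div, le_div_iff₀ ha]
  linarith

lemma abs_inv_snd_mul_le {a b : ℝ} (ha : 0 < a) :
    ∀ᵐ z ∂shellMeasure n a b, |z.2⁻¹| ≤ a⁻¹ := by
  filter_upwards [ae_shell_mem a b] with z hz
  rw [abs_of_pos (inv_pos.2 (ha.trans hz.1))]
  exact inv_anti₀ ha hz.1.le

lemma abs_snd_pow_le {a b : ℝ} (ha : 0 < a) (j : ℕ) :
    ∀ᵐ z ∂shellMeasure n a b, |z.2 ^ j| ≤ b ^ j := by
  filter_upwards [ae_shell_mem a b] with z hz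
  have := ha.trans hz.1
  rw [abs_of_pos (by positivity)]
  exact pow_le_pow_left₀ this.le hz.2.le j

lemma LpLim.inv_snd_mul {p : ENNReal} {F : ℕ → SpaceTime n → ℝ} {G : SpaceTime n → ℝ} {a b : ℝ}
    (ha : 0 < a) (h : LpLim p (shellMeasure n a b) F G) :
    LpLim p (shellMeasure n a b) (fun k z => z.2⁻¹ * F k z) (fun z => z.2⁻¹ * G z) :=
  h.bdd_mul (measurable_snd.inv.aestronglyMeasurable) (abs_inv_snd_mul_le ha)

lemma LpLim.snd_pow_mul {p : ENNReal} {F : ℕ → SpaceTime n → ℝ} {G : SpaceTime n → ℝ} {a b : ℝ}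
    (ha : 0 < a) (j : ℕ) (h : LpLim p (shellMeasure n a b) F G) :
    LpLim p (shellMeasure n a b) (fun k z => z.2 ^ j * F k z) (fun z => z.2 ^ j * G z) :=
  h.bdd_mul ((measurable_snd.pow_const j).aestronglyMeasurable) (abs_snd_pow_le ha j)

/-- Convergence of the integrands of the Weiss functional. -/
lemma LpLim.weissN {a b : ℝ} (ha : 0 < a) {u : ℕ → SpaceTime n → ℝ} {G : ℕ → SpaceTime n → ℝ}
    {β : ℕ → ℝ → ℝ} {u' G' : SpaceTime n → ℝ} {β' : ℝ → ℝ}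
    (hu : LpLim 2 (shellMeasure n a b) u u') (hG : LpLim 1 (shellMeasure n a b) G G')
    (hβ : LpLim 2 (shellMeasure n a b) (fun k z => β k (u k z)) (fun z => β' (u' z))) :
    LpLim 1 (shellMeasure n a b) (fun k => weissN (β k) (u k) (G k)) (weissN β' u' G') := by
  have h := ((((hG.sub le_rfl (hu.mul hu)).sub le_rfl
    ((hβ.one_of_two.snd_pow_mul ha 2).const_mul 2))).const_mul 2).inv_snd_mul ha
  refine h.congr (fun k => Eventually.of_forall fun z => ?_) (Eventually.of_forall fun z => ?_) <;>
  · simp only [WeissMonotonicity.weissN]; ring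

/-- Convergence of the integrands of the derivative of the Weiss functional. -/
lemma LpLim.weissPhi {a b : ℝ} (ha : 0 < a) {u t g : ℕ → SpaceTime n → ℝ}
    {β γ : ℕ → ℝ → ℝ} {u' t' g' : SpaceTime n → ℝ} {β' γ' : ℝ → ℝ}
    (hu : LpLim 2 (shellMeasure n a b) u u') (ht : LpLim 2 (shellMeasure n a b) t t')
    (hg : LpLim 2 (shellMeasure n a b) g g')
    (hβ : LpLim 2 (shellMeasure n a b) (fun k z => β k (u k z)) (fun z => β' (u' z)))
    (hγ : LpLim 2 (shellMeasure n a b) (fun k z => γ k (u k z)) (fun z => γ' (u' z))) :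
    LpLim 1 (shellMeasure n a b) (fun k => weissPhi (β k) (γ k) (u k) (t k) (g k))
      (weissPhi β' γ' u' t' g') := by
  have h12 : (1 : ENNReal) ≤ 2 := by norm_num
  have h1 := ((ht.snd_pow_mul ha 1).sub h12 (hu.const_mul 2))
  have h2 := (((hg.sub h12 hγ).mul ht).snd_pow_mul ha 3).const_mul 4
  have h3 := ((hβ.one_of_two.sub le_rfl (hu.mul hg)).snd_pow_mul ha 2).const_mul 8
  have h := (((((h1.mul h1).const_mul 2).add le_rfl h2).add le_rfl h3)).inv_snd_mul ha
  refine h.congr (fun k => Eventually.of_forall fun z => ?_) (Eventually.of_forall fun z => ?_) <;>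
  · simp only [WeissMonotonicity.weissPhi]; ring

lemma Approximates.lpLim_gradSq (h : Approximates W f U Ui Us χ) {a b : ℝ} (ha : 0 < a)
    (hab : a < b) : LpLim 1 (shellMeasure n a b) (fun k => gradSq (W k))
      (fun z => ∑ i, Ui i z ^ 2) := by
  have := LpLim.sum le_rfl Finset.univ
    (fun i => (h.lpLim_grad i ha hab).mul (h.lpLim_grad i ha hab))
  refine this.congr (fun k => Eventually.of_forall fun z => ?_) (Eventually.of_forall fun z => ?_) <;>
  · simp only [gradSq, sq]

lemma Approximates.lpLim_ramp (h : Approximates W f U Ui Us χ) {β β' : ℝ → ℝ} (hβ : Ramp β β')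
    (a b : ℝ) : LpLim 2 (shellMeasure n a b) (fun k z => β (W k z)) (fun z => β (U z)) := by
  obtain ⟨g, hg, hb, -⟩ := h.exists_bound
  exact .of_dominated
    (fun k => ((h.moderate_approx k).ramp hβ).continuous.aestronglyMeasurable)
    (hg.memLp_two a b) (fun k => Eventually.of_forall fun z => (hβ.abs_le _).trans (hb k z))
    (Eventually.of_forall fun z => (hβ.continuous.tendsto _).comp (h.tendsto z))

lemma Approximates.lpLim_ramp_deriv (h : Approximates W f U Ui Us χ) {β β' : ℝ → ℝ}
    (hβ : Ramp β β') (a b : ℝ) :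
    LpLim 2 (shellMeasure n a b) (fun k z => β' (W k z)) (fun z => β' (U z)) :=
  .of_dominated (g := fun _ => 1)
    (fun k => ((h.moderate_approx k).ramp_deriv hβ).continuous.aestronglyMeasurable)
    (memLp_const 1) (fun _ => Eventually.of_forall fun _ => hβ.abs_deriv_le _)
    (Eventually.of_forall fun z => (hβ.continuous_deriv.tendsto _).comp (h.tendsto z))

/-- The first of two limits: `β` stays fixed, so that `β'` is continuous and `β'(W k)` converges
pointwise. -/
lemma Approximates.hasDerivAt_ramp (h : Approximates W f U Ui Us χ) {β β' : ℝ → ℝ}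
    (hβ : Ramp β β') {r : ℝ} (hr : 0 < r) :
    HasDerivAt (fun r => 1 / r ^ 4 *
        ∫ z, weissN β U (fun z => ∑ i, Ui i z ^ 2) z ∂shellMeasure n r (2 * r))
      (1 / r ^ 5 * ∫ z, weissPhi β β' U Us χ z ∂shellMeasure n r (2 * r)) r :=
  hasDerivAt_shell_of_tendsto
    (fun a b ha hab => LpLim.weissN (β := fun _ => β) ha (h.lpLim a b) (h.lpLim_gradSq ha hab)
      (h.lpLim_ramp hβ a b))
    (fun a b ha hab => LpLim.weissPhi (β := fun _ => β) (γ := fun _ => β') ha (h.lpLim a b)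
      (h.lpLim_time ha hab) (h.lpLim_source ha hab) (h.lpLim_ramp hβ a b)
      (h.lpLim_ramp_deriv hβ a b))
    (fun k _ hx => hasDerivAt_weiss_smooth (h.temperate k) (h.moderate k) (h.solves k) hβ hx) hr

end

/-! ### Regularization of the positive part and the Weiss formula for the limit -/

/-- Squaring removes the kink at `0`; this is what makes `softRamp`, which contains the positive
part only through its square, continuously differentiable. -/
lemma hasDerivAt_max_zero_sq (x : ℝ) : HasDerivAt (fun x : ℝ => max x 0 ^ 2) (2 * max x 0) x := by
  rcases lt_trichotomy x 0 with hx | rfl | hx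
  · rw [max_eq_right hx.le, mul_zero]
    refine (hasDerivAt_const x (0 : ℝ)).congr_of_eventuallyEq ?_
    filter_upwards [Iio_mem_nhds hx] with y hy
    rw [max_eq_right (mem_Iio.1 hy).le]; simp
  · rw [max_self, mul_zero, hasDerivAt_iff_tendsto_slope_zero]
    refine squeeze_zero_norm (a := fun t => |t|) (fun t => ?_) ?_
    · rcases le_total t 0 with ht | ht
      · simp [ht]
      · rcases ht.eq_or_lt with rfl | ht'
        · simp
        · simp [max_eq_left ht, sq, ht'.ne']
    · simpa using (continuous_abs.tendsto (0 : ℝ)).mono_left nhdsWithin_le_nhds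
  · rw [max_eq_left hx.le]
    refine (((hasDerivAt_id x).pow 2).congr_of_eventuallyEq ?_).congr_deriv (by simp)
    filter_upwards [Ioi_mem_nhds hx] with y hy
    rw [max_eq_left (mem_Ioi.1 hy).le]; simp

/-- A `C¹` regularization of the positive part. -/
noncomputable def softRamp (δ x : ℝ) : ℝ := √(max x 0 ^ 2 + δ ^ 2) - δ

/-- The derivative of `softRamp δ`. -/
noncomputable def softStep (δ x : ℝ) : ℝ := max x 0 / √(max x 0 ^ 2 + δ ^ 2)

/-- The Heaviside function. -/
noncomputable def step (x : ℝ) : ℝ := if 0 < x then 1 else 0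

lemma ramp_softRamp {δ : ℝ} (hδ : 0 < δ) : Ramp (softRamp δ) (softStep δ) where
  deriv x := by
    have hp : 0 < max x 0 ^ 2 + δ ^ 2 := by positivity
    refine ((((hasDerivAt_max_zero_sq x).add_const (δ ^ 2)).sqrt hp.ne').sub_const δ).congr_deriv ?_
    rw [softStep]; field_simp
  continuous_deriv := by
    unfold softStep
    refine Continuous.div (by fun_prop) (by fun_prop) fun x => ?_
    positivity
  abs_deriv_le x := by
    have hp : 0 < √(max x 0 ^ 2 + δ ^ 2) := by positivity
    have h0 : 0 ≤ max x 0 := le_max_right _ _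
    rw [softStep, abs_of_nonneg (by positivity), div_le_one hp]
    exact Real.le_sqrt_of_sq_le (by nlinarith)
  abs_le x := by
    have h0 : 0 ≤ max x 0 := le_max_right _ _
    have h1 : δ ≤ √(max x 0 ^ 2 + δ ^ 2) := Real.le_sqrt_of_sq_le (by nlinarith)
    have h2 : √(max x 0 ^ 2 + δ ^ 2) ≤ max x 0 + δ :=
      Real.sqrt_le_iff.2 ⟨by positivity, by nlinarith⟩
    rw [softRamp, abs_of_nonneg (by linarith)]
    have : max x 0 ≤ |x| := max_le (le_abs_self x) (abs_nonneg x)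
    linarith

lemma tendsto_softRamp (x : ℝ) :
    Tendsto (fun k : ℕ => softRamp (1 / ((k : ℝ) + 1)) x) atTop (𝓝 (max x 0)) := by
  have hc : Continuous fun δ => softRamp δ x := by unfold softRamp; fun_prop
  have h := (hc.tendsto 0).comp (tendsto_one_div_add_atTop_nhds_zero_nat (𝕜 := ℝ))
  have e : softRamp 0 x = max x 0 := by
    simp [softRamp, Real.sqrt_sq (le_max_right x 0)]
  rwa [e] at h

/-- For `x ≤ 0` the value is `0` for every `δ`, so the limit agrees with `step` at `x = 0` too.
Hence nothing has to be known about derivatives on the set `{U = 0}`. -/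
lemma tendsto_softStep (x : ℝ) :
    Tendsto (fun k : ℕ => softStep (1 / ((k : ℝ) + 1)) x) atTop (𝓝 (step x)) := by
  by_cases hx : 0 < x
  · have hc : ContinuousAt (fun δ => softStep δ x) 0 := by
      unfold softStep
      refine ContinuousAt.div (by fun_prop) (by fun_prop) ?_
      rw [max_eq_left hx.le]
      positivity
    have h := hc.tendsto.comp (tendsto_one_div_add_atTop_nhds_zero_nat (𝕜 := ℝ))
    have e : softStep 0 x = step x := by
      rw [softStep, max_eq_left hx.le, step, if_pos hx, zero_pow two_ne_zero, add_zero,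
        Real.sqrt_sq hx.le, div_self hx.ne']
    rwa [e] at h
  · have e : ∀ δ, softStep δ x = step x := fun δ => by
      rw [softStep, max_eq_right (not_lt.1 hx), step, if_neg hx, zero_div]
    simp [e]

lemma mul_step (x : ℝ) : x * step x = max x 0 := by
  unfold step
  split_ifs with h
  · rw [mul_one, max_eq_left h.le]
  · rw [mul_zero, max_eq_right (not_lt.1 h)]

variable {W f : ℕ → SpaceTime n → ℝ} {U : SpaceTime n → ℝ} {Ui : Fin n → SpaceTime n → ℝ}
  {Us : SpaceTime n → ℝ}

/-- The Weiss functional as a function of the self-similar data. -/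
noncomputable def weissAverage (U : SpaceTime n → ℝ) (Ui : Fin n → SpaceTime n → ℝ) (r : ℝ) : ℝ :=
  1 / r ^ 4 * ∫ z, weissN (fun x => max x 0) U (fun z => ∑ i, Ui i z ^ 2) z
    ∂shellMeasure n r (2 * r)

/-- The Weiss formula in self-similar coordinates. -/
theorem Approximates.hasDerivAt_weissAverage
    (h : Approximates W f U Ui Us fun z => step (U z)) {r : ℝ} (hr : 0 < r) :
    HasDerivAt (weissAverage U Ui)
      (1 / r ^ 5 * ∫ z, z.2⁻¹ * (2 * (z.2 * Us z - 2 * U z) ^ 2) ∂shellMeasure n r (2 * r)) r := by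
  have hU := h.moderate_lim
  have hδ : ∀ k : ℕ, 0 < 1 / ((k : ℝ) + 1) := fun k => by positivity
  have hβ : ∀ a b, LpLim 2 (shellMeasure n a b)
      (fun (k : ℕ) z => softRamp (1 / ((k : ℝ) + 1)) (U z)) (fun z => max (U z) 0) := fun a b =>
    .of_dominated (g := fun z => |U z|)
      (fun k => (hU.ramp (ramp_softRamp (hδ k))).continuous.aestronglyMeasurable)
      (hU.abs.memLp_two a b) (fun k => Eventually.of_forall fun z => (ramp_softRamp (hδ k)).abs_le _)
      (Eventually.of_forall fun z => tendsto_softRamp _)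
  have hγ : ∀ a b, LpLim 2 (shellMeasure n a b)
      (fun (k : ℕ) z => softStep (1 / ((k : ℝ) + 1)) (U z)) (fun z => step (U z)) := fun a b =>
    .of_dominated (g := fun _ => 1)
      (fun k => (hU.ramp_deriv (ramp_softRamp (hδ k))).continuous.aestronglyMeasurable)
      (memLp_const 1) (fun k => Eventually.of_forall fun z => (ramp_softRamp (hδ k)).abs_deriv_le _)
      (Eventually.of_forall fun z => tendsto_softStep _)
  have key := hasDerivAt_shell_of_tendsto (r := r)
    (fun a b ha hab => LpLim.weissN (β' := fun x => max x 0) ha (.const (hU.memLp_two a b))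
      (.const (h.lpLim_gradSq ha hab).memLp_lim) (hβ a b))
    (fun a b ha hab => LpLim.weissPhi (β' := fun x => max x 0) (γ' := step) ha
      (.const (hU.memLp_two a b)) (.const (h.lpLim_time ha hab).memLp_lim)
      (.const (h.lpLim_source ha hab).memLp_lim) (hβ a b) (hγ a b))
    (fun k x hx => h.hasDerivAt_ramp (ramp_softRamp (hδ k)) hx) hr
  refine key.congr_deriv ?_
  congr 1
  refine integral_congr_ae (Eventually.of_forall fun z => ?_)
  -- The source and the limit of `β'(U)` are both `step U`, so their difference vanishes
  -- identically; `mul_step` removes `β(U) - U f`.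
  simp only [weissPhi, mul_step]
  ring

lemma Approximates.integrable_sq_dev {χ : SpaceTime n → ℝ} (h : Approximates W f U Ui Us χ)
    {a b : ℝ} (ha : 0 < a) (hab : a < b) :
    Integrable (fun z => z.2⁻¹ * (2 * (z.2 * Us z - 2 * U z) ^ 2)) (shellMeasure n a b) := by
  have h12 : (1 : ENNReal) ≤ 2 := by norm_num
  have h1 := ((h.lpLim_time ha hab).snd_pow_mul ha 1).sub h12 ((h.lpLim a b).const_mul 2)
  have h2 := ((h1.mul h1).const_mul 2).inv_snd_mul ha
  refine (memLp_one_iff_integrable.1 h2.memLp_lim).congr (Eventually.of_forall fun z => ?_)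
  simp only; ring

lemma sq_dev_nonneg (a b : ℝ) (ha : 0 < a) : 0 ≤ᵐ[shellMeasure n a b]
    fun z => z.2⁻¹ * (2 * (z.2 * Us z - 2 * U z) ^ 2) := by
  filter_upwards [ae_shell_mem a b] with z hz
  have : 0 < z.2 := ha.trans hz.1
  simp only [Pi.zero_apply]
  positivity

/-! ### Homogeneity, energy identity and lower bound -/

/-- If the derivative of the Weiss functional vanishes, then `U` is homogeneous in `s`. -/
lemma Approximates.homogeneous_of_dev_eq_zero {χ : SpaceTime n → ℝ}
    (h : Approximates W f U Ui Us χ) {a b : ℝ} (ha : 0 < a) (hab : a < b)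
    (hz : ∀ᵐ z ∂shellMeasure n a b, z.2 * Us z - 2 * U z = 0) (y : EuclideanSpace ℝ (Fin n)) :
    U (y, b) / b ^ 2 = U (y, a) / a ^ 2 := by
  have h12 : (1 : ENNReal) ≤ 2 := by norm_num
  have h1 := (((h.lpLim_time ha hab).snd_pow_mul ha 1).sub h12
    ((h.lpLim a b).const_mul 2)).one_of_two.tendsto_integral_abs
  -- By `hz` the limit of `s ∂ₛW k - 2 W k` is zero, so the `L¹` distance to the limit is the
  -- integral itself.
  have h2 : Tendsto (fun k => (1 / a ^ 3) *
      ∫ z, |z.2 * pd (dirT n) (W k) z - 2 * W k z| ∂shellMeasure n a b) atTop (𝓝 0) := by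
    have h1' := h1.const_mul (1 / a ^ 3)
    rw [mul_zero] at h1'
    refine h1'.congr fun k => ?_
    congr 1
    refine integral_congr_ae ?_
    filter_upwards [hz] with z hz
    simp only [pow_one, hz, sub_zero]
  have h3 : ∀ s, Tendsto (fun k => ∫ y, |W k (y, s) - U (y, s)| ∂gaussMeasure n) atTop (𝓝 0) :=
    fun s => (h.lpLim_slice s).one_of_two.tendsto_integral_abs
  have hU := h.moderate_lim
  have hW := h.moderate_approx
  have hb := ha.trans hab
  have iU : Integrable (fun y => |U (y, b) / b ^ 2 - U (y, a) / a ^ 2|) (gaussMeasure n) :=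
    (((hU.integrable_slice b).div_const _).sub ((hU.integrable_slice a).div_const _)).abs
  have hle : ∀ k, ∫ y, |U (y, b) / b ^ 2 - U (y, a) / a ^ 2| ∂gaussMeasure n ≤
      (1 / a ^ 3) * (∫ z, |z.2 * pd (dirT n) (W k) z - 2 * W k z| ∂shellMeasure n a b) +
        (1 / b ^ 2 * (∫ y, |W k (y, b) - U (y, b)| ∂gaussMeasure n) +
          1 / a ^ 2 * ∫ y, |W k (y, a) - U (y, a)| ∂gaussMeasure n) := fun k => by
    have h4 := integral_abs_homogeneity_le (h.temperate k) ha hab.le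
    have i1 : Integrable (fun y => |W k (y, b) / b ^ 2 - W k (y, a) / a ^ 2|) (gaussMeasure n) :=
      ((((hW k).integrable_slice b).div_const _).sub
        (((hW k).integrable_slice a).div_const _)).abs
    have i2 := (((hW k).sub hU).abs.integrable_slice b).const_mul (1 / b ^ 2)
    have i3 := (((hW k).sub hU).abs.integrable_slice a).const_mul (1 / a ^ 2)
    refine le_trans ?_ (add_le_add_left h4 _)
    rw [← integral_const_mul, ← integral_const_mul, ← integral_add i2 i3]
    have i23 : Integrable (fun y => 1 / b ^ 2 * |W k (y, b) - U (y, b)| +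
        1 / a ^ 2 * |W k (y, a) - U (y, a)|) (gaussMeasure n) := i2.add i3
    rw [← integral_add i1 i23]
    refine integral_mono iU (i1.add i23) fun y => ?_
    simp only
    have e1 : 1 / b ^ 2 * |W k (y, b) - U (y, b)| = |(W k (y, b) - U (y, b)) / b ^ 2| := by
      rw [abs_div, abs_of_pos (by positivity : 0 < b ^ 2)]; ring
    have e2 : 1 / a ^ 2 * |W k (y, a) - U (y, a)| = |(W k (y, a) - U (y, a)) / a ^ 2| := by
      rw [abs_div, abs_of_pos (by positivity : 0 < a ^ 2)]; ring
    rw [e1, e2]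
    have e3 : U (y, b) / b ^ 2 - U (y, a) / a ^ 2 = (W k (y, b) / b ^ 2 - W k (y, a) / a ^ 2) -
        (W k (y, b) - U (y, b)) / b ^ 2 + (W k (y, a) - U (y, a)) / a ^ 2 := by ring
    rw [e3]
    refine (abs_add_le _ _).trans ?_
    have := abs_sub (W k (y, b) / b ^ 2 - W k (y, a) / a ^ 2) ((W k (y, b) - U (y, b)) / b ^ 2)
    linarith
  have hlim := h2.add (((h3 b).const_mul (1 / b ^ 2)).add ((h3 a).const_mul (1 / a ^ 2)))
  simp only [mul_zero, add_zero] at hlim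
  have h0 : ∫ y, |U (y, b) / b ^ 2 - U (y, a) / a ^ 2| ∂gaussMeasure n = 0 :=
    le_antisymm (ge_of_tendsto' hlim hle) (integral_nonneg fun y => abs_nonneg _)
  rw [integral_eq_zero_iff_of_nonneg (fun y => abs_nonneg _) iU] at h0
  -- The Gaussian density is positive, so equality holds Lebesgue-almost everywhere, and continuity
  -- of `U` extends it to every `y`.
  have hae := volume_absolutelyContinuous_gaussMeasure.ae_eq h0
  have hc := h.continuous
  have := (Continuous.ae_eq_iff_eq volume
    (f := fun y => |U (y, b) / b ^ 2 - U (y, a) / a ^ 2|) (g := 0)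
    (by fun_prop) continuous_const).1 hae
  exact sub_eq_zero.1 (abs_eq_zero.1 (congrFun this y))

/-- The energy identity for the limit. -/
lemma Approximates.energy_identity (h : Approximates W f U Ui Us fun z => step (U z)) {a b : ℝ}
    (ha : 0 < a) (hab : a < b) :
    ∫ z, z.2⁻¹ * (4 * ((∑ i, Ui i z ^ 2) - z.2 ^ 2 * max (U z) 0)) ∂shellMeasure n a b =
      ∫ y, U (y, b) ^ 2 ∂gaussMeasure n - ∫ y, U (y, a) ^ 2 ∂gaussMeasure n := by
  have h1 := ((((h.lpLim_gradSq ha hab).sub le_rfl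
    (((h.lpLim a b).mul (h.lpLim_source ha hab)).snd_pow_mul ha 2)).const_mul
    4).inv_snd_mul ha).tendsto_integral
  have h2 : ∀ s, Tendsto (fun k => ∫ y, W k (y, s) ^ 2 ∂gaussMeasure n) atTop
      (𝓝 (∫ y, U (y, s) ^ 2 ∂gaussMeasure n)) := fun s => by
    simpa only [sq] using ((h.lpLim_slice s).mul (h.lpLim_slice s)).tendsto_integral
  simp only [mul_step] at h1
  refine tendsto_nhds_unique h1 (((h2 b).sub (h2 a)).congr fun k => ?_)
  exact (integral_shell_gradSq_sub (h.temperate k) (h.moderate k) (h.solves k) ha hab.le).symm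

/-- The Weiss functional without the gradient. -/
lemma Approximates.integral_weissN (h : Approximates W f U Ui Us fun z => step (U z)) {a b : ℝ}
    (ha : 0 < a) (hab : a < b) :
    ∫ z, weissN (fun x => max x 0) U (fun z => ∑ i, Ui i z ^ 2) z ∂shellMeasure n a b =
      (∫ y, U (y, b) ^ 2 ∂gaussMeasure n - ∫ y, U (y, a) ^ 2 ∂gaussMeasure n) / 2 -
      ∫ z, z.2⁻¹ * (2 * (U z ^ 2 + z.2 ^ 2 * max (U z) 0)) ∂shellMeasure n a b := by
  have hU := h.moderate_lim
  have hP : Moderate fun z => max (U z) 0 :=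
    hU.mono (hU.continuous.max continuous_const) fun z => by
      rw [abs_of_nonneg (le_max_right _ _)]
      exact max_le (le_abs_self _) (abs_nonneg _)
  have i1 := memLp_one_iff_integrable.1 ((((h.lpLim_gradSq ha hab).sub le_rfl
    (((h.lpLim a b).mul (h.lpLim_source ha hab)).snd_pow_mul ha 2)).const_mul
    4).inv_snd_mul ha).memLp_lim
  simp only [mul_step] at i1
  have i2 := ((hU.sq.add (Moderate.snd.sq.mul hP)).const_mul 2).integrable_inv_mul ha b
  -- Half of the energy integrand is `(2/s)(|∇U|² - s² max(U, 0))`; it accounts for the whole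
  -- gradient term of `weissN`.
  rw [← h.energy_identity ha hab, div_eq_inv_mul, ← integral_const_mul,
    ← integral_sub (i1.const_mul _) i2]
  refine integral_congr_ae (Eventually.of_forall fun z => ?_)
  simp only [weissN]; ring

/-- The Weiss functional of a homogeneous solution is constant. -/
lemma Approximates.weissAverage_of_homogeneous
    (h : Approximates W f U Ui Us fun z => step (U z))
    (hhom : ∀ y s, 0 < s → U (y, s) = s ^ 2 * U (y, 1)) {r : ℝ} (hr : 0 < r) :
    weissAverage U Ui r = -(15 / 2) * ∫ y, max (U (y, 1)) 0 ∂gaussMeasure n := by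
  have hU := h.moderate_lim
  have hP : Moderate fun z => max (U z) 0 :=
    hU.mono (hU.continuous.max continuous_const) fun z => by
      rw [abs_of_nonneg (le_max_right _ _)]
      exact max_le (le_abs_self _) (abs_nonneg _)
  set A := ∫ y, U (y, 1) ^ 2 ∂gaussMeasure n with hA
  set P := ∫ y, max (U (y, 1)) 0 ∂gaussMeasure n with hPd
  have hA' : ∀ s, 0 < s → ∫ y, U (y, s) ^ 2 ∂gaussMeasure n = s ^ 4 * A := fun s hs => by
    rw [hA, ← integral_const_mul]
    refine integral_congr_ae (Eventually.of_forall fun y => ?_)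
    simp only [hhom y s hs]; ring
  have hP' : ∀ s, 0 < s → ∫ y, max (U (y, s)) 0 ∂gaussMeasure n = s ^ 2 * P := fun s hs => by
    rw [hPd, ← integral_const_mul]
    refine integral_congr_ae (Eventually.of_forall fun y => ?_)
    simp only [hhom y s hs]
    rw [mul_max_of_nonneg _ _ (by positivity), mul_zero]
  rw [weissAverage, h.integral_weissN hr (by linarith), hA' _ hr, hA' _ (by linarith),
    ((hU.sq.add (Moderate.snd.sq.mul hP)).const_mul 2).integral_inv_mul hr (by linarith)]
  -- The boundary terms give `(16 - 1) r⁴ A / 2`, and this integral is `(15/2) r⁴ (A + P)`; the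
  -- terms with `A` cancel.
  have e : ∫ s in r..(2 * r), s⁻¹ * ∫ y, 2 * (U (y, s) ^ 2 + s ^ 2 * max (U (y, s)) 0)
      ∂gaussMeasure n = ∫ s in r..(2 * r), (2 * (A + P)) * s ^ 3 := by
    refine intervalIntegral.integral_congr fun s hs => ?_
    rw [uIcc_of_le (by linarith)] at hs
    have hs0 : 0 < s := lt_of_lt_of_le hr hs.1
    rw [integral_const_mul, integral_add (hU.sq.integrable_slice s)
      ((hP.integrable_slice s).const_mul _), integral_const_mul, hA' s hs0, hP' s hs0]
    field_simp
  simp only at e ⊢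
  rw [e, intervalIntegral.integral_const_mul, integral_pow]
  field_simp
  push_cast
  ring

/-- The Weiss functional is bounded below if `U` has quadratic growth. -/
lemma Approximates.exists_le_weissAverage
    (h : Approximates W f U Ui Us fun z => step (U z)) {C : ℝ}
    (hC : ∀ y s, 0 < s → |U (y, s)| ≤ C * s ^ 2 * (1 + ‖y‖) ^ 2) :
    ∃ c, ∀ r, 0 < r → c ≤ weissAverage U Ui r := by
  have hC0 : 0 ≤ C := by simpa using (abs_nonneg _).trans (hC 0 1 one_pos)
  set M := ∫ y : EuclideanSpace ℝ (Fin n), (1 + ‖y‖) ^ 4 ∂gaussMeasure n with hM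
  -- Without the gradient, `weissN` is at least `-(2C² + 4C) s³ (1 + |y|)⁴`. The `8` comes from `s ≤
  -- 2r`, and the length `r` of the interval completes `r³` to `r⁴`.
  refine ⟨-(8 * (2 * C ^ 2 + 4 * C)) * M, fun r hr => ?_⟩
  have hm : Moderate fun z : SpaceTime n => -(8 * (2 * C ^ 2 + 4 * C)) * r ^ 3 * (1 + ‖z.1‖) ^ 4 := by
    refine Moderate.const_mul ⟨by fun_prop, 4, 1, fun z => ?_⟩ _
    rw [abs_of_nonneg (by positivity), one_mul]
    gcongr
    exact norm_fst_le z
  have hN : Integrable (weissN (fun x => max x 0) U (fun z => ∑ i, Ui i z ^ 2))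
      (shellMeasure n r (2 * r)) := by
    have hab : r < 2 * r := by linarith
    have hU := h.moderate_lim
    have hP : Moderate fun z => max (U z) 0 :=
      hU.mono (hU.continuous.max continuous_const) fun z => by
        rw [abs_of_nonneg (le_max_right _ _)]
        exact max_le (le_abs_self _) (abs_nonneg _)
    exact memLp_one_iff_integrable.1 (LpLim.weissN (β := fun _ x => max x 0)
      (β' := fun x => max x 0) hr
      (.const (hU.memLp_two r (2 * r))) (.const (h.lpLim_gradSq hr hab).memLp_lim)
      (.const (hP.memLp_two r (2 * r)))).memLp_lim
  have h1 : ∫ z, -(8 * (2 * C ^ 2 + 4 * C)) * r ^ 3 * (1 + ‖z.1‖) ^ 4 ∂shellMeasure n r (2 * r) =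
      r ^ 4 * (-(8 * (2 * C ^ 2 + 4 * C)) * M) := by
    rw [hm.integral_shell]
    simp only [integral_const_mul, ← hM]
    simp [show 2 * r - r = r by ring, hr.le]
    ring
  have h2 : r ^ 4 * (-(8 * (2 * C ^ 2 + 4 * C)) * M) ≤
      ∫ z, weissN (fun x => max x 0) U (fun z => ∑ i, Ui i z ^ 2) z ∂shellMeasure n r (2 * r) := by
    rw [← h1]
    refine integral_mono_ae (hm.integrable_shell _ _) hN ?_
    filter_upwards [ae_shell_mem r (2 * r)] with z hz
    have hs : 0 < z.2 := hr.trans hz.1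
    have hb := hC z.1 z.2 hs
    set q := 1 + ‖z.1‖ with hq
    have hq1 : 1 ≤ q := by simp [hq]
    have e1 : U z ^ 2 ≤ C ^ 2 * z.2 ^ 4 * q ^ 4 := by
      calc U z ^ 2 = |U z| ^ 2 := (sq_abs _).symm
        _ ≤ (C * z.2 ^ 2 * q ^ 2) ^ 2 := by gcongr
        _ = _ := by ring
    have e2 : z.2 ^ 2 * max (U z) 0 ≤ C * z.2 ^ 4 * q ^ 4 := by
      have : max (U z) 0 ≤ C * z.2 ^ 2 * q ^ 2 :=
        max_le ((le_abs_self _).trans hb) (by positivity)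
      have hq2 : q ^ 2 ≤ q ^ 4 := pow_le_pow_right₀ hq1 (by norm_num)
      calc z.2 ^ 2 * max (U z) 0 ≤ z.2 ^ 2 * (C * z.2 ^ 2 * q ^ 4) := by
            refine mul_le_mul_of_nonneg_left (this.trans ?_) (by positivity)
            gcongr
        _ = _ := by ring
    have e3 : 0 ≤ ∑ i, Ui i z ^ 2 := Finset.sum_nonneg fun i _ => sq_nonneg _
    have e4 : z.2 ^ 3 ≤ 8 * r ^ 3 := by
      calc z.2 ^ 3 ≤ (2 * r) ^ 3 := pow_le_pow_left₀ hs.le hz.2.le 3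
        _ = _ := by ring
    have e5 : z.2⁻¹ * (-(2 * C ^ 2 + 4 * C) * z.2 ^ 4 * q ^ 4) =
        -((2 * C ^ 2 + 4 * C) * q ^ 4 * z.2 ^ 3) := by field_simp
    calc -(8 * (2 * C ^ 2 + 4 * C)) * r ^ 3 * q ^ 4
        = -((2 * C ^ 2 + 4 * C) * q ^ 4 * (8 * r ^ 3)) := by ring
      _ ≤ -((2 * C ^ 2 + 4 * C) * q ^ 4 * z.2 ^ 3) :=
          neg_le_neg (mul_le_mul_of_nonneg_left e4 (by positivity))
      _ = z.2⁻¹ * (-(2 * C ^ 2 + 4 * C) * z.2 ^ 4 * q ^ 4) := e5.symm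
      _ ≤ _ := by
          rw [weissN]
          refine mul_le_mul_of_nonneg_left ?_ (by positivity)
          linarith
  rw [weissAverage, one_div, ← div_eq_inv_mul, le_div_iff₀ (by positivity)]
  linarith

/-! ### The given solution in self-similar coordinates -/

section Solution

variable {u : SpaceTime n → ℝ} {Du : SpaceTime n → EuclideanSpace ℝ (Fin n)}
  {D2u : Fin n → Fin n → SpaceTime n → ℝ} {ut : SpaceTime n → ℝ}

/-- A point lies in `Q_R` only for `R` strictly larger than its parabolic norm, hence the passage `ε
→ 0`. The origin forces `C ≥ 0`. -/
lemma QuadraticGrowth.exists_bound (h : QuadraticGrowth u) :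
    ∃ C, 0 ≤ C ∧ ∀ z, |u z| ≤ C * (‖z.1‖ + √|z.2|) ^ 2 := by
  obtain ⟨C, hC⟩ := h
  refine ⟨C, ?_, fun z => ?_⟩
  · have := (abs_nonneg _).trans (hC 1 one_pos 0 (by simp [paraCyl]))
    simpa using this
  · have hc : Continuous fun ε : ℝ => C * (‖z.1‖ + √|z.2| + ε) ^ 2 := by fun_prop
    have ht : Tendsto (fun ε : ℝ => C * (‖z.1‖ + √|z.2| + ε) ^ 2) (𝓝[>] 0)
        (𝓝 (C * (‖z.1‖ + √|z.2|) ^ 2)) := by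
      simpa using (hc.tendsto 0).mono_left nhdsWithin_le_nhds
    refine ge_of_tendsto ht ?_
    filter_upwards [self_mem_nhdsWithin] with ε (hε : 0 < ε)
    exact hC _ (by positivity) z (by simp only [paraCyl, mem_ofPred_eq]; linarith)

/-- The spatial gradient in self-similar coordinates. -/
noncomputable def selfSimGrad (Du : SpaceTime n → EuclideanSpace ℝ (Fin n)) (i : Fin n)
    (z : SpaceTime n) : ℝ := z.2 * Du (selfSimMap z) i

/-- The `s`-derivative in self-similar coordinates. -/
noncomputable def selfSimTime (Du : SpaceTime n → EuclideanSpace ℝ (Fin n))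
    (ut : SpaceTime n → ℝ) (z : SpaceTime n) : ℝ :=
  ∑ i, z.1 i * Du (selfSimMap z) i - 2 * z.2 * ut (selfSimMap z)

lemma measurable_step : Measurable step :=
  Measurable.ite measurableSet_Ioi measurable_const measurable_const

lemma abs_step_le (x : ℝ) : |step x| ≤ 1 := by
  unfold step; split_ifs <;> simp

lemma norm_selfSimMap_le (z : SpaceTime n) : ‖selfSimMap z‖ ≤ ‖z‖ ^ 2 := by
  have h1 : ‖z.1‖ ≤ ‖z‖ := norm_fst_le z
  have h2 : ‖z.2‖ ≤ ‖z‖ := norm_snd_le z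
  rw [Prod.norm_def, selfSimMap]
  refine max_le ?_ ?_
  · rw [norm_smul, sq]; gcongr
  · rw [norm_neg, norm_pow]; gcongr

/-- Mollifications of a solution approximate it in self-similar coordinates. -/
lemma approximates_mollify (hsol : IsGlobalSolution u Du D2u ut) (hgrowth : QuadraticGrowth u) :
    Approximates (fun k z => mollify (shrinkingBump n k) u (selfSimMap z))
      (fun k z => mollify (shrinkingBump n k) (fun w => step (u w)) (selfSimMap z))
      (fun z => u (selfSimMap z)) (selfSimGrad Du) (selfSimTime Du ut)
      (fun z => step (u (selfSimMap z))) := by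
  obtain ⟨C, hC0, hC⟩ := QuadraticGrowth.exists_bound hgrowth
  have hu2 : ∀ z, |u z| ≤ 4 * C * (1 + ‖z‖) ^ 2 := fun z => by
    have h1 : ‖z.1‖ ≤ ‖z‖ := norm_fst_le z
    have h2 : |z.2| ≤ ‖z‖ := norm_snd_le z
    have h3 : √|z.2| ≤ 1 + ‖z‖ := by
      refine Real.sqrt_le_iff.2 ⟨by positivity, ?_⟩
      nlinarith [norm_nonneg z]
    calc |u z| ≤ C * (‖z.1‖ + √|z.2|) ^ 2 := hC z
      _ ≤ C * (2 * (1 + ‖z‖)) ^ 2 := by gcongr; linarith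
      _ = _ := by ring
  have hui : LocallyIntegrable u := hsol.continuous.locallyIntegrable
  have hχi : LocallyIntegrable (fun w => step (u w)) :=
    (locallyIntegrable_const (1 : ℝ)).mono
      (measurable_step.comp hsol.continuous.measurable).aestronglyMeasurable
      (Eventually.of_forall fun z => by simpa using abs_step_le (u z))
  have hw : ∀ k, (mollify (shrinkingBump n k) u).HasTemperateGrowth := fun k =>
    temperate_mollify _ hui hu2
  have hf : ∀ k, (mollify (shrinkingBump n k) (fun w => step (u w))).HasTemperateGrowth :=
    fun k => temperate_mollify (k := 0) (C := 1) _ hχi fun z => by simpa using abs_step_le (u z)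
  have hX : ∀ k i, pd (dirX i) (mollify (shrinkingBump n k) u) =
      mollify (shrinkingBump n k) fun z => Du z i := fun k i => pd_mollify _ (hsol.weak_gradient i)
  have hT : ∀ k, pd (dirT n) (mollify (shrinkingBump n k) u) =
      mollify (shrinkingBump n k) ut := fun k => pd_mollify _ hsol.weak_time
  have hq := fun a b (ha : 0 < a) (hab : a < b) =>
    quasiMeasurePreserving_selfSimMap (n := n) ha (ha.trans hab).le
  refine ⟨fun k => temperate_selfSim (hw k), fun k => .of_hasTemperateGrowth
    (temperate_selfSim (hf k)), fun k z => abs_mollify_le _ fun y _ => abs_step_le _, fun k => ?_,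
    hsol.continuous.comp continuous_selfSimMap, ?_,
    fun z => tendsto_mollify hsol.continuous _, fun i a b ha hab => ?_, fun a b ha hab => ?_,
    fun a b ha hab => (hq a b ha hab).ae (ae_tendsto_mollify hχi)⟩
  · refine solvesSelfSimilar_of_heat (hw k) fun z => ?_
    have hXX : ∀ i, pd (dirX i) (pd (dirX i) (mollify (shrinkingBump n k) u)) =
        mollify (shrinkingBump n k) (D2u i i) := fun i => by
      rw [hX, pd_mollify _ (hsol.weak_hessian i i)]
    simp only [hXX, hT]
    refine mollify_sub_sum _ hsol.weak_time.locInt_deriv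
      (fun i => (hsol.weak_hessian i i).locInt_deriv) ?_ z
    filter_upwards [hsol.equation] with z hz
    rw [hz]
    simp [indicator, step]
  -- All mollification radii are at most `1`, which turns `1 + ‖·‖` into `2 + ‖·‖`. The coordinates
  -- grow quadratically, so the majorant has degree `4`.
  · refine ⟨fun z => 4 * C * (2 + ‖selfSimMap z‖) ^ 2, ⟨?_, 4, 16 * C, fun z => ?_⟩,
      fun k z => abs_mollify_le _ fun y hy => (hu2 y).trans ?_⟩
    · have := continuous_selfSimMap (n := n)
      fun_prop
    · have h1 := norm_selfSimMap_le z
      rw [abs_of_nonneg (by positivity)]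
      calc 4 * C * (2 + ‖selfSimMap z‖) ^ 2 ≤ 4 * C * (2 * (1 + ‖z‖) ^ 2) ^ 2 := by
            gcongr
            nlinarith [norm_nonneg z]
        _ = _ := by ring
    · have h1 : ‖selfSimMap z - y‖ < 1 := hy.trans_le (shrinkingBump_rOut_le k)
      have h2 : ‖y‖ ≤ ‖selfSimMap z‖ + ‖selfSimMap z - y‖ := by
        rw [norm_sub_rev]; exact norm_le_norm_add_norm_sub' _ _
      have h3 : 1 + ‖y‖ ≤ 2 + ‖selfSimMap z‖ := by linarith
      exact mul_le_mul_of_nonneg_left (pow_le_pow_left₀ (by positivity) h3 2) (by positivity)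
  · filter_upwards [(hq a b ha hab).ae (ae_tendsto_mollify (hsol.weak_gradient i).locInt_deriv)]
      with z hz
    simp only [pd_dirX_selfSim (temperate_differentiable (hw _)), hX]
    exact hz.const_mul _
  · have hall := ae_all_iff.2 fun i : Fin n =>
      (hq a b ha hab).ae (ae_tendsto_mollify (hsol.weak_gradient i).locInt_deriv)
    filter_upwards [hall, (hq a b ha hab).ae (ae_tendsto_mollify hsol.weak_time.locInt_deriv)]
      with z hz1 hz2
    simp only [pd_dirT_selfSim (temperate_differentiable (hw _)), hX, hT]
    exact (tendsto_finsetSum _ fun i _ => (hz1 i).const_mul _).sub (hz2.const_mul _)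

lemma aestronglyMeasurable_grad (hsol : IsGlobalSolution u Du D2u ut) :
    AEStronglyMeasurable Du := by
  have h : AEStronglyMeasurable fun z => (EuclideanSpace.equiv (Fin n) ℝ) (Du z) :=
    (aemeasurable_pi_iff.2 fun i => by
      simpa using (hsol.weak_gradient i).locInt_deriv.aestronglyMeasurable.aemeasurable
      ).aestronglyMeasurable
  have h2 := (EuclideanSpace.equiv (Fin n) ℝ).symm.continuous.comp_aestronglyMeasurable h
  simpa using h2

lemma aestronglyMeasurable_snd : AEStronglyMeasurable fun z : SpaceTime n => z.2 :=
  continuous_snd.aestronglyMeasurable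

lemma sum_selfSimGrad_sq (z : SpaceTime n) :
    ∑ i, selfSimGrad Du i z ^ 2 = z.2 ^ 2 * ‖Du (selfSimMap z)‖ ^ 2 := by
  rw [EuclideanSpace.real_norm_sq_eq, Finset.mul_sum]
  exact Finset.sum_congr rfl fun i _ => by rw [selfSimGrad]; ring

/-- With `∇U = s ∇u` and `t = -s²`, the weight `2s` turns `|∇u|²` into `(2/s)|∇U|²` and `u²/t` into
`-(2/s) U²`. -/
lemma weissPsi_eq (hsol : IsGlobalSolution u Du D2u ut) {r : ℝ} (hr : 0 < r) :
    weissPsi u Du r = weissAverage (fun z => u (selfSimMap z)) (selfSimGrad Du) r := by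
  have hDu := aestronglyMeasurable_grad hsol
  have hu := hsol.continuous.aestronglyMeasurable (μ := volume)
  rw [weissPsi, weissAverage, integral_strip hr
    (f := fun z => ‖Du z‖ ^ 2 - 2 * max (u z) 0 + u z ^ 2 / z.2)]
  · congr 1
    refine integral_congr_ae ?_
    filter_upwards [ae_shell_mem r (2 * r)] with z hz
    have hs : z.2 ≠ 0 := (hr.trans hz.1).ne'
    simp only [weissN, sum_selfSimGrad_sq]
    have : (selfSimMap z).2 = -z.2 ^ 2 := rfl
    rw [this]
    field_simp
    ring
  · exact ((hDu.norm.pow 2).sub ((hu.sup aestronglyMeasurable_const).const_mul 2)).add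
      ((hu.pow 2).aemeasurable.div aestronglyMeasurable_snd.aemeasurable).aestronglyMeasurable

/-- The density of the derivative of the Weiss functional without the kernel. -/
noncomputable def weissSquare (u : SpaceTime n → ℝ) (Du : SpaceTime n → EuclideanSpace ℝ (Fin n))
    (ut : SpaceTime n → ℝ) (z : SpaceTime n) : ℝ :=
  1 / (-z.2) * (2 * z.2 * ut z + inner ℝ (Du z) z.1 - 2 * u z) ^ 2

lemma aestronglyMeasurable_weissSquare (hsol : IsGlobalSolution u Du D2u ut) :
    AEStronglyMeasurable (weissSquare u Du ut) := by
  have hDu := aestronglyMeasurable_grad hsol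
  have hu := hsol.continuous.aestronglyMeasurable (μ := volume)
  have hut := hsol.weak_time.locInt_deriv.aestronglyMeasurable
  have hs := aestronglyMeasurable_snd (n := n)
  unfold weissSquare
  exact (aemeasurable_const.div hs.neg.aemeasurable).aestronglyMeasurable.mul
    (((((hs.const_mul 2).mul hut).add (hDu.inner continuous_fst.aestronglyMeasurable)).sub
      (hu.const_mul 2)).pow 2)

/-- At `(x, t) = (s y, -s²)` one has `s U_s = ⟨∇u, x⟩ + 2t u_t` and `2s/(-t) = 2/s`. -/
lemma weissSquare_selfSimMap {z : SpaceTime n} (hz : 0 < z.2) :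
    2 * z.2 * weissSquare u Du ut (selfSimMap z) =
      z.2⁻¹ * (2 * (z.2 * selfSimTime Du ut z - 2 * u (selfSimMap z)) ^ 2) := by
  have h1 : inner ℝ (Du (selfSimMap z)) (selfSimMap z).1 =
      z.2 * ∑ i, z.1 i * Du (selfSimMap z) i := by
    simp only [selfSimMap, inner_smul_right]
    simp [PiLp.inner_apply]
  have h2 : (selfSimMap z).2 = -z.2 ^ 2 := rfl
  rw [weissSquare, h1, h2, selfSimTime]
  field_simp
  ring

lemma integral_weissDensity_eq (hsol : IsGlobalSolution u Du D2u ut) {r : ℝ} (hr : 0 < r) :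
    ∫ z in strip n r, weissDensity u Du ut z = ∫ z, z.2⁻¹ * (2 *
      (z.2 * selfSimTime Du ut z - 2 * u (selfSimMap z)) ^ 2) ∂shellMeasure n r (2 * r) := by
  refine (integral_strip hr (aestronglyMeasurable_weissSquare hsol)).trans ?_
  refine integral_congr_ae ?_
  filter_upwards [ae_shell_mem r (2 * r)] with z hz
  exact weissSquare_selfSimMap (hr.trans hz.1)

end Solution

end WeissMonotonicity

/-! ### The monotonicity theorem -/

open WeissMonotonicity

theorem propositionp (n : ℕ) (u : SpaceTime n → ℝ)
    (Du : SpaceTime n → EuclideanSpace ℝ (Fin n)) (D2u : Fin n → Fin n → SpaceTime n → ℝ)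
    (ut : SpaceTime n → ℝ)
    (hsol : IsGlobalSolution u Du D2u ut) (hgrowth : QuadraticGrowth u) :
    -- all integrals converge absolutely
    (∀ r : ℝ, 0 < r →
      IntegrableOn (fun z => ‖Du z‖ ^ 2 * backwardHeatKernel z) (strip n r) ∧
      IntegrableOn (fun z => max (u z) 0 * backwardHeatKernel z) (strip n r) ∧
      IntegrableOn (fun z => u z ^ 2 / z.2 * backwardHeatKernel z) (strip n r) ∧
      IntegrableOn (weissDensity u Du ut) (strip n r)) ∧
    -- the derivative formula and its sign
    (∀ r : ℝ, 0 < r →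
      HasDerivAt (weissPsi u Du) (1 / r ^ 5 * ∫ z in strip n r, weissDensity u Du ut z) r ∧
      0 ≤ 1 / r ^ 5 * ∫ z in strip n r, weissDensity u Du ut z) ∧
    -- monotonicity and the existence of a finite limit at zero
    MonotoneOn (weissPsi u Du) (Ioi 0) ∧
    (∃ L : ℝ, Tendsto (weissPsi u Du) (𝓝[>] 0) (𝓝 L)) ∧
    -- the case of equality
    ((∃ c : ℝ, ∀ r : ℝ, 0 < r → weissPsi u Du r = c) ↔
      ∀ r : ℝ, 0 < r → ∀ (x : EuclideanSpace ℝ (Fin n)) (t : ℝ), t < 0 →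
        u (r • x, r ^ 2 * t) = r ^ 2 * u (x, t)) := by
  have happ := approximates_mollify hsol hgrowth
  have hDu := aestronglyMeasurable_grad hsol
  have hu := hsol.continuous.aestronglyMeasurable (μ := volume)
  have hU := happ.moderate_lim
  have hder : ∀ r : ℝ, 0 < r →
      HasDerivAt (weissPsi u Du) (1 / r ^ 5 * ∫ z in strip n r, weissDensity u Du ut z) r := by
    intro r hr
    rw [integral_weissDensity_eq hsol hr]
    refine (happ.hasDerivAt_weissAverage hr).congr_of_eventuallyEq ?_
    filter_upwards [Ioi_mem_nhds hr] with x hx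
    exact weissPsi_eq hsol hx
  have hnn : ∀ r : ℝ, 0 < r → 0 ≤ 1 / r ^ 5 * ∫ z in strip n r, weissDensity u Du ut z := by
    intro r hr
    rw [integral_weissDensity_eq hsol hr]
    exact mul_nonneg (by positivity) (integral_nonneg_of_ae (sq_dev_nonneg r (2 * r) hr))
  have hmono : MonotoneOn (weissPsi u Du) (Ioi 0) := by
    refine monotoneOn_of_deriv_nonneg (convex_Ioi 0)
      (fun r hr => (hder r hr).continuousAt.continuousWithinAt)
      (fun r hr => ?_) fun r hr => ?_
    all_goals rw [interior_Ioi] at hr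
    · exact (hder r hr).differentiableAt.differentiableWithinAt
    · rw [(hder r hr).deriv]
      exact hnn r hr
  have hUs : ∀ (y : EuclideanSpace ℝ (Fin n)) (s : ℝ), u (selfSimMap (y, s)) = u (s • y, -s ^ 2) :=
    fun y s => rfl
  refine ⟨fun r hr => ?_, fun r hr => ⟨hder r hr, hnn r hr⟩, hmono, ?_, ?_, fun hhom => ?_⟩
  · have hab : r < 2 * r := by linarith
    have hG := memLp_one_iff_integrable.1 (happ.lpLim_gradSq hr hab).memLp_lim
    refine ⟨integrableOn_strip hr (hDu.norm.pow 2) ?_,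
      integrableOn_strip hr (hu.sup aestronglyMeasurable_const) ?_,
      integrableOn_strip hr ((hu.pow 2).aemeasurable.div aestronglyMeasurable_snd.aemeasurable).aestronglyMeasurable ?_, ?_⟩
    · have h := memLp_one_iff_integrable.1
        (((happ.lpLim_gradSq hr hab).inv_snd_mul hr).const_mul 2).memLp_lim
      refine h.congr ?_
      filter_upwards [ae_shell_mem r (2 * r)] with z hz
      have hs : z.2 ≠ 0 := (hr.trans hz.1).ne'
      simp only [sum_selfSimGrad_sq]
      change _ = 2 * z.2 * ‖Du (selfSimMap z)‖ ^ 2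
      field_simp
    · have hP : Moderate fun z => max (u (selfSimMap z)) 0 :=
        hU.mono (hU.continuous.max continuous_const) fun z => by
          rw [abs_of_nonneg (le_max_right _ _)]
          exact max_le (le_abs_self _) (abs_nonneg _)
      exact ((Moderate.snd.const_mul 2).mul hP).integrable_shell _ _
    · have h := (hU.sq.const_mul (-2)).integrable_inv_mul hr (2 * r)
      refine h.congr ?_
      filter_upwards [ae_shell_mem r (2 * r)] with z hz
      have hs : z.2 ≠ 0 := (hr.trans hz.1).ne'
      change _ = 2 * z.2 * (u (selfSimMap z) ^ 2 / -z.2 ^ 2)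
      field_simp
    · refine integrableOn_strip hr (aestronglyMeasurable_weissSquare hsol) ?_
      refine (happ.integrable_sq_dev hr hab).congr ?_
      filter_upwards [ae_shell_mem r (2 * r)] with z hz
      exact (weissSquare_selfSimMap (hr.trans hz.1)).symm
  · obtain ⟨C, -, hC⟩ := QuadraticGrowth.exists_bound hgrowth
    obtain ⟨c, hc⟩ := happ.exists_le_weissAverage (C := C) fun y s hs => by
      refine (hC _).trans (le_of_eq ?_)
      simp only [selfSimMap]
      rw [norm_smul, Real.norm_of_nonneg hs.le, abs_neg, abs_of_pos (by positivity),
        Real.sqrt_sq hs.le]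
      ring
    refine ⟨_, MonotoneOn.tendsto_nhdsGT hmono ⟨c, ?_⟩⟩
    rintro _ ⟨r, hr, rfl⟩
    rw [weissPsi_eq hsol hr]
    exact hc r hr
  · rintro ⟨c, hc⟩
    have hz : ∀ r, 0 < r → ∀ᵐ z ∂shellMeasure n r (2 * r),
        z.2 * selfSimTime Du ut z - 2 * u (selfSimMap z) = 0 := fun r hr => by
      have h1 : HasDerivAt (weissPsi u Du) 0 r :=
        (hasDerivAt_const r c).congr_of_eventuallyEq (by
          filter_upwards [Ioi_mem_nhds hr] with x hx using hc x hx)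
      have h2 := (hder r hr).unique h1
      rw [integral_weissDensity_eq hsol hr] at h2
      have h3 := (mul_eq_zero.1 h2).resolve_left (by positivity)
      rw [integral_eq_zero_iff_of_nonneg_ae (sq_dev_nonneg r (2 * r) hr)
        (happ.integrable_sq_dev hr (by linarith))] at h3
      filter_upwards [h3, ae_shell_mem r (2 * r)] with z hz hm
      have hs : z.2 ≠ 0 := (hr.trans hm.1).ne'
      simpa [hs] using hz
    -- The deviation is known to vanish on shells `(a, 2a)`, which compares radii of ratio at most
    -- `2`; `hglob` removes this bound by repeated halving of `b`.
    have hloc : ∀ (y : EuclideanSpace ℝ (Fin n)) (a b : ℝ), 0 < a → a ≤ b → b ≤ 2 * a →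
        u (selfSimMap (y, b)) / b ^ 2 = u (selfSimMap (y, a)) / a ^ 2 := by
      intro y a b ha hab hb
      rcases hab.eq_or_lt with rfl | hab
      · rfl
      exact happ.homogeneous_of_dev_eq_zero ha hab
        (ae_mono (shellMeasure_mono le_rfl hb) (hz a ha)) y
    have hglob : ∀ (k : ℕ) (y : EuclideanSpace ℝ (Fin n)) (a b : ℝ), 0 < a → a ≤ b →
        b ≤ 2 ^ k * a → u (selfSimMap (y, b)) / b ^ 2 = u (selfSimMap (y, a)) / a ^ 2 := by
      intro k
      induction k with
      | zero =>
        intro y a b ha hab hb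
        exact hloc y a b ha hab (by linarith)
      | succ k ih =>
        intro y a b ha hab hb
        by_cases h2 : b ≤ 2 * a
        · exact hloc y a b ha hab h2
        · have hb2 : a ≤ b / 2 := by linarith
          rw [hloc y (b / 2) b (by linarith) (by linarith) (by linarith)]
          exact ih y a (b / 2) ha hb2 (by rw [pow_succ] at hb; linarith)
    have hall : ∀ (y : EuclideanSpace ℝ (Fin n)) (a b : ℝ), 0 < a → a ≤ b →
        u (selfSimMap (y, b)) / b ^ 2 = u (selfSimMap (y, a)) / a ^ 2 := by
      intro y a b ha hab
      obtain ⟨k, hk⟩ := pow_unbounded_of_one_lt (b / a) one_lt_two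
      exact hglob k y a b ha hab ((div_le_iff₀ ha).1 hk.le)
    intro r hr x t ht
    -- Every `(x, t)` with `t < 0` has coordinates `(x/s, s)`, and parabolic scaling by `r` only
    -- changes `s` to `r s`.
    set s := √(-t) with hs
    have hs0 : 0 < s := Real.sqrt_pos.2 (by linarith)
    have hst : -s ^ 2 = t := by rw [hs, Real.sq_sqrt (by linarith), neg_neg]
    have e1 : u (selfSimMap (s⁻¹ • x, s)) = u (x, t) := by
      rw [hUs, smul_inv_smul₀ hs0.ne', hst]
    have e2 : u (selfSimMap (s⁻¹ • x, r * s)) = u (r • x, r ^ 2 * t) := by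
      rw [hUs, mul_smul, smul_inv_smul₀ hs0.ne', ← hst]
      congr 2; ring
    have e3 : u (selfSimMap (s⁻¹ • x, r * s)) / (r * s) ^ 2 =
        u (selfSimMap (s⁻¹ • x, s)) / s ^ 2 := by
      rcases le_total s (r * s) with h | h
      · exact hall _ _ _ hs0 h
      · exact (hall _ _ _ (by positivity) h).symm
    rw [e1, e2, div_eq_div_iff (by positivity) (by positivity)] at e3
    have : s ^ 2 ≠ 0 := by positivity
    refine mul_right_cancel₀ this ?_
    rw [e3]; ring
  · refine ⟨_, fun r hr => (weissPsi_eq hsol hr).trans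
      (happ.weissAverage_of_homogeneous (fun y s hs => ?_) hr)⟩
    -- The point `(y, -1)` has self-similar coordinates `(y, 1)`.
    have := hhom s hs y (-1) (by norm_num)
    simp only [hUs, one_smul, one_pow]
    rw [← this]
    congr 2; ring
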